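/- Consider the physically degraded Gaussian relay channel with state known at the relay. Let $P_1>0$, $P_2\ge 0$, $Q\ge 0$ and $0<N_2\le N_3$. At time $i=1,\dots,n$ the relay and the destination receive $$Y_{2,i}=X_{1,i}+S_i+Z_{2,i},\qquad Y_{3,i}=X_{2,i}+Y_{2,i}+Z'_{3,i},$$ where $S_i,Z_{2,i},Z'_{3,i}$ $(1\le i\le n)$ are independent centred Gaussian variables of variances $Q$, $N_2$ and $N_3-N_2$. The source input $X_1^n$ is a function of a uniformly distributed message. The relay input $X_{2,i}$ is a function of the whole state sequence $S^n$ and of $Y_{2,1},\dots,Y_{2,i-1}$. The destination estimates the message from $Y_3^n$. The inputs satisfy $\sum_i X_{1,i}^2\le nP_1$ and $\sum_i X_{2,i}^2\le nP_2$. A rate $R$ is achievable if there are codes with at least $e^{nR}$ messages whose average error probability tends to $0$ as $n\to\infty$. The capacity $\mathcal C$ is the supremum of the achievable rates; logarithms are natural. **1)** For $\zeta\in[-1,0]$ put $$T(\zeta)=\frac{P_1N_3\,(P_2+Q+N_3+2\zeta\sqrt{P_2Q})}{P_1N_3+P_2(1-\zeta^2)(P_1+P_2+Q+N_3+2\zeta\sqrt{P_2Q})}.$$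 If $N_2\ge T(\zeta)$ for some $\zeta\in[-1,0]$ (that is, if $N_2\ge\min_{\zeta\in[-1,0]}T(\zeta)$), and so in particular if $N_2\ge\max_{\zeta\in[-1,0]}T(\zeta)$, then $$\mathcal C=\tfrac12\log\Big(1+\frac{P_1}{N_2}\Big).$$ This is also the capacity when $S^n$ is known non-causally to the source as well as to the relay, and the capacity when there is no state ($Q=0$). **2)** For $\rho_{12}\in[0,1]$ and $\rho_{2s}\in[-1,0]$ with $\rho_{12}^2+\rho_{2s}^2\le 1$, let $\lambda=1-\frac{\rho_{12}^2}{1-\rho_{2s}^2}$ if $\rho_{2s}\ne-1$, let $\lambda=1$ if $\rho_{2s}=-1$, and put $$F_g(\rho_{12},\rho_{2s})=\min\Big\{\tfrac12\log(1+P_1\lambda g),\ \tfrac12\log\Big(1+\tfrac{(\sqrt{P_1}+\rho_{12}\sqrt{P_2})^2}{P_2(1-\rho_{12}^2-\rho_{2s}^2)+(\sqrt Q+\rho_{2s}\sqrt{P_2})^2+N_3}\Big)+\tfrac12\log\Big(1+\tfrac{P_2(1-\rho_{12}^2-\rho_{2s}^2)}{N_3}\Big)\Big\}.$$ Here $g=\frac1{N_2}$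 gives the upper bound $\max F_g$ for the degraded channel, and $g=\frac1{N_2}+\frac1{N_3}$ the one for the general Gaussian channel. If, for one of these two values of $g$, the maximum of $F_g$ is attained at a point with $\rho_{12}^2+\rho_{2s}^2=1$, then $$\mathcal C=\max_{r\in[0,1]}\min\Big\{\tfrac12\log\Big(1+\tfrac{P_1(1-r^2)}{N_2}\Big),\ \max_{\theta\in[0,1],\,t\in[-1,0]}\Big[\tfrac12\log\Big(1+\tfrac{P_1+(1-\theta)P_2+2r\sqrt{(1-\theta)P_1P_2}}{\theta P_2+Q+N_3+2t\sqrt{\theta P_2Q}}\Big)+\tfrac12\log\Big(1+\tfrac{\theta P_2(1-t^2)}{N_3}\Big)\Big]\Big\},$$ that is, the Gaussian lower bound on the right-hand side is tight. -/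

import Mathlib

open MeasureTheory ProbabilityTheory

noncomputable section

namespace GaussianRelay

/-- A code of blocklength `n` with `M` messages for the full-duplex relay channel with additive
state `s`, known non-causally to the relay.  The source map has access to the state sequence;
`Code.SourceUninformed` says that it does not use it.  The relay input at time `i` depends on the
whole state sequence and on the relay outputs at times `j < i` only. -/
structure Code (n M : ℕ) where
  source : Fin M → (Fin n → ℝ) → (Fin n → ℝ)
  relay : (Fin n → ℝ) → (Fin n → ℝ) → (Fin n → ℝ)
  decode : (Fin n → ℝ) → Fin M
  measurable_source : ∀ m, Measurable (source m)
  measurable_relay : Measurable (fun p : (Fin n → ℝ) × (Fin n → ℝ) => relay p.1 p.2)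
  measurable_decode : Measurable decode
  relay_causal : ∀ (s y y' : Fin n → ℝ) (i : Fin n),
    (∀ j, j < i → y j = y' j) → relay s y i = relay s y' i

/-- The source input is a function of the message alone. -/
def Code.SourceUninformed {n M : ℕ} (c : Code n M) : Prop :=
  ∀ m s s', c.source m s = c.source m s'

/-- Individual power constraints `∑ X₁ᵢ² ≤ n P₁` and `∑ X₂ᵢ² ≤ n P₂`. -/
def Code.PowerConstraint {n M : ℕ} (c : Code n M) (P₁ P₂ : ℝ) : Prop :=
  (∀ m s, ∑ i, (c.source m s i) ^ 2 ≤ n * P₁) ∧ (∀ s y, ∑ i, (c.relay s y i) ^ 2 ≤ n * P₂)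

/-- Law of `n` i.i.d. centred Gaussian variables of variance `v` (a point mass at `0` if `v = 0`). -/
def iidGaussian (n : ℕ) (v : ℝ) : Measure (Fin n → ℝ) :=
  Measure.pi fun _ => gaussianReal 0 v.toNNReal

/-- Joint law of `(S^n, Z₂^n, Z₃'^n)`: independent, with variances `Q`, `N₂` and `N₃ - N₂`. -/
def noiseLaw (n : ℕ) (Q N₂ N₃ : ℝ) :
    Measure ((Fin n → ℝ) × (Fin n → ℝ) × (Fin n → ℝ)) :=
  (iidGaussian n Q).prod ((iidGaussian n N₂).prod (iidGaussian n (N₃ - N₂)))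

/-- Relay output `Y₂ = X₁ + S + Z₂`. -/
def Code.relayOutput {n M : ℕ} (c : Code n M) (m : Fin M)
    (ω : (Fin n → ℝ) × (Fin n → ℝ) × (Fin n → ℝ)) : Fin n → ℝ :=
  c.source m ω.1 + ω.1 + ω.2.1

/-- Destination output of the physically degraded channel, `Y₃ = X₂ + Y₂ + Z₃'`. -/
def Code.destOutput {n M : ℕ} (c : Code n M) (m : Fin M)
    (ω : (Fin n → ℝ) × (Fin n → ℝ) × (Fin n → ℝ)) : Fin n → ℝ :=
  c.relay ω.1 (c.relayOutput m ω) + c.relayOutput m ω + ω.2.2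

/-- Average probability of error for a uniformly distributed message. -/
def Code.errorProb {n M : ℕ} (c : Code n M) (Q N₂ N₃ : ℝ) : ℝ :=
  (∑ m, (noiseLaw n Q N₂ N₃).real {ω | c.decode (c.destOutput m ω) ≠ m}) / M

/-- The rate `R` (in nats per channel use) is achievable when the relay only is informed. -/
def Achievable (P₁ P₂ Q N₂ N₃ R : ℝ) : Prop :=
  ∀ ε : ℝ, 0 < ε → ∃ n₀ : ℕ, ∀ n ≥ n₀, ∃ (M : ℕ) (c : Code n M),
    Real.exp (n * R) ≤ M ∧ c.SourceUninformed ∧ c.PowerConstraint P₁ P₂ ∧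
      c.errorProb Q N₂ N₃ ≤ ε

/-- The rate `R` is achievable when the source, too, knows the state sequence non-causally. -/
def AchievableInformedSource (P₁ P₂ Q N₂ N₃ R : ℝ) : Prop :=
  ∀ ε : ℝ, 0 < ε → ∃ n₀ : ℕ, ∀ n ≥ n₀, ∃ (M : ℕ) (c : Code n M),
    Real.exp (n * R) ≤ M ∧ c.PowerConstraint P₁ P₂ ∧ c.errorProb Q N₂ N₃ ≤ ε

/-- `C` is the capacity of the degraded Gaussian relay channel with informed relay.  For `Q = 0`
this is the capacity of the channel without state. -/
def IsCapacity (P₁ P₂ Q N₂ N₃ C : ℝ) : Prop :=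
  IsLUB {R | Achievable P₁ P₂ Q N₂ N₃ R} C

/-- `C` is the capacity when the state is known to the source as well as to the relay. -/
def IsCapacityInformedSource (P₁ P₂ Q N₂ N₃ C : ℝ) : Prop :=
  IsLUB {R | AchievableInformedSource P₁ P₂ Q N₂ N₃ R} C

/-- The function of `ζ` in the threshold for the relay noise. -/
def threshold (P₁ P₂ Q N₃ ζ : ℝ) : ℝ :=
  P₁ * N₃ * (P₂ + Q + N₃ + 2 * ζ * √(P₂ * Q)) /
    (P₁ * N₃ + P₂ * (1 - ζ ^ 2) * (P₁ + P₂ + Q + N₃ + 2 * ζ * √(P₂ * Q)))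

/-- First term of the Gaussian lower bound. -/
def lowerFirst (P₁ N₂ r₁₂ : ℝ) : ℝ :=
  1 / 2 * Real.log (1 + P₁ * (1 - r₁₂ ^ 2) / N₂)

/-- Second term of the Gaussian lower bound, at given `ρ'₁₂`, `θ`, `ρ'₂ₛ`. -/
def lowerSecond (P₁ P₂ Q N₃ r₁₂ θ r₂ₛ : ℝ) : ℝ :=
  1 / 2 * Real.log (1 + (P₁ + (1 - θ) * P₂ + 2 * r₁₂ * √((1 - θ) * P₁ * P₂)) /
      (θ * P₂ + Q + N₃ + 2 * r₂ₛ * √(θ * P₂ * Q))) +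
    1 / 2 * Real.log (1 + θ * P₂ * (1 - r₂ₛ ^ 2) / N₃)

/-- The Gaussian lower bound: the maximum over `ρ'₁₂ ∈ [0,1]` of the minimum of the first term and
the maximum over `θ ∈ [0,1]`, `ρ'₂ₛ ∈ [-1,0]` of the second term. -/
def lowerBound (P₁ P₂ Q N₂ N₃ : ℝ) : ℝ :=
  sSup ((fun r₁₂ => min (lowerFirst P₁ N₂ r₁₂)
    (sSup ((fun p : ℝ × ℝ => lowerSecond P₁ P₂ Q N₃ r₁₂ p.1 p.2) ''
      (Set.Icc 0 1 ×ˢ Set.Icc (-1) 0)))) '' Set.Icc 0 1)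

/-- Admissible `(ρ₁₂, ρ₂ₛ)` in the upper bound. -/
def upperDomain : Set (ℝ × ℝ) :=
  {p | p.1 ∈ Set.Icc 0 1 ∧ p.2 ∈ Set.Icc (-1) 0 ∧ p.1 ^ 2 + p.2 ^ 2 ≤ 1}

/-- The factor `1 - ρ₁₂² / (1 - ρ₂ₛ²) = (1 - ρ₁₂² - ρ₂ₛ²) / (1 - ρ₂ₛ²)`, which is the normalized
variance of `X₁` given `(X₂, S)`.  If `ρ₂ₛ = -1` then `X₂` is a multiple of `S`, which is
independent of `X₁`, and the value is `1`. -/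
def residualFraction (ρ₁₂ ρ₂ₛ : ℝ) : ℝ :=
  if ρ₂ₛ = -1 then 1 else 1 - ρ₁₂ ^ 2 / (1 - ρ₂ₛ ^ 2)

/-- Second term of the Gaussian upper bound. -/
def upperSecond (P₁ P₂ Q N₃ ρ₁₂ ρ₂ₛ : ℝ) : ℝ :=
  1 / 2 * Real.log (1 + (√P₁ + ρ₁₂ * √P₂) ^ 2 /
      (P₂ * (1 - ρ₁₂ ^ 2 - ρ₂ₛ ^ 2) + (√Q + ρ₂ₛ * √P₂) ^ 2 + N₃)) +
    1 / 2 * Real.log (1 + P₂ * (1 - ρ₁₂ ^ 2 - ρ₂ₛ ^ 2) / N₃)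

/-- The function maximized in the upper bound for the degraded Gaussian channel. -/
def upperDegraded (P₁ P₂ Q N₂ N₃ : ℝ) (p : ℝ × ℝ) : ℝ :=
  min (1 / 2 * Real.log (1 + P₁ * residualFraction p.1 p.2 / N₂))
    (upperSecond P₁ P₂ Q N₃ p.1 p.2)

/-- The function maximized in the upper bound for the general Gaussian channel. -/
def upperGeneral (P₁ P₂ Q N₂ N₃ : ℝ) (p : ℝ × ℝ) : ℝ :=
  min (1 / 2 * Real.log (1 + P₁ * residualFraction p.1 p.2 * (1 / N₂ + 1 / N₃)))
    (upperSecond P₁ P₂ Q N₃ p.1 p.2)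

end GaussianRelay

end

section

open Filter Topology
open scoped ENNReal NNReal

noncomputable section

namespace GaussianRelay

/-! The converse behind part 1 is the cut between source and relay. Once `S` and `Z₃'` are frozen,
the destination computes its estimate from `Y₂ = X₁ + S + Z₂` alone, even if the source knows `S`. A
code is then a code for the Gaussian channel of noise `N₂`, and above rate `½ log (1 + P₁ / N₂)` a
change of measure to a Gaussian law of variance `P₁ + N₂` keeps the error at least one half
(`Code.half_le_errorProb`).

Achievability is decode-and-forward in blocks. The relay subtracts the known state and decodes the
message of the block; in the next block it sends the bin index of that message by dirty paper
coding. Its input is `x + a s`, with `x` of power `P` nearly orthogonal to `s`, so that the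
destination sees `x + (1 + a) s + z`. The destination decodes backwards: it removes the source input
already found, decodes the bin index as if the state were absent (rate below `½ log (1 + P / N₃)`),
then decodes the preceding message inside its bin against a disturbance of power `P + (1 + a)² Q +
N₃`. The choice `P = P₂ (1 - ζ²)`, `a = ζ √P₂ / √Q` gives `achievable_of_lt`. The condition `T(ζ) ≤
N₂` says exactly that the sum of the two destination terms is at least `½ log (1 + P₁ / N₂)`, which
is then the capacity; the same inequality survives removal of the state.

Part 2 rests on a degeneracy. On the circle `ρ₁₂² + ρ₂ₛ² = 1` the residual fraction vanishes except
at `(0, -1)`, so a maximum on the circle must lie there. If `P₂ > 0` and `g > 1 / ((√Q - √P₂)² +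
N₃)`, a small displacement from `(0, -1)` gains a first-order term in the signal at a second-order
cost in the noise, so `(0, -1)` is no maximum. Since `g ≥ 1 / N₂ ≥ 1 / N₃`, what remains is `P₂ =
Q`, `N₂ = N₃`, where the relay cancels the state completely, together with `P₂ = 0`, where the
channel is a plain Gaussian channel. In both cases the capacity and the lower bound are computed
outright (`isCapacity_lowerBound`). -/

/-! ### Product Gaussian laws and change of measure -/

/-- On a box, the integral of the product density factors because the coordinates are independent
under the product measure. -/
theorem pi_withDensity {ι : Type*} [Fintype ι] {α : ι → Type*} [∀ i, MeasurableSpace (α i)]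
    (μ : ∀ i, Measure (α i)) [∀ i, IsProbabilityMeasure (μ i)] (f : ∀ i, α i → ℝ≥0∞)
    (hf : ∀ i, Measurable (f i)) [∀ i, SigmaFinite ((μ i).withDensity (f i))] :
    Measure.pi (fun i => (μ i).withDensity (f i)) =
      (Measure.pi μ).withDensity fun x => ∏ i, f i (x i) := by
  refine Measure.pi_eq fun s hs => ?_
  rw [withDensity_apply _ (MeasurableSet.univ_pi hs), ← lintegral_indicator (MeasurableSet.univ_pi hs)]
  have h1 : ((Set.univ.pi s).indicator fun x => ∏ i, f i (x i)) =
      fun x => ∏ i, (s i).indicator (f i) (x i) := by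
    funext x
    by_cases hx : x ∈ Set.univ.pi s
    · rw [Set.indicator_of_mem hx]
      exact Finset.prod_congr rfl fun i _ => (Set.indicator_of_mem (hx i trivial) _).symm
    · rw [Set.indicator_of_notMem hx]
      simp only [Set.mem_univ_pi, not_forall] at hx
      obtain ⟨i, hi⟩ := hx
      exact (Finset.prod_eq_zero (Finset.mem_univ i) (Set.indicator_of_notMem hi _)).symm
  rw [h1, lintegral_prod_eq_prod_lintegral_of_indepFun Finset.univ
    (fun i (x : ∀ i, α i) => (s i).indicator (f i) (x i))
    (iIndepFun_pi fun i => ((hf i).indicator (hs i)).aemeasurable)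
    (fun i => ((hf i).indicator (hs i)).comp (measurable_pi_apply i))]
  refine Finset.prod_congr rfl fun i _ => ?_
  rw [withDensity_apply _ (hs i), ← lintegral_indicator (hs i)]
  exact (measurePreserving_eval μ i).lintegral_comp ((hf i).indicator (hs i))

/-- The exponent of the density of `N(c, v)` relative to `N(c', v')`. -/
def logRatio (c v c' v' x : ℝ) : ℝ :=
  1 / 2 * Real.log (v' / v) - (x - c) ^ 2 / (2 * v) + (x - c') ^ 2 / (2 * v')

theorem measurable_logRatio (c v c' v' : ℝ) : Measurable (logRatio c v c' v') := by
  unfold logRatio; fun_prop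

theorem gaussianReal_eq_withDensity {v v' : ℝ} (hv : 0 < v) (hv' : 0 < v') (c c' : ℝ) :
    gaussianReal c v.toNNReal = (gaussianReal c' v'.toNNReal).withDensity
      fun x => ENNReal.ofReal (Real.exp (logRatio c v c' v' x)) := by
  have h : v.toNNReal ≠ 0 := by simpa using hv
  have h' : v'.toNNReal ≠ 0 := by simpa using hv'
  rw [gaussianReal_of_var_ne_zero _ h, gaussianReal_of_var_ne_zero _ h', ← withDensity_mul _
    (measurable_gaussianPDF _ _) (by have := measurable_logRatio c v c' v'; fun_prop)]
  congr 1
  funext x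
  rw [Pi.mul_apply, gaussianPDF, gaussianPDF, ← ENNReal.ofReal_mul (gaussianPDFReal_nonneg _ _ _)]
  congr 1
  rw [gaussianPDFReal, gaussianPDFReal, logRatio, Real.coe_toNNReal _ hv.le,
    Real.coe_toNNReal _ hv'.le,
    mul_assoc _ (Real.exp _) (Real.exp _), ← Real.exp_add]
  have e1 : -(x - c') ^ 2 / (2 * v') + (1 / 2 * Real.log (v' / v) - (x - c) ^ 2 / (2 * v) +
      (x - c') ^ 2 / (2 * v')) = Real.log (v' / v) * (1 / 2) + -(x - c) ^ 2 / (2 * v) := by ring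
  rw [e1, Real.exp_add, ← mul_assoc]
  congr 1
  rw [← Real.rpow_def_of_pos (by positivity), ← Real.sqrt_eq_rpow, ← Real.sqrt_inv,
    ← Real.sqrt_inv, ← Real.sqrt_mul (by positivity)]
  congr 1
  field_simp

/-- The law of a vector of independent Gaussians of means `c i` and common variance `v`. -/
def shiftedGaussian {k : ℕ} (c : Fin k → ℝ) (v : ℝ) : Measure (Fin k → ℝ) :=
  Measure.pi fun i => gaussianReal (c i) v.toNNReal

instance {k : ℕ} (c : Fin k → ℝ) (v : ℝ) : IsProbabilityMeasure (shiftedGaussian c v) := by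
  unfold shiftedGaussian; infer_instance

instance (k : ℕ) (v : ℝ) : IsProbabilityMeasure (iidGaussian k v) := by
  unfold iidGaussian; infer_instance

theorem shiftedGaussian_zero (k : ℕ) (v : ℝ) :
    shiftedGaussian (0 : Fin k → ℝ) v = iidGaussian k v := rfl

theorem map_add_iidGaussian {k : ℕ} (c : Fin k → ℝ) (v : ℝ) :
    (iidGaussian k v).map (fun z => c + z) = shiftedGaussian c v := by
  have h := Measure.pi_map_pi (μ := fun _ : Fin k => gaussianReal 0 v.toNNReal)
    (f := fun i x => c i + x) (hμ := fun i => by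
      rw [gaussianReal_map_const_add]; infer_instance) (fun i => by fun_prop)
  have h2 : (fun z : Fin k → ℝ => c + z) = fun x i => c i + x i := rfl
  rw [h2, iidGaussian, h, shiftedGaussian]
  congr 1
  funext i
  rw [gaussianReal_map_const_add, zero_add]

/-- Change of measure between two isotropic Gaussian laws on an event where the likelihood ratio
is controlled. -/
theorem shiftedGaussian_le {k : ℕ} {v v' : ℝ} (hv : 0 < v) (hv' : 0 < v') (c c' : Fin k → ℝ)
    {A : Set (Fin k → ℝ)} (hA : MeasurableSet A) {L : ℝ}
    (h : ∀ u ∈ A, k * (1 / 2 * Real.log (v' / v)) - ((u - c) ⬝ᵥ (u - c)) / (2 * v) +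
      ((u - c') ⬝ᵥ (u - c')) / (2 * v') ≤ L) :
    shiftedGaussian c v A ≤ ENNReal.ofReal (Real.exp L) * shiftedGaussian c' v' A := by
  have e : shiftedGaussian c v = (shiftedGaussian c' v').withDensity fun x =>
      ∏ i, ENNReal.ofReal (Real.exp (logRatio (c i) v (c' i) v' (x i))) := by
    unfold shiftedGaussian
    have : ∀ i, SigmaFinite ((gaussianReal (c' i) v'.toNNReal).withDensity
        fun x => ENNReal.ofReal (Real.exp (logRatio (c i) v (c' i) v' x))) := fun i => by
      rw [← gaussianReal_eq_withDensity hv hv']; infer_instance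
    rw [← pi_withDensity _ (fun i x => ENNReal.ofReal (Real.exp (logRatio (c i) v (c' i) v' x)))
      fun i => by have := measurable_logRatio (c i) v (c' i) v'; fun_prop]
    congr 1
    funext i
    exact gaussianReal_eq_withDensity hv hv' _ _
  rw [e, withDensity_apply _ hA, ← setLIntegral_const]
  refine setLIntegral_mono measurable_const fun u hu => ?_
  rw [← ENNReal.ofReal_prod_of_nonneg (fun i _ => (Real.exp_pos _).le), ← Real.exp_sum]
  refine ENNReal.ofReal_le_ofReal (Real.exp_le_exp.2 (le_trans (le_of_eq ?_) (h u hu)))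
  simp only [logRatio, Finset.sum_add_distrib, Finset.sum_sub_distrib, dotProduct,
    Finset.sum_const, Finset.card_univ, Fintype.card_fin, nsmul_eq_mul, Finset.sum_div,
    Pi.sub_apply, sq]

theorem map_add_prod_iidGaussian (k : ℕ) {v v' : ℝ} (hv : 0 ≤ v) (hv' : 0 ≤ v') :
    ((iidGaussian k v).prod (iidGaussian k v')).map (fun p => p.1 + p.2) =
      iidGaussian k (v + v') := by
  unfold iidGaussian
  -- A pair of vectors is read as a vector of pairs, so that the sum acts coordinate by coordinate
  -- and the one-dimensional convolution applies.
  rw [← (measurePreserving_arrowProdEquivProdArrow ℝ ℝ (Fin k)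
    (fun _ => gaussianReal 0 v.toNNReal) (fun _ => gaussianReal 0 v'.toNNReal)).map_eq,
    Measure.map_map (by fun_prop) (MeasurableEquiv.measurable _)]
  have h0 : ((gaussianReal 0 v.toNNReal).prod (gaussianReal 0 v'.toNNReal)).map
      (fun p : ℝ × ℝ => p.1 + p.2) = gaussianReal 0 (v + v').toNNReal := by
    have := gaussianReal_conv_gaussianReal (m₁ := 0) (m₂ := 0) (v₁ := v.toNNReal)
      (v₂ := v'.toNNReal)
    rw [Measure.conv, add_zero, ← Real.toNNReal_add hv hv'] at this
    exact this
  have h := Measure.pi_map_pi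
    (μ := fun _ : Fin k => (gaussianReal 0 v.toNNReal).prod (gaussianReal 0 v'.toNNReal))
    (f := fun _ p => p.1 + p.2) (hμ := fun i => by rw [h0]; infer_instance)
    (fun i => by fun_prop)
  simp only [h0] at h
  rw [← h]
  rfl

theorem map_comp_iidGaussian {k n : ℕ} (v : ℝ) {e : Fin k → Fin n} (he : Function.Injective e) :
    (iidGaussian n v).map (fun z i => z (e i)) = iidGaussian k v := by
  unfold iidGaussian
  have h : iIndepFun (fun i (z : Fin n → ℝ) => z i)
      (Measure.pi fun _ : Fin n => gaussianReal 0 v.toNNReal) :=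
    iIndepFun_pi (X := fun _ x => x) fun i => by fun_prop
  have h2 := (iIndepFun_iff_map_fun_eq_pi_map fun i =>
    (measurable_pi_apply (e i)).aemeasurable).1 (h.precomp he)
  rw [h2]
  congr 1
  funext i
  exact (measurePreserving_eval _ (e i)).map_eq

/-! ### Concentration -/

theorem memLp_eval_sq (v : ℝ) :
    MemLp (fun x : ℝ => x ^ 2) 2 (gaussianReal 0 v.toNNReal) := by
  have h := (memLp_id_gaussianReal' (μ := 0) (v := v.toNNReal) 4 (by simp)).norm_rpow_div 2
  have e : (4 : ℝ≥0∞) / 2 = 2 := by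
    rw [show (4 : ℝ≥0∞) = 2 * 2 by norm_num, mul_div_assoc, ENNReal.div_self (by simp) (by simp),
      mul_one]
  rw [e] at h
  refine h.congr_norm (by fun_prop) (ae_of_all _ fun x => ?_)
  simp

theorem integral_sq_gaussianReal {v : ℝ} (hv : 0 ≤ v) :
    ∫ x, x ^ 2 ∂(gaussianReal 0 v.toNNReal) = v := by
  have h := variance_fun_id_gaussianReal (μ := 0) (v := v.toNNReal)
  rw [variance_eq_integral (by fun_prop)] at h
  simpa [integral_id_gaussianReal, hv] using h

/-- Chebyshev for a sum of i.i.d. squares. The variance of one square is left unevaluated: only the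
decay in `1 / k` matters later. -/
theorem norm_sq_concentration (k : ℕ) {v : ℝ} (hv : 0 ≤ v) {δ : ℝ} (hδ : 0 < δ) (hk : 0 < k) :
    iidGaussian k v {z | k * δ ≤ |z ⬝ᵥ z - k * v|} ≤
      ENNReal.ofReal (Var[fun x : ℝ => x ^ 2; gaussianReal 0 v.toNNReal] / δ ^ 2 / k) := by
  have hk' : (0 : ℝ) < k := by exact_mod_cast hk
  have hm : ∀ i : Fin k, MemLp (fun z : Fin k → ℝ => z i ^ 2) 2 (iidGaussian k v) := fun i =>
    (memLp_eval_sq v).comp_measurePreserving (measurePreserving_eval _ i)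
  have hX : MemLp (∑ i : Fin k, fun z : Fin k → ℝ => z i ^ 2) 2 (iidGaussian k v) :=
    memLp_finsetSum' _ fun i _ => hm i
  have hc := meas_ge_le_variance_div_sq hX (c := k * δ) (by positivity)
  have hvar : Var[∑ i : Fin k, fun z : Fin k → ℝ => z i ^ 2; iidGaussian k v] =
      k * Var[fun x : ℝ => x ^ 2; gaussianReal 0 v.toNNReal] := by
    rw [iidGaussian, variance_sum_pi (X := fun (_ : Fin k) x => x ^ 2) fun i => memLp_eval_sq v]
    simp
  have hmean : ∫ z, (∑ i : Fin k, fun z : Fin k → ℝ => z i ^ 2) z ∂(iidGaussian k v) = k * v := by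
    simp only [Finset.sum_apply]
    rw [integral_finsetSum _ fun i _ => (hm i).integrable (by norm_num)]
    have : ∀ i : Fin k, ∫ z, z i ^ 2 ∂(iidGaussian k v) = v := fun i => by
      refine Eq.trans ?_ (integral_sq_gaussianReal hv)
      rw [← (measurePreserving_eval (fun _ : Fin k => gaussianReal 0 v.toNNReal) i).map_eq,
        integral_map (measurable_pi_apply i).aemeasurable (by fun_prop)]
      rfl
    simp [this]
  rw [hvar, hmean] at hc
  convert hc using 2
  · ext z
    simp [dotProduct, sq]
  · field_simp

/-- Chebyshev again: for fixed `a` the inner product is centred of variance `(a ⬝ᵥ a) v`. -/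
theorem dotProduct_concentration {k : ℕ} {v : ℝ} (hv : 0 ≤ v) {δ : ℝ} (hδ : 0 < δ) (hk : 0 < k)
    {a : Fin k → ℝ} {A : ℝ} (ha : a ⬝ᵥ a ≤ k * A) :
    iidGaussian k v {z | k * δ ≤ |a ⬝ᵥ z|} ≤ ENNReal.ofReal (A * v / δ ^ 2 / k) := by
  have hk' : (0 : ℝ) < k := by exact_mod_cast hk
  have h0 : ∀ i : Fin k, MemLp (fun x => a i * x) 2 (gaussianReal 0 v.toNNReal) := fun i =>
    (memLp_id_gaussianReal' (μ := 0) (v := v.toNNReal) 2 (by simp)).const_mul (a i)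
  have hm : ∀ i : Fin k, MemLp (fun z : Fin k → ℝ => a i * z i) 2 (iidGaussian k v) := fun i =>
    (h0 i).comp_measurePreserving (measurePreserving_eval _ i)
  have hX : MemLp (∑ i : Fin k, fun z : Fin k → ℝ => a i * z i) 2 (iidGaussian k v) :=
    memLp_finsetSum' _ fun i _ => hm i
  have hc := meas_ge_le_variance_div_sq hX (c := k * δ) (by positivity)
  have hvar : Var[∑ i : Fin k, fun z : Fin k → ℝ => a i * z i; iidGaussian k v] =
      (a ⬝ᵥ a) * v := by
    rw [iidGaussian, variance_sum_pi (X := fun (i : Fin k) x => a i * x) h0]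
    have : ∀ i : Fin k, Var[fun x => a i * x; gaussianReal 0 v.toNNReal] = a i * a i * v :=
      fun i => by
        rw [variance_const_mul, variance_fun_id_gaussianReal, Real.coe_toNNReal _ hv, sq]
    simp [this, dotProduct, Finset.sum_mul]
  have hmean : ∫ z, (∑ i : Fin k, fun z : Fin k → ℝ => a i * z i) z ∂(iidGaussian k v) = 0 := by
    simp only [Finset.sum_apply]
    rw [integral_finsetSum _ fun i _ => (hm i).integrable (by norm_num)]
    refine Finset.sum_eq_zero fun i _ => ?_
    rw [integral_const_mul]
    have : ∫ z, z i ∂(iidGaussian k v) = 0 := by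
      rw [← integral_id_gaussianReal (μ := 0) (v := v.toNNReal),
        ← (measurePreserving_eval (fun _ : Fin k => gaussianReal 0 v.toNNReal) i).map_eq,
        integral_map (measurable_pi_apply i).aemeasurable (by fun_prop)]
      rfl
    rw [this, mul_zero]
  rw [hvar, hmean] at hc
  refine le_trans (le_of_eq ?_) (hc.trans (ENNReal.ofReal_le_ofReal ?_))
  · congr 1
    ext z
    simp [dotProduct]
  · rw [div_div, mul_comm (δ ^ 2) (k : ℝ), mul_pow]
    rw [div_le_div_iff₀ (by positivity) (by positivity)]
    have := mul_le_mul_of_nonneg_right ha (show 0 ≤ v * (k * δ ^ 2) by positivity)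
    nlinarith

/-! ### Converse -/

theorem measurable_dotProduct_self {k : ℕ} : Measurable fun z : Fin k → ℝ => z ⬝ᵥ z := by
  unfold dotProduct; fun_prop

theorem measurable_dotProduct_left {k : ℕ} (a : Fin k → ℝ) :
    Measurable fun z : Fin k → ℝ => a ⬝ᵥ z := by
  unfold dotProduct; fun_prop

theorem dotProduct_self_add {k : ℕ} (x y : Fin k → ℝ) :
    (x + y) ⬝ᵥ (x + y) = x ⬝ᵥ x + 2 * (x ⬝ᵥ y) + y ⬝ᵥ y := by
  rw [add_dotProduct, dotProduct_add, dotProduct_add, dotProduct_comm y x]; ring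

/-- Core of the converse. When the noise has typical power and is nearly orthogonal to `x`, the
likelihood ratio of `N(x + c, N)` to `N(c, P + N)` is at most about `exp (n ½ log (1 + P / N))`. The
reference law does not involve `x`, so the bounds for all messages can be summed. -/
theorem awgn_decoding_region_le {n : ℕ} (hn : 0 < n) {P N δ : ℝ} (hP : 0 < P) (hN : 0 < N)
    (hδ : 0 < δ) {x : Fin n → ℝ} (hx : x ⬝ᵥ x ≤ n * P) (c : Fin n → ℝ)
    {D : Set (Fin n → ℝ)} (hD : MeasurableSet D) :
    iidGaussian n N {z | x + c + z ∈ D} ≤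
      ENNReal.ofReal (Var[fun x : ℝ => x ^ 2; gaussianReal 0 N.toNNReal] / δ ^ 2 / n) +
      ENNReal.ofReal (P * N / δ ^ 2 / n) +
      ENNReal.ofReal (Real.exp (n * (1 / 2 * Real.log (1 + P / N) + δ / N))) *
        shiftedGaussian c (P + N) D := by
  set B₁ : Set (Fin n → ℝ) := {z | n * δ ≤ |z ⬝ᵥ z - n * N|}
  set B₂ : Set (Fin n → ℝ) := {z | n * δ ≤ |x ⬝ᵥ z|}
  set G : Set (Fin n → ℝ) := {z | |z ⬝ᵥ z - n * N| < n * δ} ∩ {z | |x ⬝ᵥ z| < n * δ}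
  have hG : MeasurableSet G := by
    have h1 := measurable_dotProduct_self (k := n)
    have h2 := measurable_dotProduct_left x
    exact (measurableSet_lt (by fun_prop) measurable_const).inter
      (measurableSet_lt (by fun_prop) measurable_const)
  have hsub : {z | x + c + z ∈ D} ⊆ B₁ ∪ B₂ ∪
      (fun z => (x + c) + z) ⁻¹' (D ∩ (fun y => y - (x + c)) ⁻¹' G) := by
    intro z hz
    by_cases h1 : z ∈ B₁
    · exact Or.inl (Or.inl h1)
    by_cases h2 : z ∈ B₂
    · exact Or.inl (Or.inr h2)
    refine Or.inr ⟨hz, ?_⟩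
    simp only [Set.mem_preimage, add_sub_cancel_left]
    exact ⟨by simpa [B₁] using h1, by simpa [B₂] using h2⟩
  have hA : MeasurableSet (D ∩ (fun y => y - (x + c)) ⁻¹' G) :=
    hD.inter ((by fun_prop : Measurable fun y : Fin n → ℝ => y - (x + c)) hG)
  refine (measure_mono hsub).trans ((measure_union_le _ _).trans (add_le_add
    ((measure_union_le _ _).trans (add_le_add ?_ ?_)) ?_))
  · exact norm_sq_concentration n hN.le hδ hn
  · exact dotProduct_concentration hN.le hδ hn hx
  · rw [← Measure.map_apply (by fun_prop) hA, map_add_iidGaussian]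
    refine (shiftedGaussian_le hN (by positivity : 0 < P + N) (x + c) c hA ?_).trans
      (mul_le_mul_right (measure_mono Set.inter_subset_left) _)
    rintro u ⟨-, hu1, hu2⟩
    set z := u - (x + c) with hz
    have e : u - c = x + z := by rw [hz]; abel
    rw [e, dotProduct_self_add]
    simp only [Set.mem_ofPred_eq] at hu1 hu2
    have e2 : (P + N) / N = 1 + P / N := by field_simp; ring
    rw [e2]
    have h1 := (abs_lt.1 hu1).1
    have h2 := (abs_lt.1 hu2).2
    have hn' : (0 : ℝ) < n := by exact_mod_cast hn
    -- With `x ⬝ᵥ x = nP`, `z ⬝ᵥ z = nN` and `x ⬝ᵥ z = 0` the left side would be zero; the right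
    -- side pays for the two deviations.
    have key : -(z ⬝ᵥ z) / (2 * N) + (x ⬝ᵥ x + 2 * (x ⬝ᵥ z) + z ⬝ᵥ z) / (2 * (P + N)) ≤
        n * (δ / N) := by
      rw [div_add_div _ _ (by positivity) (by positivity), ← mul_div_assoc,
        div_le_div_iff₀ (by positivity) hN]
      have h3 : -(z ⬝ᵥ z) * (2 * (P + N)) + 2 * N * (x ⬝ᵥ x + 2 * (x ⬝ᵥ z) + z ⬝ᵥ z) ≤
          (n * δ) * (4 * (P + N)) := by
        have a1 := mul_le_mul_of_nonneg_left hx (by positivity : 0 ≤ 2 * N)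
        have a2 := mul_le_mul_of_nonneg_left h2.le (by positivity : 0 ≤ 4 * N)
        have a3 := mul_le_mul_of_nonneg_left h1.le (by positivity : 0 ≤ 2 * P)
        have a4 : 0 ≤ n * δ * P := by positivity
        nlinarith
      have := mul_le_mul_of_nonneg_right h3 hN.le
      nlinarith
    have e3 : -(z ⬝ᵥ z) / (2 * N) = -((z ⬝ᵥ z) / (2 * N)) := neg_div _ _
    rw [e3] at key
    rw [mul_add (n : ℝ)]
    linarith

theorem tendsto_ofReal_const_div (C : ℝ) :
    Tendsto (fun n : ℕ => ENNReal.ofReal (C / n)) atTop (𝓝 0) := by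
  have := ENNReal.tendsto_ofReal (tendsto_const_div_atTop_nhds_zero_nat C)
  simpa using this

theorem tendsto_ofReal_exp_neg {c : ℝ} (hc : 0 < c) :
    Tendsto (fun n : ℕ => ENNReal.ofReal (Real.exp (-(n * c)))) atTop (𝓝 0) := by
  have h : Tendsto (fun n : ℕ => -((n : ℝ) * c)) atTop atBot :=
    tendsto_neg_atTop_atBot.comp (tendsto_natCast_atTop_atTop.atTop_mul_const hc)
  have := ENNReal.tendsto_ofReal (Real.tendsto_exp_atBot.comp h)
  simpa using this

/-- Codes for the Gaussian channel of rate above `½ log (1 + P / N)` are decoded correctly with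
probability at most one half. -/
theorem awgn_correct_le {P N R : ℝ} (hP : 0 < P) (hN : 0 < N)
    (hR : 1 / 2 * Real.log (1 + P / N) < R) :
    ∀ᶠ n : ℕ in atTop, ∀ (M : ℕ), Real.exp (n * R) ≤ M → ∀ (x : Fin M → Fin n → ℝ),
      (∀ m, x m ⬝ᵥ x m ≤ n * P) → ∀ (c : Fin n → ℝ) (g : (Fin n → ℝ) → Fin M), Measurable g →
      ∑ m, iidGaussian n N {z | g (x m + c + z) = m} ≤ M * ENNReal.ofReal (1 / 2) := by
  -- Half of the gap between the rate and the capacity is spent on `δ / N`.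
  obtain ⟨δ, hδ, hδR⟩ : ∃ δ : ℝ, 0 < δ ∧ 1 / 2 * Real.log (1 + P / N) + δ / N < R := by
    refine ⟨(R - 1 / 2 * Real.log (1 + P / N)) / 2 * N, by have := sub_pos.2 hR; positivity, ?_⟩
    rw [mul_div_assoc, div_self hN.ne', mul_one]; linarith
  set V := Var[fun x : ℝ => x ^ 2; gaussianReal 0 N.toNNReal]
  have hlim : Tendsto (fun n : ℕ => ENNReal.ofReal (V / δ ^ 2 / n) +
      ENNReal.ofReal (P * N / δ ^ 2 / n) + ENNReal.ofReal
        (Real.exp (-(n * (R - (1 / 2 * Real.log (1 + P / N) + δ / N)))))) atTop (𝓝 0) := by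
    simpa using ((tendsto_ofReal_const_div _).add (tendsto_ofReal_const_div _)).add
      (tendsto_ofReal_exp_neg (sub_pos.2 hδR))
  have h12 : (0 : ℝ≥0∞) < ENNReal.ofReal (1 / 2) := by simp
  filter_upwards [hlim.eventually (gt_mem_nhds h12), eventually_gt_atTop 0] with n hn hn0
  intro M hM x hx c g hg
  -- The decoding regions are disjoint, so their probabilities under the common reference law add up
  -- to at most one.
  have hdis : ∑ m, shiftedGaussian c (P + N) (g ⁻¹' {m}) ≤ 1 := by
    rw [← measure_biUnion_finset (fun i _ j _ hij => by
      refine Disjoint.preimage _ ?_; simpa using hij) (fun m _ => hg (measurableSet_singleton m))]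
    exact prob_le_one
  have hexp : ENNReal.ofReal (Real.exp (n * (1 / 2 * Real.log (1 + P / N) + δ / N))) ≤
      M * ENNReal.ofReal
        (Real.exp (-(n * (R - (1 / 2 * Real.log (1 + P / N) + δ / N))))) := by
    rw [← ENNReal.ofReal_natCast, ← ENNReal.ofReal_mul (by positivity)]
    refine ENNReal.ofReal_le_ofReal
      (le_trans (le_of_eq ?_) (mul_le_mul_of_nonneg_right hM (Real.exp_pos _).le))
    rw [← Real.exp_add]; congr 1; ring
  calc ∑ m, iidGaussian n N {z | g (x m + c + z) = m}
      ≤ ∑ m, (ENNReal.ofReal (V / δ ^ 2 / n) + ENNReal.ofReal (P * N / δ ^ 2 / n) +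
          ENNReal.ofReal (Real.exp (n * (1 / 2 * Real.log (1 + P / N) + δ / N))) *
            shiftedGaussian c (P + N) (g ⁻¹' {m})) := Finset.sum_le_sum fun m _ =>
        awgn_decoding_region_le hn0 hP hN hδ (hx m) c (hg (measurableSet_singleton m))
    _ ≤ M * (ENNReal.ofReal (V / δ ^ 2 / n) + ENNReal.ofReal (P * N / δ ^ 2 / n)) +
          M * ENNReal.ofReal
            (Real.exp (-(n * (R - (1 / 2 * Real.log (1 + P / N) + δ / N))))) := by
        rw [Finset.sum_add_distrib, ← Finset.mul_sum]
        refine add_le_add (by simp [mul_add]) ?_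
        exact (mul_le_mul_right hdis _).trans (by rwa [mul_one])
    _ ≤ M * ENNReal.ofReal (1 / 2) := by
        rw [← mul_add]
        exact mul_le_mul_right hn.le _

theorem one_le_of_correct_le {n M : ℕ} (c : Code n M) {Q N₂ N₃ R : ℝ}
    (hM : Real.exp (n * R) ≤ M)
    (h : ∑ m, noiseLaw n Q N₂ N₃ {ω | c.decode (c.destOutput m ω) = m} ≤
      M * ENNReal.ofReal (1 / 2)) (hmeas : ∀ m, Measurable (c.destOutput m)) :
    1 / 2 ≤ c.errorProb Q N₂ N₃ := by
  have hM0 : (0 : ℝ) < M := (Real.exp_pos _).trans_le hM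
  have : IsProbabilityMeasure (noiseLaw n Q N₂ N₃) := by unfold noiseLaw; infer_instance
  have h1 : ∀ m, (noiseLaw n Q N₂ N₃).real {ω | c.decode (c.destOutput m ω) ≠ m} =
      1 - (noiseLaw n Q N₂ N₃).real {ω | c.decode (c.destOutput m ω) = m} := fun m => by
    have hm : MeasurableSet {ω | c.decode (c.destOutput m ω) = m} :=
      (c.measurable_decode.comp (hmeas m)) (measurableSet_singleton m)
    rw [← probReal_compl_eq_one_sub hm]; rfl
  have h2 : ∑ m, (noiseLaw n Q N₂ N₃).real {ω | c.decode (c.destOutput m ω) = m} ≤ M * (1 / 2) := by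
    have := ENNReal.toReal_mono (by finiteness) h
    rw [ENNReal.toReal_sum (fun _ _ => measure_ne_top _ _)] at this
    simpa [Measure.real] using this
  rw [Code.errorProb, le_div_iff₀ hM0]
  simp only [h1, Finset.sum_sub_distrib, Finset.sum_const, Finset.card_univ, Fintype.card_fin,
    nsmul_eq_mul, mul_one]
  linarith

theorem Code.measurable_relayOutput {n M : ℕ} (c : Code n M) (m : Fin M) :
    Measurable (c.relayOutput m) := by
  have := c.measurable_source m
  unfold Code.relayOutput
  fun_prop

theorem Code.measurable_destOutput {n M : ℕ} (c : Code n M) (m : Fin M) :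
    Measurable (c.destOutput m) := by
  have h1 := c.measurable_relayOutput m
  have h2 : Measurable fun ω : (Fin n → ℝ) × (Fin n → ℝ) × (Fin n → ℝ) =>
      c.relay ω.1 (c.relayOutput m ω) := c.measurable_relay.comp (measurable_fst.prodMk h1)
  unfold Code.destOutput
  fun_prop

theorem dotProduct_self_eq_sum_sq {k : ℕ} (x : Fin k → ℝ) : x ⬝ᵥ x = ∑ i, x i ^ 2 := by
  simp [dotProduct, sq]

/-- For fixed `s` and `z'` the decoder is a measurable function of `y = x + s + z`, because the
relay input is a function of `s` and `y`. Hence `awgn_correct_le` applies with shift `s` and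
codewords that may depend on `s`; integrating over `s` and `z'` keeps the bound. -/
theorem Code.half_le_errorProb {P₁ P₂ N₂ R : ℝ} (hP₁ : 0 < P₁) (hN₂ : 0 < N₂)
    (hR : 1 / 2 * Real.log (1 + P₁ / N₂) < R) : ∀ᶠ n : ℕ in atTop,
    ∀ (M : ℕ) (c : Code n M) (Q N₃ : ℝ), Real.exp (n * R) ≤ M → c.PowerConstraint P₁ P₂ →
      1 / 2 ≤ c.errorProb Q N₂ N₃ := by
  filter_upwards [awgn_correct_le hP₁ hN₂ hR] with n hn M c Q N₃ hM hpow
  refine one_le_of_correct_le c hM ?_ c.measurable_destOutput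
  have hms : ∀ m, MeasurableSet {ω | c.decode (c.destOutput m ω) = m} := fun m =>
    (c.measurable_decode.comp (c.measurable_destOutput m)) (measurableSet_singleton m)
  -- The order of integration puts `Z₂` innermost, with the state and the second noise frozen.
  have e : ∀ m, noiseLaw n Q N₂ N₃ {ω | c.decode (c.destOutput m ω) = m} =
      ∫⁻ s, ∫⁻ z', iidGaussian n N₂ {z | c.decode (c.destOutput m (s, z, z')) = m}
        ∂(iidGaussian n (N₃ - N₂)) ∂(iidGaussian n Q) := fun m => by
    rw [noiseLaw, Measure.prod_apply (hms m)]
    refine lintegral_congr fun s => ?_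
    rw [Measure.prod_apply_symm (measurable_prodMk_left (hms m))]
    rfl
  have hmi : ∀ m s, Measurable fun z' =>
      iidGaussian n N₂ {z | c.decode (c.destOutput m (s, z, z')) = m} := fun m s =>
    measurable_measure_prodMk_right (measurable_prodMk_left (x := s) (hms m))
  have hmo : ∀ m, Measurable fun s => ∫⁻ z', iidGaussian n N₂
      {z | c.decode (c.destOutput m (s, z, z')) = m} ∂(iidGaussian n (N₃ - N₂)) := fun m => by
    refine Measurable.lintegral_prod_right' (f := fun p : (Fin n → ℝ) × (Fin n → ℝ) =>
      iidGaussian n N₂ {z | c.decode (c.destOutput m (p.1, z, p.2)) = m}) ?_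
    refine measurable_measure_prodMk_left (ν := iidGaussian n N₂)
      (s := {q : ((Fin n → ℝ) × (Fin n → ℝ)) × (Fin n → ℝ) |
        c.decode (c.destOutput m (q.1.1, q.2, q.1.2)) = m}) ?_
    exact (by fun_prop : Measurable fun q : ((Fin n → ℝ) × (Fin n → ℝ)) × (Fin n → ℝ) =>
      (q.1.1, q.2, q.1.2)) (hms m)
  simp only [e]
  rw [← lintegral_finsetSum _ fun m _ => hmo m]
  refine (lintegral_mono fun s => ?_).trans (le_of_eq (by
    rw [lintegral_const, measure_univ, mul_one]))
  rw [← lintegral_finsetSum _ fun m _ => hmi m s]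
  refine (lintegral_mono fun z' => ?_).trans (le_of_eq (by
    rw [lintegral_const, measure_univ, mul_one]))
  have hg : Measurable fun y => c.decode (c.relay s y + y + z') := by
    have h1 : Measurable fun y => c.relay s y := c.measurable_relay.comp measurable_prodMk_left
    exact c.measurable_decode.comp (by fun_prop)
  exact hn M hM (fun m => c.source m s) (fun m => by
    rw [dotProduct_self_eq_sum_sq]; exact hpow.1 m s) s _ hg

theorem AchievableInformedSource.le {P₁ P₂ Q N₂ N₃ R : ℝ} (hP₁ : 0 < P₁) (hN₂ : 0 < N₂)
    (h : AchievableInformedSource P₁ P₂ Q N₂ N₃ R) : R ≤ 1 / 2 * Real.log (1 + P₁ / N₂) := by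
  by_contra! hR
  obtain ⟨n₀, h⟩ := h (1 / 4) (by norm_num)
  obtain ⟨n, hn, hn0⟩ := ((Code.half_le_errorProb (P₂ := P₂) hP₁ hN₂ hR).and
    (eventually_ge_atTop n₀)).exists
  obtain ⟨M, c, hM, hpow, herr⟩ := h n hn0
  have := hn M c Q N₃ hM hpow
  linarith

theorem Achievable.informedSource {P₁ P₂ Q N₂ N₃ R : ℝ} (h : Achievable P₁ P₂ Q N₂ N₃ R) :
    AchievableInformedSource P₁ P₂ Q N₂ N₃ R := fun ε hε => by
  obtain ⟨n₀, h⟩ := h ε hε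
  refine ⟨n₀, fun n hn => ?_⟩
  obtain ⟨M, c, hM, -, hpow, herr⟩ := h n hn
  exact ⟨M, c, hM, hpow, herr⟩

/-- The law of the total noise `S + (Z₂ + Z₃')` at the destination. -/
theorem map_total_noiseLaw (n : ℕ) {Q N₂ N₃ : ℝ} (hQ : 0 ≤ Q) (hN₂ : 0 ≤ N₂) (hN₂₃ : N₂ ≤ N₃) :
    (noiseLaw n Q N₂ N₃).map (fun ω => ω.1 + (ω.2.1 + ω.2.2)) = iidGaussian n (Q + N₃) := by
  have h1 := map_add_prod_iidGaussian n hN₂ (sub_nonneg.2 hN₂₃)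
  have h2 := map_add_prod_iidGaussian n hQ (hN₂.trans hN₂₃)
  rw [add_sub_cancel] at h1
  rw [← h2, ← h1, noiseLaw]
  conv_rhs => rw [← Measure.map_id (μ := iidGaussian n Q), Measure.map_prod_map _ _ measurable_id
    (by fun_prop), Measure.map_map (by fun_prop) (by fun_prop)]
  rfl

/-- Zero power forces a zero relay input, and `S + Z₂ + Z₃'` is then Gaussian noise of variance `Q +
N₃`, independent of the input of the uninformed source. -/
theorem Achievable.le_of_relay_silent {P₁ Q N₂ N₃ R : ℝ} (hP₁ : 0 < P₁) (hQ : 0 ≤ Q)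
    (hN₂ : 0 < N₂) (hN₂₃ : N₂ ≤ N₃) (h : Achievable P₁ 0 Q N₂ N₃ R) :
    R ≤ 1 / 2 * Real.log (1 + P₁ / (Q + N₃)) := by
  by_contra! hR
  have hV : 0 < Q + N₃ := by linarith
  obtain ⟨n₀, h⟩ := h (1 / 4) (by norm_num)
  obtain ⟨n, hn, hn0⟩ := ((awgn_correct_le hP₁ hV hR).and (eventually_ge_atTop n₀)).exists
  obtain ⟨M, c, hM, hun, hpow, herr⟩ := h n hn0
  have hrel : ∀ s y, c.relay s y = 0 := fun s y => by
    have := hpow.2 s y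
    rw [mul_zero] at this
    funext i
    have h0 := (Finset.sum_eq_zero_iff_of_nonneg fun i _ => sq_nonneg _).1
      (le_antisymm this (Finset.sum_nonneg fun i _ => sq_nonneg _)) i (Finset.mem_univ i)
    simpa using h0
  have hd : ∀ m ω, c.destOutput m ω = c.source m 0 + 0 + (ω.1 + (ω.2.1 + ω.2.2)) := fun m ω => by
    rw [Code.destOutput, Code.relayOutput, hrel, hun m ω.1 0]; abel
  have h1 := hn M hM (fun m => c.source m 0) (fun m => by
    rw [dotProduct_self_eq_sum_sq]; exact hpow.1 m 0) 0 c.decode c.measurable_decode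
  have h2 := one_le_of_correct_le c (Q := Q) (N₂ := N₂) (N₃ := N₃) hM ?_ c.measurable_destOutput
  · linarith
  · refine le_trans (le_of_eq (Finset.sum_congr rfl fun m _ => ?_)) h1
    rw [← map_total_noiseLaw n hQ hN₂.le hN₂₃, Measure.map_apply (by fun_prop)]
    · simp only [hd]; rfl
    · have := c.measurable_decode
      exact (by fun_prop : Measurable fun z => c.decode (c.source m 0 + 0 + z))
        (measurableSet_singleton m)

/-! ### Random codebooks -/

/-- Form of the random coding argument used throughout: one codeword is redrawn while all the others
stay fixed, so that a bound uniform in the others is enough. -/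
theorem pi_measure_le_of_update {ι X : Type*} [Fintype ι] [DecidableEq ι] [MeasurableSpace X]
    (μ : Measure X) [IsProbabilityMeasure μ] (i : ι) {A : Set (ι → X)} (hA : MeasurableSet A)
    {η : ℝ≥0∞} (h : ∀ U, μ {u | Function.update U i u ∈ A} ≤ η) :
    Measure.pi (fun _ : ι => μ) A ≤ η := by
  have hf : Measurable (A.indicator (1 : (ι → X) → ℝ≥0∞)) := measurable_one.indicator hA
  have hle := lintegral_le_of_lmarginal_le (μ := fun _ : ι => μ) {i} hf
    (measurable_const (a := η)) (fun U => by
      rw [lmarginal_singleton, lmarginal_singleton, lintegral_const, measure_univ, mul_one]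
      have hm : MeasurableSet {u | Function.update U i u ∈ A} := measurable_update U hA
      have e : (fun u => A.indicator (1 : (ι → X) → ℝ≥0∞) (Function.update U i u)) =
          {u | Function.update U i u ∈ A}.indicator 1 := rfl
      dsimp only
      rw [e, lintegral_indicator_one hm]
      exact h U)
  rwa [lintegral_indicator_one hA, lintegral_const, measure_univ, mul_one] at hle

theorem pi_measure_forall_notMem {J L X : Type*} [Fintype J] [Fintype L]
    [MeasurableSpace X] (μ : Measure X) [IsProbabilityMeasure μ] (j : J) {G : Set X}
    (hG : MeasurableSet G) :
    Measure.pi (fun _ : J × L => μ) {U | ∀ l, U (j, l) ∉ G} = (1 - μ G) ^ Fintype.card L := by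
  classical
  have e : {U : J × L → X | ∀ l, U (j, l) ∉ G} =
      Set.univ.pi fun i => if i.1 = j then Gᶜ else Set.univ := by
    ext U
    simp only [Set.mem_ofPred_eq, Set.mem_univ_pi]
    refine ⟨fun h i => ?_, fun h l => by simpa using h (j, l)⟩
    split_ifs with hi
    · obtain ⟨i, l⟩ := i
      subst hi
      exact h l
    · trivial
  rw [e, Measure.pi_pi, Fintype.prod_prod_type]
  rw [Finset.prod_eq_single j]
  · simp [prob_compl_eq_one_sub hG]
  · intro b _ hb
    simp [hb]
  · simp

theorem prod_le_of_forall_right {α β : Type*} [MeasurableSpace α] [MeasurableSpace β]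
    {μ : Measure α} {ν : Measure β} [SFinite μ] [IsProbabilityMeasure ν] {A : Set (α × β)}
    (hA : MeasurableSet A) {η : ℝ≥0∞} (h : ∀ y, μ {x | (x, y) ∈ A} ≤ η) : μ.prod ν A ≤ η := by
  rw [Measure.prod_apply_symm hA]
  refine (lintegral_mono h).trans ?_
  rw [lintegral_const, measure_univ, mul_one]

theorem prod_le_of_forall_left {α β : Type*} [MeasurableSpace α] [MeasurableSpace β]
    {μ : Measure α} {ν : Measure β} [IsProbabilityMeasure μ] [SFinite ν] {A : Set (α × β)}
    (hA : MeasurableSet A) {η : ℝ≥0∞} (h : ∀ x, ν {y | (x, y) ∈ A} ≤ η) : μ.prod ν A ≤ η := by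
  rw [Measure.prod_apply hA]
  refine (lintegral_mono h).trans ?_
  rw [lintegral_const, measure_univ, mul_one]

/-- A measurable decoder that returns the index of the unique test that is passed. -/
theorem exists_measurable_decoder {W Y : Type*} [Fintype W] [Nonempty W] [MeasurableSpace W]
    [MeasurableSpace Y] (A : W → Set Y) (hA : ∀ w, MeasurableSet (A w)) :
    ∃ d : Y → W, Measurable d ∧ ∀ y w, y ∈ A w → (∀ w', w' ≠ w → y ∉ A w') → d y = w := by
  classical
  suffices h : ∀ t : Finset W, ∃ d : Y → W, Measurable d ∧
      ∀ w ∈ t, ∀ y, y ∈ A w → (∀ w', w' ≠ w → y ∉ A w') → d y = w by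
    obtain ⟨d, hd, h⟩ := h Finset.univ
    exact ⟨d, hd, fun y w => h w (Finset.mem_univ w) y⟩
  intro t
  induction t using Finset.induction_on with
  | empty => exact ⟨fun _ => Classical.arbitrary W, measurable_const, by simp⟩
  | insert w t hw ih =>
    obtain ⟨d, hd, h⟩ := ih
    refine ⟨(A w).piecewise (fun _ => w) d, measurable_const.piecewise (hA w) hd, ?_⟩
    intro w' hw' y hy hu
    rcases Finset.mem_insert.1 hw' with rfl | hw'
    · exact Set.piecewise_eq_of_mem _ _ _ hy
    · rw [Set.piecewise_eq_of_notMem _ _ _ (hu w (by rintro rfl; exact hw hw'))]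
      exact h w' hw' y hy hu

/-! ### Random source codebooks -/

/-- The acceptance region of the decoders: codewords of about the right power that are close to the
estimate `c`. -/
def acceptance (k : ℕ) (σ τ δ : ℝ) (c : Fin k → ℝ) : Set (Fin k → ℝ) :=
  {u | (u - c) ⬝ᵥ (u - c) ≤ k * (τ + δ) ∧ k * (σ - δ) ≤ u ⬝ᵥ u}

theorem measurableSet_setOf_mem_acceptance {k : ℕ} {α : Type*} [MeasurableSpace α] (σ τ δ : ℝ)
    {f g : α → Fin k → ℝ} (hf : Measurable f) (hg : Measurable g) :
    MeasurableSet {a | f a ∈ acceptance k σ τ δ (g a)} := by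
  have h := measurable_dotProduct_self (k := k)
  exact (measurableSet_le (h.comp (hf.sub hg)) measurable_const).inter
    (measurableSet_le measurable_const (h.comp hf))

/-- On the acceptance region a vector is too long for its distance to `c`: the density of `N(0, σ)`
relative to `N(c, τ)` is at most about `(τ / σ)^(k/2)` there, whatever `c` is. -/
theorem measure_acceptance_le (k : ℕ) {σ τ δ : ℝ} (hσ : 0 < σ) (hτ : 0 < τ) (c : Fin k → ℝ) :
    iidGaussian k σ (acceptance k σ τ δ c) ≤ ENNReal.ofReal
      (Real.exp (-(k * (1 / 2 * Real.log (σ / τ) - δ * (1 / (2 * τ) + 1 / (2 * σ)))))) := by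
  rw [← shiftedGaussian_zero]
  refine (shiftedGaussian_le hσ hτ 0 c
    (measurableSet_setOf_mem_acceptance σ τ δ measurable_id measurable_const) ?_).trans
      ((mul_le_mul_right prob_le_one _).trans (by rw [mul_one]))
  rintro u ⟨h1, h2⟩
  rw [id_eq] at h1 h2
  rw [sub_zero]
  have h3 := div_le_div_of_nonneg_right h1 (by positivity : 0 ≤ 2 * τ)
  have h4 := div_le_div_of_nonneg_right h2 (by positivity : 0 ≤ 2 * σ)
  have e1 : (k : ℝ) * (τ + δ) / (2 * τ) = k * (1 / 2 + δ * (1 / (2 * τ))) := by field_simp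
  have e2 : (k : ℝ) * (σ - δ) / (2 * σ) = k * (1 / 2 - δ * (1 / (2 * σ))) := by field_simp
  have e3 : Real.log (τ / σ) = - Real.log (σ / τ) := by rw [← Real.log_inv, inv_div]
  rw [e1] at h3
  rw [e2] at h4
  rw [e3]
  linarith

/-- Error of the linear estimate with coefficient `β`. -/
theorem estimation_error_le {k : ℕ} {σ V δ β : ℝ} (hβ0 : 0 ≤ β) (hβ1 : β ≤ 1)
    {x v : Fin k → ℝ} (hx : x ⬝ᵥ x ≤ k * (σ + δ)) (hv : v ⬝ᵥ v ≤ k * (V + δ))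
    (hxv : |x ⬝ᵥ v| ≤ k * δ) :
    ((1 - β) • x - β • v) ⬝ᵥ ((1 - β) • x - β • v) ≤
      k * ((1 - β) ^ 2 * σ + β ^ 2 * V + δ) := by
  have e : ((1 - β) • x - β • v) ⬝ᵥ ((1 - β) • x - β • v) =
      (1 - β) ^ 2 * (x ⬝ᵥ x) - 2 * (β * (1 - β)) * (x ⬝ᵥ v) + β ^ 2 * (v ⬝ᵥ v) := by
    simp only [sub_dotProduct, dotProduct_sub, smul_dotProduct, dotProduct_smul, smul_eq_mul,
      dotProduct_comm v x]
    ring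
  rw [e]
  have h1 := mul_le_mul_of_nonneg_left hx (sq_nonneg (1 - β))
  have h2 := mul_le_mul_of_nonneg_left hv (sq_nonneg β)
  have h3 := mul_le_mul_of_nonneg_left (abs_le.1 hxv).1
    (show 0 ≤ 2 * (β * (1 - β)) by have := sub_nonneg.2 hβ1; positivity)
  nlinarith

/-- `σ / (σ + V)` is the coefficient of the best linear estimate and `σ V / (σ + V)` its error. By
`div_mmse`, the ratio of prior variance to error is `1 + σ / V`, which is how the capacity formula
enters. -/
theorem mmse_identity {σ V : ℝ} (hσ : 0 < σ) (hV : 0 < V) :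
    (1 - σ / (σ + V)) ^ 2 * σ + (σ / (σ + V)) ^ 2 * V = σ * V / (σ + V) := by
  have : σ + V ≠ 0 := by positivity
  field_simp
  ring

theorem div_mmse {σ V : ℝ} (hσ : 0 < σ) (hV : 0 < V) : σ / (σ * V / (σ + V)) = 1 + σ / V := by
  have : σ + V ≠ 0 := by positivity
  field_simp
  ring

/-- The exponent with which a wrong codeword is accepted. -/
def packingExponent (σ V δ : ℝ) : ℝ :=
  1 / 2 * Real.log (1 + σ / V) - δ * (1 / (2 * (σ * V / (σ + V))) + 1 / (2 * σ))

/-- The test of a codeword `x` against the channel output `y`. -/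
def passes (k : ℕ) (σ V δ : ℝ) (x y : Fin k → ℝ) : Prop :=
  x ∈ acceptance k σ (σ * V / (σ + V)) δ ((σ / (σ + V)) • y)

theorem measurableSet_passes {k : ℕ} {α : Type*} [MeasurableSpace α] (σ V δ : ℝ)
    {f g : α → Fin k → ℝ} (hf : Measurable f) (hg : Measurable g) :
    MeasurableSet {a | passes k σ V δ (f a) (g a)} :=
  measurableSet_setOf_mem_acceptance _ _ _ hf (by fun_prop)

/-- The bad event for the message `w` and the noise `v`, when `w` is to be distinguished from the
messages in `T`. -/
def sourceBad {W : Type*} (k : ℕ) (σ V δ : ℝ) (T : Finset W) (w : W) :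
    Set ((W → Fin k → ℝ) × (Fin k → ℝ)) :=
  {p | ¬(p.1 w ⬝ᵥ p.1 w ≤ k * (σ + δ) ∧ passes k σ V δ (p.1 w) (p.1 w + p.2) ∧
    ∀ w' ∈ T, ¬ passes k σ V δ (p.1 w') (p.1 w + p.2))}

theorem measurableSet_sourceBad {W : Type*} (k : ℕ) (σ V δ : ℝ) (T : Finset W) (w : W) :
    MeasurableSet (sourceBad k σ V δ T w) := by
  have hc : ∀ w, Measurable fun p : (W → Fin k → ℝ) × (Fin k → ℝ) => p.1 w := fun w =>
    (measurable_pi_apply w).comp measurable_fst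
  refine MeasurableSet.compl (MeasurableSet.inter ?_ (MeasurableSet.inter ?_ ?_))
  · exact measurableSet_le (measurable_dotProduct_self.comp (hc w)) measurable_const
  · exact measurableSet_passes _ _ _ (hc w) ((hc w).add measurable_snd)
  · have e : {p : (W → Fin k → ℝ) × (Fin k → ℝ) |
        ∀ w' ∈ T, ¬ passes k σ V δ (p.1 w') (p.1 w + p.2)} =
        ⋂ w' ∈ T, {p | passes k σ V δ (p.1 w') (p.1 w + p.2)}ᶜ := by ext; simp
    have h : MeasurableSet {p : (W → Fin k → ℝ) × (Fin k → ℝ) |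
        ∀ w' ∈ T, ¬ passes k σ V δ (p.1 w') (p.1 w + p.2)} := by
      rw [e]
      exact Finset.measurableSet_biInter T fun w' _ =>
        (measurableSet_passes σ V δ (hc w') ((hc w).add measurable_snd)).compl
    exact h

/-- The noise `v` is an arbitrary fixed vector of bounded power: the Gaussian codeword alone makes
the inner product small, and a wrong codeword is independent of everything in the test. This is why
the relay input and the state may later serve as noise although they are not jointly Gaussian. -/
theorem measure_sourceBad_slice_le {W : Type*} [Fintype W] {k : ℕ} (hk : 0 < k)
    {σ V δ : ℝ} (hσ : 0 < σ) (hV : 0 < V) (hδ : 0 < δ) {T : Finset W} {w : W} (hw : w ∉ T)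
    {v : Fin k → ℝ} (hv : v ⬝ᵥ v ≤ k * (V + δ)) :
    Measure.pi (fun _ : W => iidGaussian k σ) {X | (X, v) ∈ sourceBad k σ V δ T w} ≤
      ENNReal.ofReal (Var[fun x : ℝ => x ^ 2; gaussianReal 0 σ.toNNReal] / δ ^ 2 / k) +
      ENNReal.ofReal ((V + δ) * σ / δ ^ 2 / k) +
      T.card * ENNReal.ofReal (Real.exp (-(k * packingExponent σ V δ))) := by
  classical
  have hsub : {X | (X, v) ∈ sourceBad k σ V δ T w} ⊆
      (Function.eval w ⁻¹' {x | k * δ ≤ |x ⬝ᵥ x - k * σ|} ∪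
        Function.eval w ⁻¹' {x | k * δ ≤ |v ⬝ᵥ x|}) ∪
      ⋃ w' ∈ T, {X | passes k σ V δ (X w') (X w + v)} := by
    intro X hX
    by_contra hcon
    simp only [Set.mem_union, Set.mem_preimage, Set.mem_ofPred_eq, Set.mem_iUnion, not_or, not_le,
      not_exists, Function.eval] at hcon
    obtain ⟨⟨h1, h2⟩, h3⟩ := hcon
    have h1' := abs_lt.1 h1
    refine hX ⟨by dsimp only; linarith, ⟨?_, by dsimp only; linarith⟩, h3⟩
    have e : X w - (σ / (σ + V)) • (X w + v) =
        (1 - σ / (σ + V)) • X w - (σ / (σ + V)) • v := by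
      rw [smul_add, sub_smul, one_smul]; abel
    dsimp only
    rw [e, ← mmse_identity hσ hV]
    refine estimation_error_le (by positivity) ?_ (by linarith) hv ?_
    · rw [div_le_one (by positivity)]; linarith
    · rw [dotProduct_comm]; exact h2.le
  refine (measure_mono hsub).trans ((measure_union_le _ _).trans (add_le_add
    ((measure_union_le _ _).trans (add_le_add ?_ ?_)) ?_))
  · have := measurable_dotProduct_self (k := k)
    have hm : MeasurableSet {x : Fin k → ℝ | k * δ ≤ |x ⬝ᵥ x - k * σ|} :=
      measurableSet_le measurable_const (by fun_prop)
    rw [(measurePreserving_eval (fun _ : W => iidGaussian k σ) w).measure_preimage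
      hm.nullMeasurableSet]
    exact norm_sq_concentration k hσ.le hδ hk
  · have := measurable_dotProduct_left v
    have hm : MeasurableSet {x : Fin k → ℝ | k * δ ≤ |v ⬝ᵥ x|} :=
      measurableSet_le measurable_const (by fun_prop)
    rw [(measurePreserving_eval (fun _ : W => iidGaussian k σ) w).measure_preimage
      hm.nullMeasurableSet]
    exact dotProduct_concentration hσ.le hδ hk hv
  · refine (measure_biUnion_finset_le _ _).trans ?_
    rw [← nsmul_eq_mul]
    refine Finset.sum_le_card_nsmul _ _ _ fun w' hw' => ?_
    have hne : w ≠ w' := by rintro rfl; exact hw hw'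
    have hm : MeasurableSet {X : W → Fin k → ℝ | passes k σ V δ (X w') (X w + v)} :=
      measurableSet_passes σ V δ (f := fun X : W → Fin k → ℝ => X w')
        (g := fun X => X w + v) (measurable_pi_apply w') (by fun_prop)
    -- Only the wrong codeword `w'` is redrawn; the centre of its acceptance region depends on `X w`
    -- and `v` only.
    refine pi_measure_le_of_update (iidGaussian k σ) w' hm fun X => ?_
    simp only [Set.mem_ofPred_eq, Function.update_self, Function.update_of_ne hne]
    have h := measure_acceptance_le k (δ := δ) hσ (by positivity : 0 < σ * V / (σ + V))
      ((σ / (σ + V)) • (X w + v))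
    rw [div_mmse hσ hV] at h
    exact h

theorem prod_sourceBad_le {W : Type*} [Fintype W] {k : ℕ} (hk : 0 < k)
    {σ V δ : ℝ} (hσ : 0 < σ) (hV : 0 < V) (hδ : 0 < δ) {T : Finset W} {w : W} (hw : w ∉ T)
    (ν : Measure (Fin k → ℝ)) [IsProbabilityMeasure ν] :
    (Measure.pi (fun _ : W => iidGaussian k σ)).prod ν (sourceBad k σ V δ T w) ≤
      ν {v | ¬ v ⬝ᵥ v ≤ k * (V + δ)} + 
      (ENNReal.ofReal (Var[fun x : ℝ => x ^ 2; gaussianReal 0 σ.toNNReal] / δ ^ 2 / k) +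
      ENNReal.ofReal ((V + δ) * σ / δ ^ 2 / k) +
      T.card * ENNReal.ofReal (Real.exp (-(k * packingExponent σ V δ)))) := by
  have hg : MeasurableSet {p : (W → Fin k → ℝ) × (Fin k → ℝ) | p.2 ⬝ᵥ p.2 ≤ k * (V + δ)} :=
    measurableSet_le (measurable_dotProduct_self.comp measurable_snd) measurable_const
  have hsub : sourceBad k σ V δ T w ⊆ (Set.univ ×ˢ {v | ¬ v ⬝ᵥ v ≤ k * (V + δ)}) ∪
      (sourceBad k σ V δ T w ∩ {p | p.2 ⬝ᵥ p.2 ≤ k * (V + δ)}) := by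
    intro p hp
    by_cases h : p.2 ⬝ᵥ p.2 ≤ k * (V + δ)
    · exact Or.inr ⟨hp, h⟩
    · exact Or.inl ⟨trivial, h⟩
  refine (measure_mono hsub).trans ((measure_union_le _ _).trans (add_le_add ?_ ?_))
  · rw [Measure.prod_prod, measure_univ, one_mul]
  · refine prod_le_of_forall_right ((measurableSet_sourceBad k σ V δ T w).inter hg) fun v => ?_
    by_cases h : v ⬝ᵥ v ≤ k * (V + δ)
    · refine (measure_mono fun X hX => ?_).trans (measure_sourceBad_slice_le hk hσ hV hδ hw h)
      exact hX.1
    · have : {X : W → Fin k → ℝ | (X, v) ∈ sourceBad k σ V δ T w ∩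
          {p | p.2 ⬝ᵥ p.2 ≤ k * (V + δ)}} = ∅ := by
        ext X
        simp only [Set.mem_ofPred_eq, Set.mem_inter_iff, Set.mem_empty_iff_false, iff_false]
        exact fun hX => h hX.2
      rw [this, measure_empty]
      exact zero_le

/-! ### Dirty paper coding -/

/-- Auxiliary codewords `u` for which `u - β s` has power about `P` and is nearly orthogonal
to `s`. -/
def coverSet (k : ℕ) (P β δ : ℝ) (s : Fin k → ℝ) : Set (Fin k → ℝ) :=
  {u | |(u - β • s) ⬝ᵥ (u - β • s) - k * P| < k * δ ∧ |s ⬝ᵥ (u - β • s)| < k * δ}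

theorem measurable_dotProduct_comp {k : ℕ} {α : Type*} [MeasurableSpace α]
    {f g : α → Fin k → ℝ} (hf : Measurable f) (hg : Measurable g) :
    Measurable fun a => f a ⬝ᵥ g a := by
  unfold dotProduct
  fun_prop

theorem measurableSet_mem_coverSet {k : ℕ} {α : Type*} [MeasurableSpace α] (P β δ : ℝ)
    {f g : α → Fin k → ℝ} (hf : Measurable f) (hg : Measurable g) :
    MeasurableSet {a | f a ∈ coverSet k P β δ (g a)} := by
  have h0 : Measurable fun a => f a - β • g a := by fun_prop
  have h1 := measurable_dotProduct_comp h0 h0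
  have h2 := measurable_dotProduct_comp hg h0
  exact (measurableSet_lt (continuous_abs.measurable.comp (h1.sub_const _)) measurable_const).inter
    (measurableSet_lt (continuous_abs.measurable.comp h2) measurable_const)

/-- Source of the factor `(1 + |β|)²` in all later tolerances: the three deviations carry weights
`1`, `2 |β|` and `β²`. -/
theorem norm_sq_add_smul_bounds {k : ℕ} {P Q β δ : ℝ} {x s : Fin k → ℝ}
    (hx : |x ⬝ᵥ x - k * P| < k * δ) (hsx : |s ⬝ᵥ x| < k * δ) (hs : |s ⬝ᵥ s - k * Q| < k * δ) :
    |(x + β • s) ⬝ᵥ (x + β • s) - k * (P + β ^ 2 * Q)| ≤ k * (δ * (1 + |β|) ^ 2) := by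
  have e : (x + β • s) ⬝ᵥ (x + β • s) - k * (P + β ^ 2 * Q) =
      (x ⬝ᵥ x - k * P) + 2 * β * (s ⬝ᵥ x) + β ^ 2 * (s ⬝ᵥ s - k * Q) := by
    simp only [add_dotProduct, dotProduct_add, smul_dotProduct, dotProduct_smul, smul_eq_mul,
      dotProduct_comm x s]
    ring
  rw [e]
  refine (abs_add_three _ _ _).trans ?_
  rw [abs_mul, abs_mul, abs_mul, abs_of_nonneg (sq_nonneg β), abs_two]
  have h2 := mul_le_mul_of_nonneg_left hsx.le (show 0 ≤ 2 * |β| by positivity)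
  have h3 := mul_le_mul_of_nonneg_left hs.le (sq_nonneg β)
  have h4 : k * (δ * (1 + |β|) ^ 2) = k * δ + 2 * |β| * (k * δ) + β ^ 2 * (k * δ) := by
    rw [← sq_abs β]; ring
  linarith

/-- Under `N(β s, P)` the cover set has probability at least one half by Chebyshev. Passing to the
codebook law `N(0, P + β² Q)` costs a factor `exp L`, where `L / k` is about `½ log ((P + β² Q) /
P)`, the rate needed inside a bin to cover the state. -/
theorem le_measure_coverSet {k : ℕ} (hk : 0 < k) {P Q β δ : ℝ} (hP : 0 < P) (hQ : 0 ≤ Q)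
    (hδ : 0 < δ)
    (hk2 : ENNReal.ofReal (Var[fun x : ℝ => x ^ 2; gaussianReal 0 P.toNNReal] / δ ^ 2 / k) +
      ENNReal.ofReal ((Q + δ) * P / δ ^ 2 / k) ≤ ENNReal.ofReal (1 / 2))
    {s : Fin k → ℝ} (hs : |s ⬝ᵥ s - k * Q| < k * δ) :
    ENNReal.ofReal (1 / 2 * Real.exp (-(k * (1 / 2 * Real.log ((P + β ^ 2 * Q) / P) +
      δ * (1 / (2 * P) + (1 + |β|) ^ 2 / (2 * (P + β ^ 2 * Q))))))) ≤
      iidGaussian k (P + β ^ 2 * Q) (coverSet k P β δ s) := by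
  set σ := P + β ^ 2 * Q with hσ
  have hσ0 : 0 < σ := by positivity
  have hm : MeasurableSet (coverSet k P β δ s) :=
    measurableSet_mem_coverSet P β δ measurable_id measurable_const
  have h1 : ENNReal.ofReal (1 / 2) ≤ shiftedGaussian (β • s) P (coverSet k P β δ s) := by
    have hc : shiftedGaussian (β • s) P (coverSet k P β δ s)ᶜ ≤ ENNReal.ofReal (1 / 2) := by
      rw [← map_add_iidGaussian, Measure.map_apply (by fun_prop) hm.compl]
      refine le_trans (measure_mono ?_) ((measure_union_le _ _).trans ((add_le_add
        (norm_sq_concentration k hP.le hδ hk) (dotProduct_concentration (a := s) (A := Q + δ)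
          hP.le hδ hk ?_)).trans hk2))
      · intro z hz
        by_contra hcon
        simp only [Set.mem_union, Set.mem_ofPred_eq, not_or, not_le] at hcon
        refine hz ⟨?_, ?_⟩
        · simpa using hcon.1
        · simpa using hcon.2
      · have := (abs_lt.1 hs).2
        linarith
    rw [prob_compl_eq_one_sub hm] at hc
    have h2 := tsub_le_iff_right.1 hc
    have h3 : ENNReal.ofReal (1 / 2) + ENNReal.ofReal (1 / 2) = 1 := by
      rw [← ENNReal.ofReal_add (by norm_num) (by norm_num)]; norm_num
    rw [← h3] at h2
    exact (ENNReal.add_le_add_iff_left (by simp)).1 h2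
  set L := k * (1 / 2 * Real.log (σ / P) + δ * (1 / (2 * P) + (1 + |β|) ^ 2 / (2 * σ))) with hL
  have h2 := shiftedGaussian_le hP hσ0 (β • s) 0 hm (L := L) (by
    rintro u ⟨hu1, hu2⟩
    have hu := norm_sq_add_smul_bounds (β := β) hu1 hu2 hs
    rw [sub_add_cancel, ← hσ] at hu
    rw [sub_zero]
    have h3 := div_le_div_of_nonneg_right (abs_le.1 hu).2 (by positivity : 0 ≤ 2 * σ)
    have h4 := div_le_div_of_nonneg_right (abs_lt.1 hu1).1.le (by positivity : 0 ≤ 2 * P)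
    have e1 : (u ⬝ᵥ u - k * σ) / (2 * σ) = (u ⬝ᵥ u) / (2 * σ) - k / 2 := by field_simp
    have e2 : ((u - β • s) ⬝ᵥ (u - β • s) - k * P) / (2 * P) =
      ((u - β • s) ⬝ᵥ (u - β • s)) / (2 * P) - k / 2 := by field_simp
    have e3 : -(k * δ) / (2 * P) = - (k * (δ * (1 / (2 * P)))) := by field_simp
    have e4 : k * (δ * (1 + |β|) ^ 2) / (2 * σ) = k * (δ * ((1 + |β|) ^ 2 / (2 * σ))) := by
      field_simp
    rw [e1, e4] at h3
    rw [e2, e3] at h4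
    rw [hL]
    linarith)
  rw [shiftedGaussian_zero] at h2
  have h3 := mul_le_mul_right (h1.trans h2) (ENNReal.ofReal (Real.exp (-L)))
  rw [← mul_assoc, ← ENNReal.ofReal_mul (Real.exp_pos _).le, ← ENNReal.ofReal_mul
    (Real.exp_pos _).le, ← Real.exp_add, neg_add_cancel, Real.exp_zero, ENNReal.ofReal_one,
    one_mul, mul_comm (Real.exp _)] at h3
  exact h3

theorem one_sub_pow_le_exp {p : ℝ} {q : ℝ≥0∞}
    (h : ENNReal.ofReal p ≤ q) (n : ℕ) :
    (1 - q) ^ n ≤ ENNReal.ofReal (Real.exp (-(n * p))) := by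
  have h1 : 1 - q ≤ ENNReal.ofReal (Real.exp (-p)) := by
    refine (tsub_le_tsub_left h 1).trans ?_
    by_cases hp : 0 ≤ p
    · rw [← ENNReal.ofReal_one, ← ENNReal.ofReal_sub _ hp]
      exact ENNReal.ofReal_le_ofReal (by have := Real.add_one_le_exp (-p); linarith)
    · refine tsub_le_self.trans ?_
      rw [← ENNReal.ofReal_one]
      exact ENNReal.ofReal_le_ofReal (Real.one_le_exp (by linarith))
  refine (pow_le_pow_left' h1 n).trans (le_of_eq ?_)
  rw [← ENNReal.ofReal_pow (Real.exp_pos _).le, ← Real.exp_nat_mul]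
  congr 2
  ring

open Classical in
/-- The dirty paper encoder: the first auxiliary codeword of the bin `j` that lies in the cover set
of `s`, minus `β s`. -/
def dirtyEncode {J L k : ℕ} (P β δ : ℝ) (U : Fin J × Fin L → Fin k → ℝ) (j : Fin J)
    (s : Fin k → ℝ) : Fin k → ℝ :=
  ∑ l, if U (j, l) ∈ coverSet k P β δ s ∧ ∀ l' < l, U (j, l') ∉ coverSet k P β δ s then
    U (j, l) - β • s else 0

theorem dirtyEncode_spec {J L k : ℕ} {P β δ : ℝ} {U : Fin J × Fin L → Fin k → ℝ} {j : Fin J}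
    {s : Fin k → ℝ} (h : ∃ l, U (j, l) ∈ coverSet k P β δ s) :
    ∃ l, U (j, l) ∈ coverSet k P β δ s ∧ dirtyEncode P β δ U j s = U (j, l) - β • s := by
  obtain ⟨l, hl, hmin⟩ := WellFounded.has_min (wellFounded_lt (α := Fin L))
    {l | U (j, l) ∈ coverSet k P β δ s} h
  refine ⟨l, hl, ?_⟩
  unfold dirtyEncode
  rw [Finset.sum_eq_single l]
  · rw [if_pos ⟨hl, fun l' hl' hm => hmin l' hm hl'⟩]
  · intro l' _ hne
    rw [if_neg]
    rintro ⟨h1, h2⟩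
    rcases lt_or_gt_of_ne hne with h3 | h3
    · exact hmin l' h1 h3
    · exact h2 l h3 hl
  · simp

/-- The word sent for bin `j` ignores the other bins, so a competing codeword can be redrawn without
changing the channel output. -/
theorem dirtyEncode_update {J L k : ℕ} (P β δ : ℝ) (U : Fin J × Fin L → Fin k → ℝ) {j : Fin J}
    (s : Fin k → ℝ) {i : Fin J × Fin L} (hi : i.1 ≠ j) (u : Fin k → ℝ) :
    dirtyEncode P β δ (Function.update U i u) j s = dirtyEncode P β δ U j s := by
  have h : ∀ l, Function.update U i u (j, l) = U (j, l) := fun l =>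
    Function.update_of_ne (by rintro rfl; exact hi rfl) _ _
  classical
  unfold dirtyEncode
  exact Finset.sum_congr rfl fun l _ => if_congr (by simp only [h]) (by rw [h]) rfl

theorem measurable_dirtyEncode {J L k : ℕ} (P β δ : ℝ) (j : Fin J) :
    Measurable fun p : (Fin J × Fin L → Fin k → ℝ) × (Fin k → ℝ) =>
      dirtyEncode P β δ p.1 j p.2 := by
  classical
  have hU : ∀ l, Measurable fun p : (Fin J × Fin L → Fin k → ℝ) × (Fin k → ℝ) => p.1 (j, l) :=
    fun l => (measurable_pi_apply (j, l)).comp measurable_fst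
  have hC : ∀ l, MeasurableSet {p : (Fin J × Fin L → Fin k → ℝ) × (Fin k → ℝ) |
      p.1 (j, l) ∈ coverSet k P β δ p.2} := fun l =>
    measurableSet_mem_coverSet P β δ (hU l) measurable_snd
  unfold dirtyEncode
  refine Finset.measurable_fun_sum _ fun l _ => Measurable.ite ?_ ?_ measurable_const
  · have e : {p : (Fin J × Fin L → Fin k → ℝ) × (Fin k → ℝ) | p.1 (j, l) ∈ coverSet k P β δ p.2 ∧
        ∀ l' < l, p.1 (j, l') ∉ coverSet k P β δ p.2} =
        {p | p.1 (j, l) ∈ coverSet k P β δ p.2} ∩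
          ⋂ l' ∈ Finset.Iio l, {p | p.1 (j, l') ∈ coverSet k P β δ p.2}ᶜ := by
      ext; simp
    rw [e]
    exact (hC l).inter (Finset.measurableSet_biInter _ fun l' _ => (hC l').compl)
  · have := hU l
    fun_prop

/-- The space of a codebook of auxiliary codewords, a state and a noise sequence. -/
abbrev DirtySpace (J L k : ℕ) : Type :=
  (Fin J × Fin L → Fin k → ℝ) × (Fin k → ℝ) × (Fin k → ℝ)

/-- The joint law of the codebook, the state and the noise. -/
abbrev dirtyLaw (J L k : ℕ) (σ Q N : ℝ) : Measure (DirtySpace J L k) :=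
  (Measure.pi fun _ : Fin J × Fin L => iidGaussian k σ).prod
    ((iidGaussian k Q).prod (iidGaussian k N))

theorem dirtyLaw_state_le {J L k : ℕ} (hk : 0 < k) (σ : ℝ) {Q δ : ℝ} (N : ℝ) (hQ : 0 ≤ Q)
    (hδ : 0 < δ) :
    dirtyLaw J L k σ Q N {p | k * δ ≤ |p.2.1 ⬝ᵥ p.2.1 - k * Q|} ≤
      ENNReal.ofReal (Var[fun x : ℝ => x ^ 2; gaussianReal 0 Q.toNNReal] / δ ^ 2 / k) := by
  have hm : MeasurableSet {p : DirtySpace J L k | k * δ ≤ |p.2.1 ⬝ᵥ p.2.1 - k * Q|} := by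
    have h1 : Measurable fun p : DirtySpace J L k => p.2.1 := by fun_prop
    have h2 := measurable_dotProduct_comp h1 h1
    exact measurableSet_le measurable_const (by fun_prop)
  refine prod_le_of_forall_left hm fun U => ?_
  refine prod_le_of_forall_right (measurable_prodMk_left hm) fun z => ?_
  exact norm_sq_concentration k hQ hδ hk

/-- The `L` codewords of a bin are independent, so all of them miss the cover set with probability
`(1 - q) ^ L ≤ exp (-L q)`. -/
theorem dirtyLaw_cover_le {J L k : ℕ} (hk : 0 < k) {P Q β δ : ℝ} (N : ℝ) (hP : 0 < P)
    (hQ : 0 ≤ Q) (hδ : 0 < δ)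
    (hk2 : ENNReal.ofReal (Var[fun x : ℝ => x ^ 2; gaussianReal 0 P.toNNReal] / δ ^ 2 / k) +
      ENNReal.ofReal ((Q + δ) * P / δ ^ 2 / k) ≤ ENNReal.ofReal (1 / 2)) (j : Fin J) :
    dirtyLaw J L k (P + β ^ 2 * Q) Q N {p | |p.2.1 ⬝ᵥ p.2.1 - k * Q| < k * δ ∧
      ∀ l, p.1 (j, l) ∉ coverSet k P β δ p.2.1} ≤
    ENNReal.ofReal (Real.exp (-(L * (1 / 2 * Real.exp (-(k * (1 / 2 *
      Real.log ((P + β ^ 2 * Q) / P) +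
      δ * (1 / (2 * P) + (1 + |β|) ^ 2 / (2 * (P + β ^ 2 * Q)))))))))) := by
  have hm : MeasurableSet {p : DirtySpace J L k | |p.2.1 ⬝ᵥ p.2.1 - k * Q| < k * δ ∧
      ∀ l, p.1 (j, l) ∉ coverSet k P β δ p.2.1} := by
    have h1 : Measurable fun p : DirtySpace J L k => p.2.1 := by fun_prop
    have h2 := measurable_dotProduct_comp h1 h1
    have h3 : ∀ l, Measurable fun p : DirtySpace J L k => p.1 (j, l) := fun l =>
      (measurable_pi_apply (j, l)).comp measurable_fst
    rw [Set.ofPred_and]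
    refine (measurableSet_lt (by fun_prop) measurable_const).inter ?_
    rw [Set.ofPred_forall]
    exact MeasurableSet.iInter fun l => (measurableSet_mem_coverSet P β δ (h3 l) h1).compl
  refine prod_le_of_forall_right hm fun sz => ?_
  by_cases hs : |sz.1 ⬝ᵥ sz.1 - k * Q| < k * δ
  · have hc := le_measure_coverSet (β := β) hk hP hQ hδ hk2 hs
    have hmc : MeasurableSet (coverSet k P β δ sz.1) :=
      measurableSet_mem_coverSet P β δ measurable_id measurable_const
    have h1 := pi_measure_forall_notMem (L := Fin L) (iidGaussian k (P + β ^ 2 * Q)) j hmc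
    rw [Fintype.card_fin] at h1
    exact le_trans (measure_mono fun U hU => hU.2) (h1.trans_le (one_sub_pow_le_exp hc L))
  · refine le_trans (le_of_eq ?_) zero_le
    convert! measure_empty (μ := Measure.pi fun _ : Fin J × Fin L => iidGaussian k (P + β ^ 2 * Q))
    ext U
    simp only [Set.mem_ofPred_eq, Set.mem_empty_iff_false, iff_false]
    exact fun h => hs h.1

/-- The noise is independent of the codebook and the state, hence of the encoded word `x`; with
these fixed, Chebyshev applies. -/
theorem dirtyLaw_noise_le {J L k : ℕ} (hk : 0 < k) (σ : ℝ) {P Q N δ : ℝ}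
    (hN : 0 < N) (hδ : 0 < δ)
    {x : (Fin J × Fin L → Fin k → ℝ) × (Fin k → ℝ) → Fin k → ℝ} (hx : Measurable x) :
    dirtyLaw J L k σ Q N {p | (p.2.1 ⬝ᵥ p.2.1 ≤ k * (Q + δ) ∧
        x (p.1, p.2.1) ⬝ᵥ x (p.1, p.2.1) ≤ k * (P + δ)) ∧
      (k * δ ≤ |p.2.2 ⬝ᵥ p.2.2 - k * N| ∨ k * δ ≤ |x (p.1, p.2.1) ⬝ᵥ p.2.2| ∨
        k * δ ≤ |p.2.1 ⬝ᵥ p.2.2|)} ≤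
    ENNReal.ofReal (Var[fun x : ℝ => x ^ 2; gaussianReal 0 N.toNNReal] / δ ^ 2 / k) +
      (ENNReal.ofReal ((P + δ) * N / δ ^ 2 / k) + ENNReal.ofReal ((Q + δ) * N / δ ^ 2 / k)) := by
  have hm : MeasurableSet {p : DirtySpace J L k | (p.2.1 ⬝ᵥ p.2.1 ≤ k * (Q + δ) ∧
        x (p.1, p.2.1) ⬝ᵥ x (p.1, p.2.1) ≤ k * (P + δ)) ∧
      (k * δ ≤ |p.2.2 ⬝ᵥ p.2.2 - k * N| ∨ k * δ ≤ |x (p.1, p.2.1) ⬝ᵥ p.2.2| ∨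
        k * δ ≤ |p.2.1 ⬝ᵥ p.2.2|)} := by
    have hms : Measurable fun p : DirtySpace J L k => p.2.1 := by fun_prop
    have hmz : Measurable fun p : DirtySpace J L k => p.2.2 := by fun_prop
    have hmx : Measurable fun p : DirtySpace J L k => x (p.1, p.2.1) :=
      hx.comp (measurable_fst.prodMk hms)
    have hss := measurable_dotProduct_comp hms hms
    have hzz := measurable_dotProduct_comp hmz hmz
    have hxx := measurable_dotProduct_comp hmx hmx
    have hxz := measurable_dotProduct_comp hmx hmz
    have hsz := measurable_dotProduct_comp hms hmz
    simp only [Set.ofPred_and, Set.ofPred_or]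
    exact ((measurableSet_le hss measurable_const).inter
      (measurableSet_le hxx measurable_const)).inter
      ((measurableSet_le measurable_const (by fun_prop)).union
        ((measurableSet_le measurable_const (by fun_prop)).union
          (measurableSet_le measurable_const (by fun_prop))))
  refine prod_le_of_forall_left hm fun U => ?_
  refine prod_le_of_forall_left (measurable_prodMk_left hm) fun s => ?_
  by_cases hS : s ⬝ᵥ s ≤ k * (Q + δ) ∧ x (U, s) ⬝ᵥ x (U, s) ≤ k * (P + δ)
  · refine le_trans (measure_mono (t := {z | k * δ ≤ |z ⬝ᵥ z - k * N|} ∪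
      ({z | k * δ ≤ |x (U, s) ⬝ᵥ z|} ∪ {z | k * δ ≤ |s ⬝ᵥ z|})) fun z hz => hz.2) ?_
    refine (measure_union_le _ _).trans (add_le_add ?_ ((measure_union_le _ _).trans
      (add_le_add ?_ ?_)))
    · exact norm_sq_concentration k hN.le hδ hk
    · exact dotProduct_concentration hN.le hδ hk hS.2
    · exact dotProduct_concentration hN.le hδ hk hS.1
  · refine le_trans (le_of_eq ?_) zero_le
    convert! measure_empty (μ := iidGaussian k N)
    ext z
    simp only [Set.mem_ofPred_eq, Set.mem_empty_iff_false, iff_false]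
    exact fun h => hS h.1

theorem dirtyLaw_accept_le {J L k : ℕ} {P β δ σ τ δ' : ℝ} (Q N α γ : ℝ) (hσ : 0 < σ)
    (hτ : 0 < τ) {j : Fin J} {i : Fin J × Fin L} (hi : i.1 ≠ j) :
    dirtyLaw J L k σ Q N {p | p.1 i ∈ acceptance k σ τ δ'
      (α • (dirtyEncode P β δ p.1 j p.2.1 + γ • p.2.1 + p.2.2))} ≤ ENNReal.ofReal
      (Real.exp (-(k * (1 / 2 * Real.log (σ / τ) - δ' * (1 / (2 * τ) + 1 / (2 * σ)))))) := by
  have hm : MeasurableSet {p : DirtySpace J L k | p.1 i ∈ acceptance k σ τ δ'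
      (α • (dirtyEncode P β δ p.1 j p.2.1 + γ • p.2.1 + p.2.2))} := by
    have hms : Measurable fun p : DirtySpace J L k => p.2.1 := by fun_prop
    have hmx : Measurable fun p : DirtySpace J L k => dirtyEncode P β δ p.1 j p.2.1 :=
      (measurable_dirtyEncode (L := L) (k := k) P β δ j).comp
        (f := fun p : DirtySpace J L k => (p.1, p.2.1)) (measurable_fst.prodMk hms)
    have hmU : Measurable fun p : DirtySpace J L k => p.1 i :=
      (measurable_pi_apply i).comp measurable_fst
    have hmy : Measurable fun p : DirtySpace J L k =>
        α • (dirtyEncode P β δ p.1 j p.2.1 + γ • p.2.1 + p.2.2) := by fun_prop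
    exact measurableSet_setOf_mem_acceptance _ _ _ hmU hmy
  refine prod_le_of_forall_right hm fun sz => ?_
  refine pi_measure_le_of_update (iidGaussian k σ) i (measurable_prodMk_right hm) fun U => ?_
  refine le_trans (measure_mono fun u hu => ?_) (measure_acceptance_le k (δ := δ') hσ hτ
    (α • (dirtyEncode P β δ U j sz.1 + γ • sz.1 + sz.2)))
  have hacc : Function.update U i u i ∈ acceptance k σ τ δ'
    (α • (dirtyEncode P β δ (Function.update U i u) j sz.1 + γ • sz.1 + sz.2)) := hu
  rwa [Function.update_self, dirtyEncode_update _ _ _ _ _ hi] at hacc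

/-- The event on which dirty paper coding of `j` succeeds. -/
def dirtyGood {J L : ℕ} (k : ℕ) (P Q N α β γ δ δ' : ℝ) (j : Fin J) (p : DirtySpace J L k) : Prop :=
  |p.2.1 ⬝ᵥ p.2.1 - k * Q| < k * δ ∧ (∃ l, p.1 (j, l) ∈ coverSet k P β δ p.2.1) ∧
    |p.2.2 ⬝ᵥ p.2.2 - k * N| < k * δ ∧ |dirtyEncode P β δ p.1 j p.2.1 ⬝ᵥ p.2.2| < k * δ ∧
    |p.2.1 ⬝ᵥ p.2.2| < k * δ ∧
    ∀ i : Fin J × Fin L, i.1 ≠ j → p.1 i ∉ acceptance k (P + β ^ 2 * Q) (P * N / (P + N)) δ'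
      (α • (dirtyEncode P β δ p.1 j p.2.1 + γ • p.2.1 + p.2.2))

theorem dirtyLaw_not_good_le {J L k : ℕ} (hk : 0 < k) {P Q N β δ : ℝ} (α γ δ' : ℝ) (hP : 0 < P)
    (hQ : 0 ≤ Q) (hN : 0 < N) (hδ : 0 < δ)
    (hk2 : ENNReal.ofReal (Var[fun x : ℝ => x ^ 2; gaussianReal 0 P.toNNReal] / δ ^ 2 / k) +
      ENNReal.ofReal ((Q + δ) * P / δ ^ 2 / k) ≤ ENNReal.ofReal (1 / 2)) (j : Fin J) :
    dirtyLaw J L k (P + β ^ 2 * Q) Q N {p | ¬ dirtyGood k P Q N α β γ δ δ' j p} ≤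
    ENNReal.ofReal (Var[fun x : ℝ => x ^ 2; gaussianReal 0 Q.toNNReal] / δ ^ 2 / k) +
    ENNReal.ofReal (Real.exp (-(L * (1 / 2 * Real.exp (-(k * (1 / 2 *
      Real.log ((P + β ^ 2 * Q) / P) +
      δ * (1 / (2 * P) + (1 + |β|) ^ 2 / (2 * (P + β ^ 2 * Q)))))))))) +
    (ENNReal.ofReal (Var[fun x : ℝ => x ^ 2; gaussianReal 0 N.toNNReal] / δ ^ 2 / k) +
      (ENNReal.ofReal ((P + δ) * N / δ ^ 2 / k) + ENNReal.ofReal ((Q + δ) * N / δ ^ 2 / k))) +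
    (J * L : ℕ) * ENNReal.ofReal (Real.exp (-(k * (1 / 2 * Real.log ((P + β ^ 2 * Q) /
      (P * N / (P + N))) - δ' * (1 / (2 * (P * N / (P + N))) + 1 / (2 * (P + β ^ 2 * Q))))))) := by
  have hσ : 0 < P + β ^ 2 * Q := by positivity
  have hτ : 0 < P * N / (P + N) := by positivity
  refine le_trans (measure_mono ?_) ((measure_union_le _ _).trans (add_le_add
    ((measure_union_le _ _).trans (add_le_add ((measure_union_le _ _).trans
      (add_le_add (dirtyLaw_state_le hk _ N hQ hδ) (dirtyLaw_cover_le hk N hP hQ hδ hk2 j)))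
      (dirtyLaw_noise_le (P := P) hk _ hN hδ (measurable_dirtyEncode P β δ j))))
    (measure_biUnion_finset_le (Finset.univ.filter fun i : Fin J × Fin L => i.1 ≠ j)
      fun i => {p | p.1 i ∈ acceptance k (P + β ^ 2 * Q) (P * N / (P + N)) δ'
        (α • (dirtyEncode P β δ p.1 j p.2.1 + γ • p.2.1 + p.2.2))})) |>.trans
    (add_le_add le_rfl ?_))
  · intro p hp
    by_contra hcon
    simp only [Set.mem_union, not_or, Set.mem_iUnion, not_exists, Finset.mem_filter,
      Finset.mem_univ, true_and, Set.mem_ofPred_eq, not_and, not_le] at hcon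
    obtain ⟨⟨⟨h1, h2⟩, h3⟩, h4⟩ := hcon
    have h2' : ∃ l, p.1 (j, l) ∈ coverSet k P β δ p.2.1 := by
      by_contra! hne
      exact h2 h1 hne
    obtain ⟨l, hl, hx⟩ := dirtyEncode_spec h2'
    have h3' := h3 ⟨by have := (abs_lt.1 h1).2; linarith, by
      have := (abs_lt.1 hl.1).2; rw [hx]; linarith⟩
    exact hp ⟨h1, h2', h3'.1, h3'.2.1, h3'.2.2, h4⟩
  · have hcard : (Finset.univ.filter (fun i : Fin J × Fin L => i.1 ≠ j)).card ≤ J * L :=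
      (Finset.card_filter_le _ _).trans (by simp)
    refine le_trans ?_ (mul_le_mul_left (Nat.cast_le.2 hcard) _)
    rw [← nsmul_eq_mul]
    exact Finset.sum_le_card_nsmul _ _ _ fun i hi =>
      dirtyLaw_accept_le Q N α γ hσ hτ (Finset.mem_filter.1 hi).2

/-- Some realization of a random codebook is at least as good as the average. -/
theorem exists_sum_measure_slice_le {α β ι : Type*} [MeasurableSpace α] [MeasurableSpace β]
    [Fintype ι] (μ : Measure α) [IsProbabilityMeasure μ] (ν : ι → Measure β) [∀ i, SFinite (ν i)]
    (B : ι → Set (α × β)) {η : ι → ℝ≥0∞} (h : ∀ i, μ.prod (ν i) (B i) ≤ η i) :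
    ∃ a, ∑ i, ν i {b | (a, b) ∈ B i} ≤ ∑ i, η i := by
  -- Measurable hulls spare any measurability assumption on the bad events.
  set A : ι → Set (α × β) := fun i => toMeasurable (μ.prod (ν i)) (B i)
  have hA : ∀ i, MeasurableSet (A i) := fun i => measurableSet_toMeasurable _ _
  have hm : ∀ i, Measurable fun a => ν i (Prod.mk a ⁻¹' A i) := fun i =>
    measurable_measure_prodMk_left (hA i)
  obtain ⟨a, ha⟩ := exists_le_lintegral (μ := μ) (f := fun a => ∑ i, ν i (Prod.mk a ⁻¹' A i))
    (Finset.measurable_fun_sum _ fun i _ => hm i).aemeasurable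
  refine ⟨a, (Finset.sum_le_sum fun i _ => measure_mono ?_).trans (ha.trans ?_)⟩
  · exact fun b hb => subset_toMeasurable _ _ hb
  · rw [lintegral_finsetSum _ fun i _ => hm i]
    refine Finset.sum_le_sum fun i _ => ?_
    rw [← Measure.prod_apply (hA i), measure_toMeasurable]
    exact h i

theorem eventually_le_ofReal {f : ℕ → ℝ≥0∞} (hf : Tendsto f atTop (𝓝 0)) {ε : ℝ} (hε : 0 < ε) :
    ∀ᶠ k in atTop, f k ≤ ENNReal.ofReal ε :=
  (hf.eventually (gt_mem_nhds (ENNReal.ofReal_pos.2 hε))).mono fun _ h => h.le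

/-- A dirty paper code of rate `R` succeeds on this event: the message is recovered and all
correlations are as for independent vectors. -/
def DirtySuccess {J k : ℕ} (P Q N γ δ : ℝ) (enc : Fin J → (Fin k → ℝ) → Fin k → ℝ)
    (dec : (Fin k → ℝ) → Fin J) (j : Fin J) (s z : Fin k → ℝ) : Prop :=
  dec (enc j s + γ • s + z) = j ∧ |enc j s ⬝ᵥ enc j s - k * P| < k * δ ∧
    |s ⬝ᵥ enc j s| < k * δ ∧ |s ⬝ᵥ s - k * Q| < k * δ ∧ |z ⬝ᵥ z - k * N| < k * δ ∧
    |enc j s ⬝ᵥ z| < k * δ ∧ |s ⬝ᵥ z| < k * δ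

/-- Costa's cancellation. With `α = P / (P + N)` and `β = α γ` the codeword `u = x + β s` satisfies
`u - α y = (1 - α) x - α z`: the state drops out, and the estimation error is that of a channel
without state. -/
theorem dirtySuccess_of_good {J L k : ℕ} {P Q N γ δ δ₀ : ℝ} (hP : 0 < P)
    (hN : 0 < N) (hδ₀ : 0 < δ) (hδ : δ ≤ δ₀) {U : Fin J × Fin L → Fin k → ℝ}
    {dec : (Fin k → ℝ) → Fin J}
    (hdec : ∀ y j, (∃ l, U (j, l) ∈ acceptance k (P + (P / (P + N) * γ) ^ 2 * Q)
        (P * N / (P + N)) (δ * (1 + |P / (P + N) * γ|) ^ 2) ((P / (P + N)) • y)) →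
      (∀ j', j' ≠ j → ¬ ∃ l, U (j', l) ∈ acceptance k (P + (P / (P + N) * γ) ^ 2 * Q)
        (P * N / (P + N)) (δ * (1 + |P / (P + N) * γ|) ^ 2) ((P / (P + N)) • y)) → dec y = j)
    {j : Fin J} {s z : Fin k → ℝ}
    (h : dirtyGood k P Q N (P / (P + N)) (P / (P + N) * γ) γ δ
      (δ * (1 + |P / (P + N) * γ|) ^ 2) j (U, s, z)) :
    DirtySuccess P Q N γ δ₀ (dirtyEncode P (P / (P + N) * γ) δ U) dec j s z := by
  obtain ⟨h1, h2, h3, h4, h5, h6⟩ := h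
  dsimp only at h1 h2 h3 h4 h5 h6
  obtain ⟨l, hl, hx⟩ := dirtyEncode_spec h2
  have hkδ : (k : ℝ) * δ ≤ k * δ₀ := mul_le_mul_of_nonneg_left hδ (Nat.cast_nonneg k)
  set α := P / (P + N) with hα
  set β := α * γ with hβ
  set x := dirtyEncode P β δ U j s with hxd
  have hU : U (j, l) = x + β • s := by rw [hx]; abel
  have hl1 := hl.1
  have hl2 := hl.2
  rw [← hx] at hl1 hl2
  have hα1 : α ≤ 1 := by rw [hα, div_le_one (by positivity)]; linarith
  refine ⟨hdec _ _ ⟨l, ?_⟩ ?_, hl1.trans_le hkδ, hl2.trans_le hkδ, h1.trans_le hkδ,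
    h3.trans_le hkδ, h4.trans_le hkδ, h5.trans_le hkδ⟩
  · rw [hU]
    refine ⟨?_, ?_⟩
    · have e : x + β • s - α • (x + γ • s + z) = (1 - α) • x - α • z := by
        rw [smul_add, smul_add, smul_smul, ← hβ, sub_smul, one_smul]; abel
      rw [e, ← mmse_identity hP hN, ← hα]
      refine (estimation_error_le (σ := P) (V := N) (δ := δ) (by positivity) hα1 ?_ ?_ h4.le).trans ?_
      · have := (abs_lt.1 hl1).2; linarith
      · have := (abs_lt.1 h3).2; linarith
      · refine mul_le_mul_of_nonneg_left (add_le_add_right ?_ _) (Nat.cast_nonneg k)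
        have : 1 ≤ (1 + |β|) ^ 2 := one_le_pow₀ (by linarith [abs_nonneg β])
        nlinarith
    · have := (abs_le.1 (norm_sq_add_smul_bounds (β := β) hl1 hl2 h1)).1
      linarith
  · rintro j' hj' ⟨l', hl'⟩
    exact h6 (j', l') hj' hl'

/-- Covering needs a bin rate above `½ log (σ / P)`; packing needs total rate below `½ log (σ / τ)`.
The difference of the two is `½ log (1 + P / N)`, so the state costs no rate. -/
theorem tendsto_dirty_bound {P Q N R : ℝ} (β : ℝ) (hP : 0 < P) (hQ : 0 ≤ Q) (hN : 0 < N)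
    (hR : R < 1 / 2 * Real.log (1 + P / N)) (hR0 : 0 ≤ R) {δ₀ : ℝ} (hδ₀ : 0 < δ₀) :
    ∃ δ : ℝ, 0 < δ ∧ δ ≤ δ₀ ∧ ∃ (L : ℕ → ℕ) (f : ℕ → ℝ≥0∞), Tendsto f atTop (𝓝 0) ∧
      ∀ k J : ℕ, (J : ℝ) ≤ Real.exp (k * R) + 1 →
      ENNReal.ofReal (Real.exp (-(L k * (1 / 2 * Real.exp (-(k * (1 / 2 *
        Real.log ((P + β ^ 2 * Q) / P) +
        δ * (1 / (2 * P) + (1 + |β|) ^ 2 / (2 * (P + β ^ 2 * Q)))))))))) ≤ f k ∧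
      (J * L k : ℕ) * ENNReal.ofReal (Real.exp (-(k * (1 / 2 * Real.log ((P + β ^ 2 * Q) /
        (P * N / (P + N))) - δ * (1 + |β|) ^ 2 *
        (1 / (2 * (P * N / (P + N))) + 1 / (2 * (P + β ^ 2 * Q))))))) ≤ f k := by
  set σ := P + β ^ 2 * Q with hσ
  have hσ0 : 0 < σ := by positivity
  set τ := P * N / (P + N) with hτ
  have hτ0 : 0 < τ := by positivity
  set κ₁ := 1 / (2 * P) + (1 + |β|) ^ 2 / (2 * σ) with hκ₁
  set κ₂ := (1 + |β|) ^ 2 * (1 / (2 * τ) + 1 / (2 * σ)) with hκ₂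
  have hκ₁0 : 0 < κ₁ := by positivity
  have hκ₂0 : 0 < κ₂ := by positivity
  -- Of the gap `4 η`, the bin rate `R'` takes `2 η`. Losses due to `δ` are at most `η` in covering
  -- and in packing, so a margin `η` is left in each.
  set η := (1 / 2 * Real.log (1 + P / N) - R) / 4 with hη
  have hη0 : 0 < η := by rw [hη]; linarith
  have hlog : 0 ≤ Real.log (σ / P) := Real.log_nonneg (by
    rw [le_div_iff₀ hP, one_mul, hσ]
    have : 0 ≤ β ^ 2 * Q := by positivity
    linarith)
  have hlogs : Real.log (σ / τ) = Real.log (σ / P) + Real.log (1 + P / N) := by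
    rw [← div_mmse hP hN, ← hτ, ← Real.log_mul (by positivity) (by positivity)]
    congr 1
    field_simp
  set R' := 1 / 2 * Real.log (σ / P) + 2 * η with hR'
  have hR'0 : 0 < R' := by positivity
  refine ⟨min δ₀ (η / (κ₁ + κ₂)), by positivity, min_le_left _ _, fun k => ⌈Real.exp (k * R')⌉₊,
    fun k => ENNReal.ofReal (Real.exp (-(k * (η / 2)))) +
      4 * ENNReal.ofReal (Real.exp (-(k * η))), ?_, ?_⟩
  · have h1 := tendsto_ofReal_exp_neg (half_pos hη0)
    have h2 := ENNReal.Tendsto.const_mul (a := 4) (tendsto_ofReal_exp_neg hη0) (Or.inr (by simp))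
    simpa using h1.add h2
  intro k J hJ
  set δ := min δ₀ (η / (κ₁ + κ₂)) with hδ
  have hδ0 : 0 < δ := by positivity
  have hδ1 : δ * (κ₁ + κ₂) ≤ η := by
    have := mul_le_mul_of_nonneg_right (min_le_right δ₀ (η / (κ₁ + κ₂)))
      (by positivity : 0 ≤ κ₁ + κ₂)
    rwa [div_mul_cancel₀ _ (by positivity)] at this
  have hδκ₁ : δ * κ₁ ≤ η := by nlinarith
  have hδκ₂ : δ * κ₂ ≤ η := by nlinarith
  constructor
  · refine le_trans (ENNReal.ofReal_le_ofReal (Real.exp_le_exp.2 (neg_le_neg ?_))) le_self_add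
    have h1 : Real.exp (k * η) ≤ ⌈Real.exp (k * R')⌉₊ *
        Real.exp (-(k * (1 / 2 * Real.log (σ / P) + δ * κ₁))) := by
      refine le_trans ?_ (mul_le_mul_of_nonneg_right (Nat.le_ceil _) (Real.exp_pos _).le)
      rw [← Real.exp_add]
      refine Real.exp_le_exp.2 ?_
      have : (k : ℝ) * (δ * κ₁) ≤ k * η := mul_le_mul_of_nonneg_left hδκ₁ (Nat.cast_nonneg k)
      rw [hR']
      linarith
    have h2 := Real.add_one_le_exp (k * η)
    linarith
  · refine le_trans ?_ le_add_self
    have hJ' : (J : ℝ) ≤ 2 * Real.exp (k * R) := by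
      have : 1 ≤ Real.exp (k * R) := Real.one_le_exp (by positivity)
      linarith
    have hL' : (⌈Real.exp (k * R')⌉₊ : ℝ) ≤ 2 * Real.exp (k * R') := by
      have h1 : 1 ≤ Real.exp (k * R') := Real.one_le_exp (by positivity)
      have h2 := Nat.ceil_lt_add_one (Real.exp_pos (k * R')).le
      linarith
    rw [← ENNReal.ofReal_natCast, ← ENNReal.ofReal_mul (by positivity),
      show (4 : ℝ≥0∞) = ENNReal.ofReal 4 by simp, ← ENNReal.ofReal_mul (by norm_num)]
    refine ENNReal.ofReal_le_ofReal ?_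
    push_cast
    have h3 := mul_le_mul hJ' hL' (by positivity) (by positivity)
    refine (mul_le_mul_of_nonneg_right h3 (Real.exp_pos _).le).trans ?_
    have e : 2 * Real.exp (k * R) * (2 * Real.exp (k * R')) *
        Real.exp (-(k * (1 / 2 * Real.log (σ / τ) - δ * (1 + |β|) ^ 2 *
          (1 / (2 * τ) + 1 / (2 * σ))))) =
        4 * Real.exp (k * R + k * R' + -(k * (1 / 2 * Real.log (σ / τ) - δ * κ₂))) := by
      rw [Real.exp_add, Real.exp_add, hκ₂, ← mul_assoc δ]; ring
    rw [e]
    refine mul_le_mul_of_nonneg_left (Real.exp_le_exp.2 ?_) (by norm_num)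
    have h4 : (k : ℝ) * (δ * κ₂) ≤ k * η := mul_le_mul_of_nonneg_left hδκ₂ (Nat.cast_nonneg k)
    have h5 : (k : ℝ) * (1 / 2 * Real.log (1 + P / N)) = k * (4 * η + R) := by rw [hη]; ring
    rw [hlogs, hR']
    linarith

/-- Costa's theorem, with control of the correlations of the code. -/
theorem exists_dirty_paper_code {P Q N R δ₀ ε : ℝ} (γ : ℝ) (hP : 0 < P) (hQ : 0 ≤ Q) (hN : 0 < N)
    (hR0 : 0 ≤ R) (hR : R < 1 / 2 * Real.log (1 + P / N)) (hδ₀ : 0 < δ₀) (hε : 0 < ε) :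
    ∀ᶠ k : ℕ in atTop, ∀ J : ℕ, 0 < J → (J : ℝ) ≤ Real.exp (k * R) + 1 →
      ∃ (enc : Fin J → (Fin k → ℝ) → Fin k → ℝ) (dec : (Fin k → ℝ) → Fin J),
        (∀ j, Measurable (enc j)) ∧ Measurable dec ∧
        ∑ j, (iidGaussian k Q).prod (iidGaussian k N)
          {p | ¬ DirtySuccess P Q N γ δ₀ enc dec j p.1 p.2} ≤ J * ENNReal.ofReal ε := by
  set α := P / (P + N) with hα
  set β := α * γ with hβ
  obtain ⟨δ, hδ, hδδ₀, L, f, hf, hbound⟩ := tendsto_dirty_bound β hP hQ hN hR hR0 hδ₀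
  have hlim : Tendsto (fun k : ℕ =>
      ENNReal.ofReal (Var[fun x : ℝ => x ^ 2; gaussianReal 0 Q.toNNReal] / δ ^ 2 / k) + f k +
      (ENNReal.ofReal (Var[fun x : ℝ => x ^ 2; gaussianReal 0 N.toNNReal] / δ ^ 2 / k) +
      (ENNReal.ofReal ((P + δ) * N / δ ^ 2 / k) + ENNReal.ofReal ((Q + δ) * N / δ ^ 2 / k))) +
      f k) atTop (𝓝 0) := by
    simpa using (((tendsto_ofReal_const_div _).add hf).add ((tendsto_ofReal_const_div _).add
      ((tendsto_ofReal_const_div _).add (tendsto_ofReal_const_div _)))).add hf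
  have hlim2 : Tendsto (fun k : ℕ =>
      ENNReal.ofReal (Var[fun x : ℝ => x ^ 2; gaussianReal 0 P.toNNReal] / δ ^ 2 / k) +
      ENNReal.ofReal ((Q + δ) * P / δ ^ 2 / k)) atTop (𝓝 0) := by
    simpa using (tendsto_ofReal_const_div _).add (tendsto_ofReal_const_div _)
  filter_upwards [eventually_le_ofReal hlim hε,
    eventually_le_ofReal hlim2 (show (0 : ℝ) < 1 / 2 by norm_num), eventually_gt_atTop 0] with
    k hk1 hk2 hk0 J hJ0 hJ
  have : Nonempty (Fin J) := ⟨⟨0, hJ0⟩⟩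
  obtain ⟨hb1, hb2⟩ := hbound k J hJ
  obtain ⟨U, hU⟩ := exists_sum_measure_slice_le
    (Measure.pi fun _ : Fin J × Fin (L k) => iidGaussian k (P + β ^ 2 * Q))
    (fun _ : Fin J => (iidGaussian k Q).prod (iidGaussian k N))
    (fun j => {p | ¬ dirtyGood k P Q N α β γ δ (δ * (1 + |β|) ^ 2) j p})
    (fun j => (dirtyLaw_not_good_le hk0 α γ (δ * (1 + |β|) ^ 2) hP hQ hN hδ hk2 j).trans
      ((add_le_add (add_le_add (add_le_add le_rfl hb1) le_rfl) hb2).trans hk1))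
  obtain ⟨dec, hdec, hdec'⟩ := exists_measurable_decoder
    (fun j : Fin J => {y : Fin k → ℝ | ∃ l, U (j, l) ∈ acceptance k (P + β ^ 2 * Q)
      (P * N / (P + N)) (δ * (1 + |β|) ^ 2) (α • y)}) (fun j => by
      rw [Set.ofPred_exists]
      exact MeasurableSet.iUnion fun l =>
        measurableSet_setOf_mem_acceptance _ _ _ measurable_const (by fun_prop))
  refine ⟨dirtyEncode P β δ U, dec, fun j => ?_, hdec, ?_⟩
  · exact (measurable_dirtyEncode (L := L k) (k := k) P β δ j).comp
      (f := fun s : Fin k → ℝ => (U, s)) measurable_prodMk_left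
  · rw [Finset.sum_const, Finset.card_univ, Fintype.card_fin, nsmul_eq_mul] at hU
    refine (Finset.sum_le_sum fun j _ => measure_mono ?_).trans hU
    exact fun p (hp : ¬ _) hg => hp (dirtySuccess_of_good hP hN hδ hδδ₀ hdec' hg)

/-! ### Codes for one block -/

/-- The codewords are drawn with power `σ` slightly below `P`, so that typical ones obey the
constraint and `clip` leaves them unchanged; continuity keeps the rates. -/
theorem exists_packing_parameters {P V₁ V₂ R R' : ℝ} (hP : 0 < P)
    (h₁ : R < 1 / 2 * Real.log (1 + P / V₁)) (h₂ : R' < 1 / 2 * Real.log (1 + P / V₂))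
    (hV₁ : 0 < V₁) (hV₂ : 0 < V₂) :
    ∃ σ δ : ℝ, 0 < σ ∧ 0 < δ ∧ σ + δ ≤ P ∧ R < packingExponent σ V₁ δ ∧
      R' < packingExponent σ V₂ δ := by
  have hc : ∀ V : ℝ, 0 < V → ContinuousAt (fun σ => 1 / 2 * Real.log (1 + σ / V)) P := by
    intro V hV
    refine ContinuousAt.mul continuousAt_const (ContinuousAt.log (by fun_prop) ?_)
    positivity
  have e1 : ∀ᶠ σ in 𝓝[<] P, R < 1 / 2 * Real.log (1 + σ / V₁) :=
    ((hc V₁ hV₁).eventually (lt_mem_nhds h₁)).filter_mono nhdsWithin_le_nhds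
  have e2 : ∀ᶠ σ in 𝓝[<] P, R' < 1 / 2 * Real.log (1 + σ / V₂) :=
    ((hc V₂ hV₂).eventually (lt_mem_nhds h₂)).filter_mono nhdsWithin_le_nhds
  have e3 : ∀ᶠ σ in 𝓝[<] P, 0 < σ := (lt_mem_nhds hP).filter_mono nhdsWithin_le_nhds
  obtain ⟨σ, h1, h2, h3, h4⟩ := (e1.and (e2.and (e3.and self_mem_nhdsWithin))).exists
  have h4' : σ < P := h4
  have hd : ∀ V : ℝ, ContinuousAt (fun δ => packingExponent σ V δ) 0 := fun V => by
    unfold packingExponent; fun_prop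
  have f1 : ∀ᶠ δ in 𝓝[>] (0 : ℝ), R < packingExponent σ V₁ δ :=
    ((hd V₁).eventually (lt_mem_nhds (by simpa [packingExponent] using h1))).filter_mono
      nhdsWithin_le_nhds
  have f2 : ∀ᶠ δ in 𝓝[>] (0 : ℝ), R' < packingExponent σ V₂ δ :=
    ((hd V₂).eventually (lt_mem_nhds (by simpa [packingExponent] using h2))).filter_mono
      nhdsWithin_le_nhds
  have f3 : ∀ᶠ δ in 𝓝[>] (0 : ℝ), δ < P - σ :=
    (gt_mem_nhds (sub_pos.2 h4')).filter_mono nhdsWithin_le_nhds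
  obtain ⟨δ, g1, g2, g3, g4⟩ := (f1.and (f2.and (f3.and self_mem_nhdsWithin))).exists
  exact ⟨σ, δ, h3, g4, by linarith, g1, g2⟩

theorem tendsto_card_mul_exp {c r : ℝ} (C : ℝ) (hcr : r < c) :
    Tendsto (fun k : ℕ => ENNReal.ofReal (C * Real.exp (k * r)) *
      ENNReal.ofReal (Real.exp (-(k * c)))) atTop (𝓝 0) := by
  have h := ENNReal.Tendsto.const_mul (a := ENNReal.ofReal C)
    (tendsto_ofReal_exp_neg (sub_pos.2 hcr)) (Or.inr (by simp))
  rw [mul_zero] at h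
  refine h.congr fun k => ?_
  rw [← ENNReal.ofReal_mul' (Real.exp_pos _).le, ← ENNReal.ofReal_mul' (Real.exp_pos _).le,
    mul_assoc, ← Real.exp_add]
  congr 3
  ring

/-- Replace a vector by zero if it violates the power constraint. -/
def clip {k : ℕ} (P : ℝ) (x : Fin k → ℝ) : Fin k → ℝ :=
  if x ⬝ᵥ x ≤ k * P then x else 0

theorem clip_dotProduct_self_le {k : ℕ} {P : ℝ} (hP : 0 ≤ P) (x : Fin k → ℝ) :
    clip P x ⬝ᵥ clip P x ≤ k * P := by
  unfold clip
  split_ifs with h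
  · exact h
  · rw [dotProduct_zero]; positivity

theorem clip_eq_self {k : ℕ} {P : ℝ} {x : Fin k → ℝ} (h : x ⬝ᵥ x ≤ k * P) : clip P x = x :=
  if_pos h

theorem measurable_clip {k : ℕ} (P : ℝ) : Measurable (clip P : (Fin k → ℝ) → Fin k → ℝ) :=
  Measurable.ite (measurableSet_le measurable_dotProduct_self measurable_const) measurable_id
    measurable_const

theorem DirtySuccess.relay_power {J k : ℕ} {P Q N γ δ P₂ a : ℝ}
    {enc : Fin J → (Fin k → ℝ) → Fin k → ℝ} {dec : (Fin k → ℝ) → Fin J} {j : Fin J}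
    {s z : Fin k → ℝ} (h : DirtySuccess P Q N γ δ enc dec j s z)
    (hδ : P + a ^ 2 * Q + δ * (1 + |a|) ^ 2 ≤ P₂) :
    (enc j s + a • s) ⬝ᵥ (enc j s + a • s) ≤ k * P₂ := by
  have h1 := (abs_le.1 (norm_sq_add_smul_bounds (β := a) h.2.1 h.2.2.1 h.2.2.2.1)).2
  have h2 := mul_le_mul_of_nonneg_left hδ (Nat.cast_nonneg (α := ℝ) k)
  linarith

/-- Bounds the power of everything except the source input at the destination, which is treated as
noise when the source codeword is decoded. -/
theorem DirtySuccess.noise_power {J k : ℕ} {P Q N γ δ V : ℝ}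
    {enc : Fin J → (Fin k → ℝ) → Fin k → ℝ} {dec : (Fin k → ℝ) → Fin J} {j : Fin J}
    {s z : Fin k → ℝ} (h : DirtySuccess P Q N γ δ enc dec j s z)
    (hδ : P + γ ^ 2 * Q + N + 4 * δ * (1 + |γ|) ^ 2 ≤ V) :
    (enc j s + γ • s + z) ⬝ᵥ (enc j s + γ • s + z) ≤ k * V := by
  have h1 := (abs_le.1 (norm_sq_add_smul_bounds (β := γ) h.2.1 h.2.2.1 h.2.2.2.1)).2
  have h2 := mul_le_mul_of_nonneg_left hδ (Nat.cast_nonneg (α := ℝ) k)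
  obtain ⟨-, -, -, -, hz, hxz, hsz⟩ := h
  have h3 := (abs_lt.1 hz).2
  have h4 := (abs_lt.1 hxz).2
  have h5 : γ * (s ⬝ᵥ z) ≤ |γ| * (k * δ) := by
    refine (le_abs_self _).trans ?_
    rw [abs_mul]
    exact mul_le_mul_of_nonneg_left hsz.le (abs_nonneg γ)
  have hkδ : 0 ≤ k * δ := (abs_nonneg _).trans hsz.le
  rw [dotProduct_self_add, add_dotProduct (enc j s) (γ • s) z, smul_dotProduct, smul_eq_mul]
  have h6 : 0 ≤ (k * δ) * (4 * |γ| + 3 * |γ| ^ 2) := by positivity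
  nlinarith

theorem eventually_source_bound {σ V δ r : ℝ} (C : ℝ) (hr : r < packingExponent σ V δ)
    {ε : ℝ} (hε : 0 < ε) :
    ∀ᶠ k : ℕ in atTop, ∀ c : ℕ, (c : ℝ) ≤ C * Real.exp (k * r) →
      ENNReal.ofReal (Var[fun x : ℝ => x ^ 2; gaussianReal 0 σ.toNNReal] / δ ^ 2 / k) +
      ENNReal.ofReal ((V + δ) * σ / δ ^ 2 / k) +
      c * ENNReal.ofReal (Real.exp (-(k * packingExponent σ V δ))) ≤ ENNReal.ofReal ε := by
  have hlim : Tendsto (fun k : ℕ =>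
      ENNReal.ofReal (Var[fun x : ℝ => x ^ 2; gaussianReal 0 σ.toNNReal] / δ ^ 2 / k) +
      ENNReal.ofReal ((V + δ) * σ / δ ^ 2 / k) + ENNReal.ofReal (C * Real.exp (k * r)) *
      ENNReal.ofReal (Real.exp (-(k * packingExponent σ V δ)))) atTop (𝓝 0) := by
    simpa using ((tendsto_ofReal_const_div _).add (tendsto_ofReal_const_div _)).add
      (tendsto_card_mul_exp C hr)
  filter_upwards [eventually_le_ofReal hlim hε] with k hk c hT
  refine le_trans (add_le_add le_rfl (mul_le_mul_left ?_ _)) hk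
  rw [← ENNReal.ofReal_natCast]
  exact ENNReal.ofReal_le_ofReal hT

theorem decode_eq_of_notMem_sourceBad {W : Type*} {k : ℕ} {σ V δ P : ℝ} (hσδ : σ + δ ≤ P)
    {T : Finset W} {w : W} {X : W → Fin k → ℝ} {v : Fin k → ℝ}
    (h : (X, v) ∉ sourceBad k σ V δ T w) :
    clip P (X w) = X w ∧ passes k σ V δ (X w) (X w + v) ∧
      ∀ w' ∈ T, ¬ passes k σ V δ (X w') (X w + v) := by
  obtain ⟨h1, h2, h3⟩ := not_not.1 h
  exact ⟨clip_eq_self (h1.trans (mul_le_mul_of_nonneg_left hσδ (Nat.cast_nonneg k))), h2, h3⟩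

/-- Single-user coding over a Gaussian channel. -/
theorem exists_awgn_code {P N R ε : ℝ} (hP : 0 < P) (hN : 0 < N) (hR0 : 0 ≤ R)
    (hR : R < 1 / 2 * Real.log (1 + P / N)) (hε : 0 < ε) :
    ∀ᶠ k : ℕ in atTop, ∃ (M : ℕ) (x : Fin M → Fin k → ℝ) (d : (Fin k → ℝ) → Fin M),
      Real.exp (k * R) ≤ M ∧ Measurable d ∧ (∀ m, x m ⬝ᵥ x m ≤ k * P) ∧
      ∑ m, iidGaussian k N {z | d (x m + z) ≠ m} ≤ M * ENNReal.ofReal ε := by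
  obtain ⟨σ, δ, hσ, hδ, hσδ, hr, -⟩ := exists_packing_parameters hP hR hR hN hN
  have hlim := tendsto_ofReal_const_div
    (Var[fun x : ℝ => x ^ 2; gaussianReal 0 N.toNNReal] / δ ^ 2)
  filter_upwards [eventually_source_bound 2 hr (half_pos hε), eventually_le_ofReal hlim (half_pos hε), eventually_gt_atTop 0] with
    k hk1 hk2 hk0
  set M := ⌈Real.exp (k * R)⌉₊ with hM
  have hM0 : 0 < M := Nat.ceil_pos.2 (Real.exp_pos _)
  have hM2 : (M : ℝ) ≤ 2 * Real.exp (k * R) := by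
    have h1 : 1 ≤ Real.exp (k * R) := Real.one_le_exp (by positivity)
    have h2 := Nat.ceil_lt_add_one (Real.exp_pos (k * R)).le
    linarith
  have : Nonempty (Fin M) := ⟨⟨0, hM0⟩⟩
  have : SFinite (iidGaussian k N) := inferInstance
  have hnu : iidGaussian k N {v | ¬ v ⬝ᵥ v ≤ k * (N + δ)} ≤ ENNReal.ofReal (ε / 2) := by
    refine le_trans (measure_mono fun v (hv : ¬ _) => ?_)
      ((norm_sq_concentration k hN.le hδ hk0).trans hk2)
    have h1 : k * δ ≤ v ⬝ᵥ v - k * N := by linarith [not_le.1 hv]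
    exact h1.trans (le_abs_self _)
  obtain ⟨X, hX⟩ := exists_sum_measure_slice_le (Measure.pi fun _ : Fin M => iidGaussian k σ)
    (fun _ : Fin M => iidGaussian k N)
    (fun m => sourceBad k σ N δ (Finset.univ.erase m) m) (η := fun _ => ENNReal.ofReal ε)
    (fun m => (prod_sourceBad_le hk0 hσ hN hδ (Finset.notMem_erase m _) _).trans (by
      rw [← add_halves ε, ENNReal.ofReal_add (half_pos hε).le (half_pos hε).le]
      refine add_le_add hnu (hk1 _ (le_trans (Nat.cast_le.2 ?_) hM2))
      exact (Finset.card_le_univ _).trans (by simp)))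
  obtain ⟨d, hd, hd'⟩ := exists_measurable_decoder
    (fun m : Fin M => {y : Fin k → ℝ | passes k σ N δ (X m) y})
    (fun m => measurableSet_passes _ _ _ measurable_const measurable_id)
  refine ⟨M, fun m => clip P (X m), d, Nat.le_ceil _, hd,
    fun m => clip_dotProduct_self_le hP.le _, ?_⟩
  rw [Finset.sum_const, Finset.card_univ, Fintype.card_fin, nsmul_eq_mul] at hX
  refine (Finset.sum_le_sum fun m _ => measure_mono fun z (hz : _ ≠ _) => ?_).trans hX
  by_contra hcon
  obtain ⟨h1, h2, h3⟩ := decode_eq_of_notMem_sourceBad hσδ hcon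
  refine hz ?_
  dsimp only
  rw [h1]
  exact hd' _ _ h2 fun m' hm' => h3 m' (Finset.mem_erase.2 ⟨hm', Finset.mem_univ _⟩)

/-- A code for one block of length `k`.  The messages are pairs of a bin index and an index in the
bin; the relay conveys the bin index of the previous message. -/
structure BlockCode (k J K : ℕ) (P₁ P₂ : ℝ) where
  source : Fin J × Fin K → Fin k → ℝ
  relay : Fin J → (Fin k → ℝ) → Fin k → ℝ
  relayDecode : (Fin k → ℝ) → Fin J × Fin K
  destDecode : Fin J → (Fin k → ℝ) → Fin J × Fin K
  binDecode : (Fin k → ℝ) → Fin J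
  measurable_relay : ∀ j, Measurable (relay j)
  measurable_relayDecode : Measurable relayDecode
  measurable_destDecode : ∀ j, Measurable (destDecode j)
  measurable_binDecode : Measurable binDecode
  source_power : ∀ w, source w ⬝ᵥ source w ≤ k * P₁
  relay_power : ∀ j s, relay j s ⬝ᵥ relay j s ≤ k * P₂

namespace BlockCode

variable {k J K : ℕ} {P₁ P₂ : ℝ}

/-- Probability that the relay decodes the message `w` wrongly. -/
def relayError (c : BlockCode k J K P₁ P₂) (N₂ : ℝ) (w : Fin J × Fin K) : ℝ≥0∞ :=
  iidGaussian k N₂ {z | c.relayDecode (c.source w + z) ≠ w}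

/-- Probability that the destination, knowing the bin of `w`, decodes `w` wrongly while the relay
transmits `j`. -/
def destError (c : BlockCode k J K P₁ P₂) (Q N₃ : ℝ) (w : Fin J × Fin K) (j : Fin J) : ℝ≥0∞ :=
  (iidGaussian k Q).prod (iidGaussian k N₃)
    {p | c.destDecode w.1 (c.source w + (c.relay j p.1 + p.1 + p.2)) ≠ w}

/-- Probability that the destination, after removal of the source input, decodes `j` wrongly. -/
def binError (c : BlockCode k J K P₁ P₂) (Q N₃ : ℝ) (j : Fin J) : ℝ≥0∞ :=
  (iidGaussian k Q).prod (iidGaussian k N₃) {p | c.binDecode (c.relay j p.1 + p.1 + p.2) ≠ j}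

end BlockCode

theorem relay_add_state_of_success {J k : ℕ} {P Q N δ P₂ a : ℝ}
    {enc : Fin J → (Fin k → ℝ) → Fin k → ℝ} {dec : (Fin k → ℝ) → Fin J} {j : Fin J}
    {s z : Fin k → ℝ} (h : DirtySuccess P Q N (1 + a) δ enc dec j s z)
    (hδ : P + a ^ 2 * Q + δ * (1 + |a|) ^ 2 ≤ P₂) :
    clip P₂ (enc j s + a • s) + s + z = enc j s + (1 + a) • s + z := by
  rw [clip_eq_self (h.relay_power hδ), add_smul, one_smul]
  abel

theorem exists_small_pos {A B C D : ℝ} (hA : 0 < A) (hB : 0 < B) (hC : 0 < C) (hD : 0 < D) :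
    ∃ x : ℝ, 0 < x ∧ x * A ≤ C ∧ x * B ≤ D := by
  refine ⟨min (C / A) (D / B), by positivity, ?_, ?_⟩
  · exact (mul_le_mul_of_nonneg_right (min_le_left _ _) hA.le).trans_eq (div_mul_cancel₀ _ hA.ne')
  · exact (mul_le_mul_of_nonneg_right (min_le_right _ _) hB.le).trans_eq (div_mul_cancel₀ _ hB.ne')

theorem ceil_exp_le {x : ℝ} (hx : 0 ≤ x) : (⌈Real.exp x⌉₊ : ℝ) ≤ 2 * Real.exp x := by
  have h1 : 1 ≤ Real.exp x := Real.one_le_exp hx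
  have h2 := Nat.ceil_lt_add_one (Real.exp_pos x).le
  linarith

theorem card_bin_le {J K : ℕ} (w : Fin J × Fin K) :
    (Finset.univ.filter fun w' : Fin J × Fin K => w'.1 = w.1 ∧ w' ≠ w).card ≤ K := by
  refine (Finset.card_le_card_of_injOn (t := (Finset.univ : Finset (Fin K))) Prod.snd
    (fun _ _ => Finset.mem_coe.2 (Finset.mem_univ _)) ?_).trans (by simp)
  intro u hu v hv huv
  simp only [Finset.coe_filter, Finset.mem_univ, true_and, Set.mem_ofPred_eq] at hu hv
  exact Prod.ext (hu.1.trans hv.1.symm) huv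

theorem exists_sum_measure_slice_add_le {α β ι : Type*} [MeasurableSpace α] [MeasurableSpace β]
    [Fintype ι] (μ : Measure α) [IsProbabilityMeasure μ] (ν ν' : ι → Measure β)
    [∀ i, SFinite (ν i)] [∀ i, SFinite (ν' i)]
    (B B' : ι → Set (α × β)) {η η' : ι → ℝ≥0∞} (h : ∀ i, μ.prod (ν i) (B i) ≤ η i)
    (h' : ∀ i, μ.prod (ν' i) (B' i) ≤ η' i) :
    ∃ a, ∑ i, ν i {b | (a, b) ∈ B i} + ∑ i, ν' i {b | (a, b) ∈ B' i} ≤ ∑ i, η i + ∑ i, η' i := by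
  have : ∀ i, SFinite (Sum.elim ν ν' i) := by
    rintro (i | i)
    · exact inferInstanceAs (SFinite (ν i))
    · exact inferInstanceAs (SFinite (ν' i))
  obtain ⟨a, ha⟩ := exists_sum_measure_slice_le μ (Sum.elim ν ν') (Sum.elim B B')
    (η := Sum.elim η η') (by rintro (i | i); exacts [h i, h' i])
  rw [Fintype.sum_sum_type, Fintype.sum_sum_type] at ha
  exact ⟨a, ha⟩

/-- A source codebook that can be decoded over the Gaussian channel to the relay and, given the bin
index, in the presence of any family of noises of power `V`. -/
theorem exists_source_codebook {P₁ N₂ V σ δ R₁ R₁₂ ε : ℝ} (hP₁ : 0 < P₁) (hN₂ : 0 < N₂)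
    (hV : 0 < V) (hσ : 0 < σ) (hδ : 0 < δ) (hσδ : σ + δ ≤ P₁)
    (hr₁ : R₁ < packingExponent σ V δ) (hr₂ : R₁₂ < packingExponent σ N₂ δ) (hε : 0 < ε) :
    ∀ᶠ k : ℕ in atTop, ∀ J K : ℕ, 0 < J → 0 < K → (K : ℝ) ≤ 2 * Real.exp (k * R₁) →
      ((J * K : ℕ) : ℝ) ≤ 4 * Real.exp (k * R₁₂) →
      ∀ ν : Fin J → Measure (Fin k → ℝ), (∀ j, IsProbabilityMeasure (ν j)) →
      ∑ j, ν j {v | ¬ v ⬝ᵥ v ≤ k * (V + δ)} ≤ J * ENNReal.ofReal (ε / 4) →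
      ∃ (x : Fin J × Fin K → Fin k → ℝ) (d : (Fin k → ℝ) → Fin J × Fin K)
        (d' : Fin J → (Fin k → ℝ) → Fin J × Fin K), Measurable d ∧ (∀ j, Measurable (d' j)) ∧
        (∀ w, x w ⬝ᵥ x w ≤ k * P₁) ∧
        ∑ w, iidGaussian k N₂ {z | d (x w + z) ≠ w} ≤ (J * K : ℕ) * ENNReal.ofReal ε ∧
        ∑ w : Fin J × Fin K, ∑ j, ν j {v | d' w.1 (x w + v) ≠ w} ≤
          (J * K * J : ℕ) * ENNReal.ofReal ε := by
  have hε4 : 0 < ε / 4 := by positivity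
  filter_upwards [eventually_source_bound 2 hr₁ hε4, eventually_source_bound 4 hr₂ hε4,
    eventually_le_ofReal (tendsto_ofReal_const_div
      (Var[fun x : ℝ => x ^ 2; gaussianReal 0 N₂.toNNReal] / δ ^ 2)) hε4,
    eventually_gt_atTop 0] with k hb₁ hb₂ hN hk0 J K hJ0 hK0 hK2 hJK4 ν hνp hν
  have : Nonempty (Fin J × Fin K) := ⟨(⟨0, hJ0⟩, ⟨0, hK0⟩)⟩
  have : SFinite (iidGaussian k N₂) := inferInstance
  have hνN : iidGaussian k N₂ {v | ¬ v ⬝ᵥ v ≤ k * (N₂ + δ)} ≤ ENNReal.ofReal (ε / 4) := by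
    refine le_trans (measure_mono fun v (hv : ¬ _) => ?_)
      ((norm_sq_concentration k hN₂.le hδ hk0).trans hN)
    have h1 : k * δ ≤ v ⬝ᵥ v - k * N₂ := by linarith [not_le.1 hv]
    exact h1.trans (le_abs_self _)
  have hcard : ∀ w : Fin J × Fin K, (Finset.univ.erase w).card ≤ J * K := fun w =>
    (Finset.card_le_univ _).trans (by simp)
  obtain ⟨X, hX⟩ := exists_sum_measure_slice_add_le
    (Measure.pi fun _ : Fin J × Fin K => iidGaussian k σ)
    -- Both families of events are indexed by a message and an interfering bin index, so that a
    -- single averaging selects the codebook. The relay events ignore the second index.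
    (ι := (Fin J × Fin K) × Fin J) (fun _ => iidGaussian k N₂) (fun i => ν i.2)
    (fun i => sourceBad k σ N₂ δ (Finset.univ.erase i.1) i.1)
    (fun i => sourceBad k σ V δ
      (Finset.univ.filter fun w' : Fin J × Fin K => w'.1 = i.1.1 ∧ w' ≠ i.1) i.1)
    (η := fun _ => ENNReal.ofReal (ε / 4) + ENNReal.ofReal (ε / 4))
    (η' := fun i => ν i.2 {v | ¬ v ⬝ᵥ v ≤ k * (V + δ)} + ENNReal.ofReal (ε / 4))
    (fun i => (prod_sourceBad_le hk0 hσ hN₂ hδ (Finset.notMem_erase i.1 _) _).trans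
        (add_le_add hνN (hb₂ _ (le_trans (Nat.cast_le.2 (hcard i.1)) hJK4))))
    (fun i => (prod_sourceBad_le hk0 hσ hV hδ
      (fun h => (Finset.mem_filter.1 h).2.2 rfl) (ν i.2)).trans
        (add_le_add le_rfl (hb₁ _ (le_trans (Nat.cast_le.2 (card_bin_le i.1)) hK2))))
  have htot : ∑ i : (Fin J × Fin K) × Fin J,
      (ENNReal.ofReal (ε / 4) + ENNReal.ofReal (ε / 4)) +
      ∑ i : (Fin J × Fin K) × Fin J,
        (ν i.2 {v | ¬ v ⬝ᵥ v ≤ k * (V + δ)} + ENNReal.ofReal (ε / 4)) ≤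
      (J * K * J : ℕ) * ENNReal.ofReal ε := by
    rw [Finset.sum_add_distrib (s := Finset.univ (α := (Fin J × Fin K) × Fin J))
      (f := fun i => ν i.2 _), Fintype.sum_prod_type (f := fun i => ν i.2 _)]
    have h1 : ∑ w : Fin J × Fin K, ∑ j, ν j {v | ¬ v ⬝ᵥ v ≤ k * (V + δ)} ≤
        (J * K * J : ℕ) * ENNReal.ofReal (ε / 4) := by
      refine (Finset.sum_le_card_nsmul _ _ _ fun w _ => hν).trans_eq ?_
      simp [mul_assoc]
    refine (add_le_add le_rfl (add_le_add h1 le_rfl)).trans_eq ?_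
    have h2 : ENNReal.ofReal ε = ENNReal.ofReal (ε / 4) + ENNReal.ofReal (ε / 4) +
        (ENNReal.ofReal (ε / 4) + ENNReal.ofReal (ε / 4)) := by
      rw [← ENNReal.ofReal_add hε4.le hε4.le, ← ENNReal.ofReal_add (by positivity) (by positivity)]
      congr 1; ring
    rw [h2]
    simp only [Finset.sum_const, Finset.card_univ, Fintype.card_prod, Fintype.card_fin,
      nsmul_eq_mul]
    ring
  replace hX := hX.trans htot
  obtain ⟨d, hd, hd'⟩ := exists_measurable_decoder
    (fun w : Fin J × Fin K => {y : Fin k → ℝ | passes k σ N₂ δ (X w) y})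
    (fun w => measurableSet_passes _ _ _ measurable_const measurable_id)
  choose b hb hb' using fun j : Fin J => exists_measurable_decoder
    -- Knowing the bin, the destination tests only its codewords, so at most `K` competitors count.
    (fun w : Fin J × Fin K => {y : Fin k → ℝ | w.1 = j ∧ passes k σ V δ (X w) y})
    (fun w => by
      by_cases hw : w.1 = j
      · simp only [hw, true_and]
        exact measurableSet_passes _ _ _ measurable_const measurable_id
      · simp [hw])
  refine ⟨fun w => clip P₁ (X w), d, b, hd, hb, fun w => clip_dotProduct_self_le hP₁.le _, ?_, ?_⟩
  · have h1 : ∑ i : (Fin J × Fin K) × Fin J, iidGaussian k N₂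
        {z | d (clip P₁ (X i.1) + z) ≠ i.1} ≤ (J * K * J : ℕ) * ENNReal.ofReal ε := by
      refine (Finset.sum_le_sum fun i _ => measure_mono fun z (hz : _ ≠ _) => ?_).trans
        (le_self_add.trans hX)
      by_contra hcon
      obtain ⟨h1, h2, h3⟩ := decode_eq_of_notMem_sourceBad hσδ hcon
      refine hz ?_
      rw [h1]
      exact hd' _ _ h2 fun w' hw' => h3 w' (Finset.mem_erase.2 ⟨hw', Finset.mem_univ _⟩)
    rw [Fintype.sum_prod_type] at h1
    simp only [Finset.sum_const, Finset.card_univ, Fintype.card_fin, nsmul_eq_mul] at h1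
    rw [← Finset.mul_sum, mul_comm (J * K) J, Nat.cast_mul, mul_assoc] at h1
    -- The relay sum was counted once for each interfering index; the factor `J` is divided out.
    exact (ENNReal.mul_le_mul_iff_right (by simpa using hJ0.ne') (by simp)).1 h1
  · rw [← Fintype.sum_prod_type' (f := fun w j => ν j {v | b w.1 (clip P₁ (X w) + v) ≠ w})]
    refine (Finset.sum_le_sum fun i _ => measure_mono fun z (hz : _ ≠ _) => ?_).trans
        (le_add_self.trans hX)
    by_contra hcon
    obtain ⟨h1, h2, h3⟩ := decode_eq_of_notMem_sourceBad hσδ hcon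
    refine hz ?_
    rw [h1]
    exact hb' _ _ _ ⟨rfl, h2⟩ fun w' hw' h => h3 w'
      (Finset.mem_filter.2 ⟨Finset.mem_univ _, h.1, hw'⟩) h.2

/-- The dirty paper code is fixed first, with `γ = 1 + a` because the channel adds `s` to the
relay's own `a s`. Its output law then plays the role of the noise family `ν j` in
`exists_source_codebook`; the failure probability of the dirty paper code controls how often that
noise is too strong. -/
theorem exists_block_code {P₁ P₂ Q N₂ N₃ P a R₁ R₂ ε : ℝ} (hP₁ : 0 < P₁) (hP : 0 < P) (hQ : 0 ≤ Q)
    (hN₂ : 0 < N₂) (hN₃ : 0 < N₃) (hpow : P + a ^ 2 * Q < P₂) (hR₁0 : 0 ≤ R₁) (hR₂0 : 0 ≤ R₂)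
    (hR₁ : R₁ < 1 / 2 * Real.log (1 + P₁ / (P + (1 + a) ^ 2 * Q + N₃)))
    (hR₂ : R₂ < 1 / 2 * Real.log (1 + P / N₃))
    (hR₁₂ : R₁ + R₂ < 1 / 2 * Real.log (1 + P₁ / N₂)) (hε : 0 < ε) :
    ∀ᶠ k : ℕ in atTop, ∃ (J K : ℕ) (c : BlockCode k J K P₁ P₂),
      Real.exp (k * (R₁ + R₂)) ≤ J * K ∧
      ∑ w, c.relayError N₂ w ≤ (J * K : ℕ) * ENNReal.ofReal ε ∧
      ∑ w, ∑ j, c.destError Q N₃ w j ≤ (J * K * J : ℕ) * ENNReal.ofReal ε ∧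
      ∑ j, c.binError Q N₃ j ≤ J * ENNReal.ofReal ε := by
  have hV0 : 0 < P + (1 + a) ^ 2 * Q + N₃ := by positivity
  have hP₂ : 0 < P₂ := lt_of_le_of_lt (by positivity) hpow
  obtain ⟨σ, δ, hσ, hδ, hσδ, hr₁, hr₂⟩ := exists_packing_parameters hP₁ hR₁ hR₁₂ hV0 hN₂
  obtain ⟨δ₀, hδ₀, hδP, hδV⟩ := exists_small_pos (A := (1 + |a|) ^ 2)
    (B := 4 * (1 + |1 + a|) ^ 2) (by positivity) (by positivity) (sub_pos.2 hpow) hδ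
  have hδP' : P + a ^ 2 * Q + δ₀ * (1 + |a|) ^ 2 ≤ P₂ := by linarith
  have hδV' : P + (1 + a) ^ 2 * Q + N₃ + 4 * δ₀ * (1 + |1 + a|) ^ 2 ≤
      P + (1 + a) ^ 2 * Q + N₃ + δ := by linarith
  have hε4 : 0 < ε / 4 := by positivity
  filter_upwards [exists_dirty_paper_code (1 + a) hP hQ hN₃ hR₂0 hR₂ hδ₀ hε4,
    exists_source_codebook hP₁ hN₂ hV0 hσ hδ hσδ hr₁ hr₂ hε] with k hdirty hsource
  obtain ⟨J, hJ⟩ : ∃ J, J = ⌈Real.exp (k * R₂)⌉₊ := ⟨_, rfl⟩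
  obtain ⟨K, hK⟩ : ∃ K, K = ⌈Real.exp (k * R₁)⌉₊ := ⟨_, rfl⟩
  have hJ0 : 0 < J := hJ ▸ Nat.ceil_pos.2 (Real.exp_pos _)
  have hK0 : 0 < K := hK ▸ Nat.ceil_pos.2 (Real.exp_pos _)
  have hJ2 : (J : ℝ) ≤ 2 * Real.exp (k * R₂) := hJ ▸ ceil_exp_le (by positivity)
  have hK2 : (K : ℝ) ≤ 2 * Real.exp (k * R₁) := hK ▸ ceil_exp_le (by positivity)
  have hJK : Real.exp (k * (R₁ + R₂)) ≤ J * K := by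
    rw [mul_add, Real.exp_add, mul_comm (J : ℝ)]
    exact mul_le_mul (hK ▸ Nat.le_ceil _) (hJ ▸ Nat.le_ceil _) (Real.exp_pos _).le (by positivity)
  have hJK4 : ((J * K : ℕ) : ℝ) ≤ 4 * Real.exp (k * (R₁ + R₂)) := by
    push_cast
    refine (mul_le_mul hJ2 hK2 (by positivity) (by positivity)).trans_eq ?_
    rw [mul_add, Real.exp_add]; ring
  obtain ⟨enc, dec, henc, hdec, hsum⟩ := hdirty J hJ0
    (hJ ▸ (Nat.ceil_lt_add_one (Real.exp_pos _).le).le)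
  have hx₂ : ∀ j, Measurable fun s => clip P₂ (enc j s + a • s) := fun j => by
    have := henc j
    exact (measurable_clip P₂).comp (by fun_prop)
  have hnoise : ∀ j, Measurable fun p : (Fin k → ℝ) × (Fin k → ℝ) =>
      clip P₂ (enc j p.1 + a • p.1) + p.1 + p.2 := fun j =>
    (((hx₂ j).comp measurable_fst).add measurable_fst).add measurable_snd
  have hν : ∀ j, ((iidGaussian k Q).prod (iidGaussian k N₃)).map
      (fun p => clip P₂ (enc j p.1 + a • p.1) + p.1 + p.2)
        {v | ¬ v ⬝ᵥ v ≤ k * (P + (1 + a) ^ 2 * Q + N₃ + δ)} ≤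
      (iidGaussian k Q).prod (iidGaussian k N₃)
        {p | ¬ DirtySuccess P Q N₃ (1 + a) δ₀ enc dec j p.1 p.2} := fun j => by
    have hm : MeasurableSet {v : Fin k → ℝ | ¬ v ⬝ᵥ v ≤ k * (P + (1 + a) ^ 2 * Q + N₃ + δ)} :=
      (measurableSet_le measurable_dotProduct_self measurable_const).compl
    rw [Measure.map_apply (hnoise j) hm]
    refine measure_mono fun p hp => ?_
    simp only [Set.mem_preimage, Set.mem_ofPred_eq] at hp ⊢
    intro hs
    rw [relay_add_state_of_success hs hδP'] at hp
    exact hp (hs.noise_power hδV')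
  have hνp : ∀ j, IsProbabilityMeasure (((iidGaussian k Q).prod (iidGaussian k N₃)).map
      fun p => clip P₂ (enc j p.1 + a • p.1) + p.1 + p.2) :=
    fun j => Measure.isProbabilityMeasure_map (hnoise j).aemeasurable
  obtain ⟨x, d, d', hd, hd', hx, hrel, hdest⟩ := hsource J K hJ0 hK0 hK2 hJK4 _ hνp
    ((Finset.sum_le_sum fun j _ => hν j).trans hsum)
  refine ⟨J, K, ⟨x, fun j s => clip P₂ (enc j s + a • s), d, d', dec, hx₂, hd, hd', hdec, hx,
    fun j s => clip_dotProduct_self_le hP₂.le _⟩, hJK, ?_, ?_, ?_⟩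
  · simp only [BlockCode.relayError]
    exact hrel
  · refine (Finset.sum_le_sum fun w _ => Finset.sum_le_sum fun j _ => ?_).trans hdest
    simp only [BlockCode.destError]
    exact Measure.le_map_apply (hnoise j).aemeasurable _
  · simp only [BlockCode.binError]
    have hε' : ENNReal.ofReal (ε / 4) ≤ ENNReal.ofReal ε :=
      ENNReal.ofReal_le_ofReal (by linarith)
    refine le_trans (Finset.sum_le_sum fun j _ => measure_mono fun p hp => ?_)
      (hsum.trans (mul_le_mul_right hε' _))
    simp only [Set.mem_ofPred_eq] at hp ⊢
    intro hs
    rw [relay_add_state_of_success hs hδP'] at hp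
    exact hp hs.1

/-! ### Block Markov coding -/

/-- The `b`-th block of length `k` of a sequence. -/
def block {n : ℕ} (k b : ℕ) (y : Fin n → ℝ) : Fin k → ℝ :=
  fun o => if h : b * k + o < n then y ⟨b * k + o, h⟩ else 0

/-- Concatenation of the blocks `f 0, …, f (B - 1)`, padded with zeros. -/
def concat (n : ℕ) {k : ℕ} (B : ℕ) (f : ℕ → Fin k → ℝ) : Fin n → ℝ :=
  fun i => if h : i / k < B ∧ 0 < k then f (i / k) ⟨i % k, Nat.mod_lt _ h.2⟩ else 0

theorem block_add {n : ℕ} (k b : ℕ) (y y' : Fin n → ℝ) :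
    block k b (y + y') = block k b y + block k b y' := by
  funext o
  simp only [block, Pi.add_apply]
  split_ifs <;> simp

theorem index_lt {n k b B : ℕ} (hb : b < B) (hn : B * k ≤ n) (o : Fin k) : b * k + o < n := by
  have h1 : (b + 1) * k ≤ B * k := Nat.mul_le_mul_right k hb
  have h2 := o.2
  rw [Nat.add_mul, one_mul] at h1
  omega

theorem block_concat {n k b B : ℕ} (hb : b < B) (hn : B * k ≤ n) (f : ℕ → Fin k → ℝ) :
    block k b (concat n B f) = f b := by
  funext o
  have hk : 0 < k := o.pos
  have h1 : (b * k + o) / k = b := by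
    rw [mul_comm, Nat.mul_add_div hk, Nat.div_eq_of_lt o.2, add_zero]
  have h2 : (b * k + o) % k = o := by
    rw [mul_comm, Nat.mul_add_mod, Nat.mod_eq_of_lt o.2]
  rw [block, dif_pos (index_lt hb hn o), concat, dif_pos (by simp only [h1]; exact ⟨hb, hk⟩)]
  simp only [h1, h2]

theorem measurable_block {n : ℕ} (k b : ℕ) :
    Measurable (block k b : (Fin n → ℝ) → Fin k → ℝ) := by
  refine measurable_pi_lambda _ fun o => ?_
  unfold block
  split_ifs
  · exact measurable_pi_apply _
  · exact measurable_const

theorem measurable_concat {α : Type*} [MeasurableSpace α] (n B : ℕ) {k : ℕ}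
    {f : α → ℕ → Fin k → ℝ} (hf : ∀ b, Measurable fun a => f a b) :
    Measurable fun a => concat n B (f a) := by
  refine measurable_pi_lambda _ fun i => ?_
  unfold concat
  split_ifs with h
  · exact (measurable_pi_apply _).comp (hf _)
  · exact measurable_const

theorem measurePreserving_block {n k b B : ℕ} (hb : b < B) (hn : B * k ≤ n) (v : ℝ) :
    MeasurePreserving (block k b) (iidGaussian n v) (iidGaussian k v) := by
  refine ⟨measurable_block k b, ?_⟩
  have he : Function.Injective fun o : Fin k => (⟨b * k + o, index_lt hb hn o⟩ : Fin n) := by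
    intro o o' h
    simp only [Fin.mk.injEq] at h
    exact Fin.ext (by omega)
  rw [← map_comp_iidGaussian v he]
  congr 1
  funext y o
  rw [block, dif_pos (index_lt hb hn o)]

theorem sum_range_mul_eq (g : ℕ → ℝ) (B k : ℕ) :
    ∑ i ∈ Finset.range (B * k), g i = ∑ b ∈ Finset.range B, ∑ o ∈ Finset.range k, g (b * k + o) := by
  induction B with
  | zero => simp
  | succ B ih => rw [Nat.succ_mul, Finset.sum_range_add, ih, Finset.sum_range_succ]

theorem concat_power {n k B : ℕ} (hn : B * k ≤ n) {P : ℝ} (hP : 0 ≤ P) {f : ℕ → Fin k → ℝ}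
    (hf : ∀ b, f b ⬝ᵥ f b ≤ k * P) : ∑ i, concat n B f i ^ 2 ≤ n * P := by
  set g : ℕ → ℝ := fun i =>
    if h : i / k < B ∧ 0 < k then f (i / k) ⟨i % k, Nat.mod_lt _ h.2⟩ ^ 2 else 0 with hg
  have e1 : ∑ i, concat n B f i ^ 2 = ∑ i ∈ Finset.range n, g i := by
    rw [Finset.sum_range]
    refine Finset.sum_congr rfl fun i _ => ?_
    simp only [concat, hg]
    split_ifs <;> simp
  have e2 : ∑ i ∈ Finset.range n, g i = ∑ i ∈ Finset.range (B * k), g i := by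
    refine (Finset.sum_subset (Finset.range_subset_range.2 hn) fun i _ hi => ?_).symm
    rw [Finset.mem_range, not_lt] at hi
    simp only [hg]
    refine dif_neg fun h => ?_
    exact absurd h.1 (not_lt.2 ((Nat.le_div_iff_mul_le h.2).2 hi))
  rw [e1, e2, sum_range_mul_eq]
  have h1 : ∀ b ∈ Finset.range B, ∑ o ∈ Finset.range k, g (b * k + o) ≤ k * P := fun b hb => by
    rw [Finset.sum_range]
    refine le_trans (le_of_eq ?_) (hf b)
    rw [dotProduct_self_eq_sum_sq]
    refine Finset.sum_congr rfl fun o _ => ?_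
    have hk : 0 < k := o.pos
    have h1 : (b * k + o) / k = b := by
      rw [mul_comm, Nat.mul_add_div hk, Nat.div_eq_of_lt o.2, add_zero]
    have h2 : (b * k + o) % k = o := by
      rw [mul_comm, Nat.mul_add_mod, Nat.mod_eq_of_lt o.2]
    simp only [hg]
    rw [dif_pos (by simp only [h1]; exact ⟨Finset.mem_range.1 hb, hk⟩)]
    simp only [h1, h2]
  refine (Finset.sum_le_card_nsmul _ _ _ h1).trans ?_
  rw [Finset.card_range, nsmul_eq_mul, ← mul_assoc]
  refine mul_le_mul_of_nonneg_right ?_ hP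
  exact_mod_cast hn

namespace BlockCode

variable {k J K : ℕ} {P₁ P₂ : ℝ} (c : BlockCode k J K P₁ P₂)

/-- The bin index that the relay sends in block `b`, from its outputs in block `b - 1`. -/
def relayIndex {n : ℕ} (j₀ : Fin J) (s y : Fin n → ℝ) : ℕ → Fin J
  | 0 => j₀
  | b + 1 => (c.relayDecode (block k b y - block k b s)).1

/-- Backward decoding at the destination: the estimate of the message of block `m - r`. -/
def estimate {n : ℕ} (m : ℕ) (w₀ : Fin J × Fin K) (y : Fin n → ℝ) : ℕ → Fin J × Fin K
  | 0 => w₀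
  | r + 1 => c.destDecode (c.binDecode (block k (m - r) y - c.source (estimate m w₀ y r)))
      (block k (m - r - 1) y)

/-- The message of block `b`; the last block carries the fixed message `w₀`. -/
def blockMessage {m : ℕ} (w₀ : Fin J × Fin K) (w : Fin m → Fin J × Fin K) (b : ℕ) :
    Fin J × Fin K :=
  if h : b < m then w ⟨b, h⟩ else w₀

/-- The bin index that the relay sends in block `b` when it decodes correctly. -/
def sentIndex {m : ℕ} (j₀ : Fin J) (w₀ : Fin J × Fin K) (w : Fin m → Fin J × Fin K) : ℕ → Fin J
  | 0 => j₀
  | b + 1 => (blockMessage w₀ w b).1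

theorem measurable_relayIndex {n : ℕ} (j₀ : Fin J) (b : ℕ) :
    Measurable fun p : (Fin n → ℝ) × (Fin n → ℝ) => c.relayIndex j₀ p.1 p.2 b := by
  cases b with
  | zero => exact measurable_const
  | succ b =>
    have h1 := measurable_block (n := n) k b
    exact measurable_fst.comp (c.measurable_relayDecode.comp
      ((h1.comp measurable_snd).sub (h1.comp measurable_fst)))

theorem measurable_uncurry_relay : Measurable fun q : Fin J × (Fin k → ℝ) => c.relay q.1 q.2 :=
  measurable_from_prod_countable_right fun j => c.measurable_relay j

theorem measurable_uncurry_destDecode :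
    Measurable fun q : Fin J × (Fin k → ℝ) => c.destDecode q.1 q.2 :=
  measurable_from_prod_countable_right fun j => c.measurable_destDecode j

theorem measurable_estimate {n : ℕ} (m : ℕ) (w₀ : Fin J × Fin K) (r : ℕ) :
    Measurable fun y : Fin n → ℝ => c.estimate m w₀ y r := by
  induction r with
  | zero => exact measurable_const
  | succ r ih =>
    have h1 : Measurable fun y : Fin n → ℝ => c.source (c.estimate m w₀ y r) :=
      (measurable_of_finite c.source).comp ih
    have h2 : Measurable fun y : Fin n → ℝ =>
        c.binDecode (block k (m - r) y - c.source (c.estimate m w₀ y r)) :=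
      c.measurable_binDecode.comp ((measurable_block k (m - r)).sub h1)
    exact c.measurable_uncurry_destDecode.comp (h2.prodMk (measurable_block k (m - r - 1)))

/-- Causality: the index sent in a block depends on the outputs of the preceding block only, which
all precede time `i`. -/
theorem relayIndex_congr {n : ℕ} (j₀ : Fin J) (s : Fin n → ℝ) {y y' : Fin n → ℝ} (i : Fin n)
    (h : ∀ j, j < i → y j = y' j) :
    c.relayIndex j₀ s y (i / k) = c.relayIndex j₀ s y' (i / k) := by
  cases hb : (i : ℕ) / k with
  | zero => rfl
  | succ b =>
    have e : block k b y = block k b y' := by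
      funext o
      simp only [block]
      split_ifs with ho
      · refine h _ (Fin.lt_def.2 ?_)
        have h1 := Nat.div_mul_le_self i k
        rw [hb, Nat.succ_mul] at h1
        have h2 := o.2
        simp only
        omega
      · rfl
    simp only [relayIndex, e]

/-- The relay code that transmits the messages `w 0, …, w (m - 1)` in `m + 1` blocks. -/
def toCode (n m : ℕ) (j₀ : Fin J) (w₀ : Fin J × Fin K) :
    Code n (Fintype.card (Fin m → Fin J × Fin K)) where
  source i _ := concat n (m + 1) fun b =>
    c.source (blockMessage w₀ ((Fintype.equivFin (Fin m → Fin J × Fin K)).symm i) b)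
  relay s y := concat n (m + 1) fun b => c.relay (c.relayIndex j₀ s y b) (block k b s)
  -- Estimates are counted from the end: step `m - b` concerns block `b`, and step `0` is the known
  -- message of the last block `m`.
  decode y := Fintype.equivFin (Fin m → Fin J × Fin K) fun b => c.estimate m w₀ y (m - b)
  measurable_source _ := measurable_const
  measurable_relay := measurable_concat n (m + 1)
    (f := fun (p : (Fin n → ℝ) × (Fin n → ℝ)) b =>
      c.relay (c.relayIndex j₀ p.1 p.2 b) (block k b p.1)) fun b =>
    c.measurable_uncurry_relay.comp ((c.measurable_relayIndex j₀ b).prodMk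
      ((measurable_block k b).comp measurable_fst))
  measurable_decode := (measurable_of_finite _).comp
    (measurable_pi_lambda _ fun b => c.measurable_estimate m w₀ (m - b))
  relay_causal s y y' i h := by
    simp only [concat, c.relayIndex_congr j₀ s i h]

end BlockCode

namespace BlockCode

variable {k J K : ℕ} {P₁ P₂ : ℝ} (c : BlockCode k J K P₁ P₂)

/-- The event on which every block is decoded correctly. -/
def allCorrect {n m : ℕ} (j₀ : Fin J) (w₀ : Fin J × Fin K) (w : Fin m → Fin J × Fin K)
    (ω : (Fin n → ℝ) × (Fin n → ℝ) × (Fin n → ℝ)) : Prop :=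
  ∀ b : Fin m, c.relayDecode (c.source (w b) + block k b ω.2.1) = w b ∧
    c.binDecode (c.relay (w b).1 (block k (b + 1) ω.1) + block k (b + 1) ω.1 +
      (block k (b + 1) ω.2.1 + block k (b + 1) ω.2.2)) = (w b).1 ∧
    c.destDecode (w b).1 (c.source (w b) + (c.relay (sentIndex j₀ w₀ w b) (block k b ω.1) +
      block k b ω.1 + (block k b ω.2.1 + block k b ω.2.2))) = w b

variable {c} in
-- The relay indices are right because the relay sees `X₁ + Z₂` after removing `S`. Induction from
-- the last block backwards then works: the message of block `b + 1` clears that block for the bin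
-- index, and the bin index resolves block `b`.
theorem allCorrect.decode_eq {n m : ℕ} (hn : (m + 1) * k ≤ n)
    {j₀ : Fin J} {w₀ : Fin J × Fin K} {w : Fin m → Fin J × Fin K}
    {ω : (Fin n → ℝ) × (Fin n → ℝ) × (Fin n → ℝ)} (h : c.allCorrect j₀ w₀ w ω) :
    (c.toCode n m j₀ w₀).decode ((c.toCode n m j₀ w₀).destOutput
      (Fintype.equivFin (Fin m → Fin J × Fin K) w) ω) =
        Fintype.equivFin (Fin m → Fin J × Fin K) w := by
  set i := Fintype.equivFin (Fin m → Fin J × Fin K) w with hi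
  set y₂ := (c.toCode n m j₀ w₀).relayOutput i ω with hy₂
  set y₃ := (c.toCode n m j₀ w₀).destOutput i ω with hy₃
  have h₂ : ∀ b, b < m + 1 → block k b y₂ =
      c.source (blockMessage w₀ w b) + block k b ω.1 + block k b ω.2.1 := fun b hb => by
    rw [hy₂, Code.relayOutput, block_add, block_add]
    congr 2
    rw [toCode, block_concat hb hn, hi, Equiv.symm_apply_apply]
  have hmsg : ∀ (b : ℕ) (hb : b < m), blockMessage w₀ w b = w ⟨b, hb⟩ := fun b hb => dif_pos hb
  have hidx : ∀ b, b < m + 1 → c.relayIndex j₀ ω.1 y₂ b = sentIndex j₀ w₀ w b := by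
    intro b hb
    cases b with
    | zero => rfl
    | succ b =>
      have hb' : b < m := by omega
      simp only [relayIndex, sentIndex]
      rw [h₂ b (by omega), hmsg b hb']
      have e : c.source (w ⟨b, hb'⟩) + block k b ω.1 + block k b ω.2.1 - block k b ω.1 =
          c.source (w ⟨b, hb'⟩) + block k b ω.2.1 := by abel
      rw [e]
      exact congrArg Prod.fst (h ⟨b, hb'⟩).1
  have h₃ : ∀ b, b < m + 1 → block k b y₃ = c.source (blockMessage w₀ w b) +
      (c.relay (sentIndex j₀ w₀ w b) (block k b ω.1) + block k b ω.1 +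
        (block k b ω.2.1 + block k b ω.2.2)) := fun b hb => by
    rw [hy₃, Code.destOutput, block_add, block_add, ← hy₂, h₂ b hb]
    have e : block k b ((c.toCode n m j₀ w₀).relay ω.1 y₂) =
        c.relay (sentIndex j₀ w₀ w b) (block k b ω.1) := by
      rw [toCode, block_concat hb hn, hidx b hb]
    rw [e]
    abel
  have hest : ∀ r, r ≤ m → c.estimate m w₀ y₃ r = blockMessage w₀ w (m - r) := by
    intro r
    induction r with
    | zero =>
      intro _
      simp [estimate, blockMessage]
    | succ r ih =>
      intro hr
      obtain ⟨b, hb⟩ : ∃ b, m - r = b + 1 := ⟨m - r - 1, by omega⟩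
      have hbm : b < m := by omega
      have hb2 : m - (r + 1) = b := by omega
      have hb3 : m - r - 1 = b := by omega
      rw [estimate, ih (by omega), hb, hb2, Nat.add_sub_cancel, h₃ (b + 1) (by omega),
        add_sub_cancel_left, h₃ b (by omega), hmsg b hbm]
      have e : sentIndex j₀ w₀ w (b + 1) = (w ⟨b, hbm⟩).1 := by rw [sentIndex, hmsg b hbm]
      rw [e, (h ⟨b, hbm⟩).2.1, (h ⟨b, hbm⟩).2.2]
  have hdec : (c.toCode n m j₀ w₀).decode y₃ = Fintype.equivFin (Fin m → Fin J × Fin K)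
      fun b => c.estimate m w₀ y₃ (m - b) := rfl
  rw [hdec, hi]
  congr 1
  funext b
  rw [hest _ (Nat.sub_le _ _), Nat.sub_sub_self b.2.le, hmsg b b.2]

theorem measurePreserving_block_noise {n k b B : ℕ} (hb : b < B) (hn : B * k ≤ n)
    {Q N₂ N₃ : ℝ} (hN₂ : 0 ≤ N₂) (hN₂₃ : N₂ ≤ N₃) :
    MeasurePreserving (fun ω : (Fin n → ℝ) × (Fin n → ℝ) × (Fin n → ℝ) =>
      (block k b ω.1, block k b ω.2.1 + block k b ω.2.2)) (noiseLaw n Q N₂ N₃)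
      ((iidGaussian k Q).prod (iidGaussian k N₃)) := by
  have h1 : MeasurePreserving (fun p : (Fin k → ℝ) × (Fin k → ℝ) => p.1 + p.2)
      ((iidGaussian k N₂).prod (iidGaussian k (N₃ - N₂))) (iidGaussian k N₃) :=
    ⟨by fun_prop, by rw [map_add_prod_iidGaussian k hN₂ (sub_nonneg.2 hN₂₃), add_sub_cancel]⟩
  exact (measurePreserving_block hb hn Q).prod
    (h1.comp ((measurePreserving_block hb hn N₂).prod (measurePreserving_block hb hn (N₃ - N₂))))

theorem measurePreserving_block_relayNoise {n k b B : ℕ} (hb : b < B) (hn : B * k ≤ n)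
    {Q N₂ N₃ : ℝ} :
    MeasurePreserving (fun ω : (Fin n → ℝ) × (Fin n → ℝ) × (Fin n → ℝ) => block k b ω.2.1)
      (noiseLaw n Q N₂ N₃) (iidGaussian k N₂) :=
  (measurePreserving_block hb hn N₂).comp (measurePreserving_fst.comp measurePreserving_snd)

/-- A union bound: only the law of the noises in each single block is needed, not independence
between blocks. -/
theorem measure_not_allCorrect_le {n m : ℕ} (hn : (m + 1) * k ≤ n) {Q N₂ N₃ : ℝ}
    (hN₂ : 0 ≤ N₂) (hN₂₃ : N₂ ≤ N₃) (j₀ : Fin J) (w₀ : Fin J × Fin K)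
    (w : Fin m → Fin J × Fin K) :
    noiseLaw n Q N₂ N₃ {ω | ¬ c.allCorrect j₀ w₀ w ω} ≤
      ∑ b : Fin m, (c.relayError N₂ (w b) + (c.binError Q N₃ (w b).1 +
        c.destError Q N₃ (w b) (sentIndex j₀ w₀ w b))) := by
  set E₁ : Fin m → Set ((Fin n → ℝ) × (Fin n → ℝ) × (Fin n → ℝ)) := fun b =>
    (fun ω => block k b ω.2.1) ⁻¹' {z | c.relayDecode (c.source (w b) + z) ≠ w b} with hE₁
  set E₂ : Fin m → Set ((Fin n → ℝ) × (Fin n → ℝ) × (Fin n → ℝ)) := fun b =>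
    (fun ω => (block k (b + 1) ω.1, block k (b + 1) ω.2.1 + block k (b + 1) ω.2.2)) ⁻¹'
      {p | c.binDecode (c.relay (w b).1 p.1 + p.1 + p.2) ≠ (w b).1} with hE₂
  set E₃ : Fin m → Set ((Fin n → ℝ) × (Fin n → ℝ) × (Fin n → ℝ)) := fun b =>
    (fun ω => (block k b ω.1, block k b ω.2.1 + block k b ω.2.2)) ⁻¹'
      {p | c.destDecode (w b).1 (c.source (w b) +
        (c.relay (sentIndex j₀ w₀ w b) p.1 + p.1 + p.2)) ≠ w b} with hE₃
  have hsub : {ω | ¬ c.allCorrect j₀ w₀ w ω} ⊆ ⋃ b, (E₁ b ∪ (E₂ b ∪ E₃ b)) := by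
    intro ω hω
    simp only [Set.mem_ofPred_eq, allCorrect, not_forall] at hω
    obtain ⟨b, hb⟩ := hω
    refine Set.mem_iUnion.2 ⟨b, ?_⟩
    by_contra hcon
    simp only [Set.mem_union, not_or, hE₁, hE₂, hE₃, Set.mem_preimage, Set.mem_ofPred_eq,
      not_not, ne_eq] at hcon
    exact hb hcon
  refine (measure_mono hsub).trans ((measure_iUnion_fintype_le _ _).trans
    (Finset.sum_le_sum fun b _ => (measure_union_le _ _).trans (add_le_add ?_
      ((measure_union_le _ _).trans (add_le_add ?_ ?_)))))
  · have hmp := measurePreserving_block_relayNoise (Q := Q) (N₂ := N₂) (N₃ := N₃)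
      (show (b : ℕ) < m + 1 by omega) hn
    -- The error event need not be measurable: this inequality for the image measure holds for every
    -- set.
    refine (Measure.le_map_apply hmp.measurable.aemeasurable _).trans_eq ?_
    rw [hmp.map_eq, relayError]
  · have hmp := measurePreserving_block_noise (Q := Q)
      (show (b : ℕ) + 1 < m + 1 by omega) hn hN₂ hN₂₃
    refine (Measure.le_map_apply hmp.measurable.aemeasurable _).trans_eq ?_
    rw [hmp.map_eq, binError]
  · have hmp := measurePreserving_block_noise (Q := Q)
      (show (b : ℕ) < m + 1 by omega) hn hN₂ hN₂₃
    refine (Measure.le_map_apply hmp.measurable.aemeasurable _).trans_eq ?_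
    rw [hmp.map_eq, destError]

end BlockCode

/-! ### Averages over message tuples -/

theorem sum_pi_eval_le {ι W : Type*} [Fintype ι] [DecidableEq ι] [Fintype W] (b : ι)
    {f : W → ℝ≥0∞} {η : ℝ≥0∞} (h : ∑ x, f x ≤ Fintype.card W * η) :
    ∑ w : ι → W, f (w b) ≤ Fintype.card (ι → W) * η := by
  have hc := Fintype.card_congr (Equiv.funSplitAt b W)
  rw [Fintype.card_prod] at hc
  rw [← (Equiv.funSplitAt b W).symm.sum_comp, Fintype.sum_prod_type, hc]
  simp only [Equiv.funSplitAt_symm_apply, Finset.sum_const, Finset.card_univ,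
    nsmul_eq_mul, dite_true, ← Finset.mul_sum]
  refine (mul_le_mul_right h _).trans_eq ?_
  push_cast
  ring

/-- Two different coordinates of a uniform tuple are independent and uniform. This is applied to a
message and the bin index that interferes with it, which comes from the preceding block. -/
theorem sum_pi_eval_pair_le {ι W : Type*} [Fintype ι] [DecidableEq ι] [Fintype W] {a b : ι}
    (hab : b ≠ a) {f : W → W → ℝ≥0∞} {η : ℝ≥0∞}
    (h : ∑ x, ∑ y, f x y ≤ Fintype.card W * (Fintype.card W * η)) :
    ∑ w : ι → W, f (w a) (w b) ≤ Fintype.card (ι → W) * η := by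
  have hc := Fintype.card_congr (Equiv.funSplitAt a W)
  rw [Fintype.card_prod] at hc
  rw [← (Equiv.funSplitAt a W).symm.sum_comp, Fintype.sum_prod_type_right, hc]
  simp only [Equiv.funSplitAt_symm_apply, dite_true, dif_neg hab]
  refine (sum_pi_eval_le (⟨b, hab⟩ : {j // j ≠ a}) (f := fun y => ∑ x, f x y)
    (η := Fintype.card W * η) (by rwa [Finset.sum_comm])).trans_eq ?_
  push_cast
  ring

theorem exists_sum_le_of_sum_sum_le {α ι : Type*} [Fintype α] [Fintype ι] [Nonempty ι]
    (f : α → ι → ℝ≥0∞) {η : ℝ≥0∞}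
    (h : ∑ a, ∑ i, f a i ≤ Fintype.card ι * η) : ∃ i, ∑ a, f a i ≤ η := by
  by_contra! hcon
  rw [Finset.sum_comm] at h
  refine absurd h (not_le.2 ?_)
  rw [← nsmul_eq_mul]
  refine lt_of_eq_of_lt (by simp) (ENNReal.sum_lt_sum_of_nonempty Finset.univ_nonempty
    (f := fun _ : ι => η) fun i _ => hcon i)

namespace BlockCode

variable {k J K : ℕ} {P₁ P₂ : ℝ} (c : BlockCode k J K P₁ P₂)

/-- In block `0` the relay sends the fixed `j₀`, which therefore needs its own bound; afterwards it
sends the bin of an independent uniform message, and the average over all pairs applies. -/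
theorem sum_destError_sentIndex_le {m : ℕ} {Q N₃ : ℝ} {η : ℝ≥0∞}
    (hdest : ∑ w, ∑ j, c.destError Q N₃ w j ≤ (J * K * J : ℕ) * η)
    {j₀ : Fin J} (hj₀ : ∑ w, c.destError Q N₃ w j₀ ≤ (J * K : ℕ) * η) (w₀ : Fin J × Fin K)
    (b : Fin m) :
    ∑ w : Fin m → Fin J × Fin K, c.destError Q N₃ (w b) (sentIndex j₀ w₀ w b) ≤
      Fintype.card (Fin m → Fin J × Fin K) * η := by
  have hW : Fintype.card (Fin J × Fin K) = J * K := by simp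
  obtain ⟨b, hb⟩ := b
  cases b with
  | zero =>
    exact sum_pi_eval_le (f := fun x => c.destError Q N₃ x j₀) (⟨0, hb⟩ : Fin m) (by rwa [hW])
  | succ b =>
    have hb' : b < m := by omega
    have e : ∀ w : Fin m → Fin J × Fin K,
        sentIndex j₀ w₀ w (b + 1) = (w ⟨b, hb'⟩).1 := fun w => by
      rw [sentIndex, blockMessage, dif_pos hb']
    have hsum : ∑ w : Fin J × Fin K, ∑ w' : Fin J × Fin K, c.destError Q N₃ w w'.1 ≤
        (J * K : ℕ) * ((J * K : ℕ) * η) := by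
      have e' : ∀ w : Fin J × Fin K, ∑ w' : Fin J × Fin K, c.destError Q N₃ w w'.1 =
          K * ∑ j, c.destError Q N₃ w j := fun w => by
        rw [Fintype.sum_prod_type]
        simp only [Finset.sum_const, Finset.card_univ, Fintype.card_fin, nsmul_eq_mul]
        rw [← Finset.mul_sum]
      simp only [e', ← Finset.mul_sum]
      refine (mul_le_mul_right hdest _).trans_eq ?_
      push_cast
      ring
    have hne : (⟨b, hb'⟩ : Fin m) ≠ ⟨b + 1, hb⟩ := fun h => by
      simp only [Fin.mk.injEq] at h
      omega
    simp only [e]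
    exact sum_pi_eval_pair_le hne (f := fun x y => c.destError Q N₃ x y.1) (by rwa [hW])

theorem measure_decode_ne_le {n m : ℕ} (hn : (m + 1) * k ≤ n) {Q N₂ N₃ : ℝ}
    (hN₂ : 0 ≤ N₂) (hN₂₃ : N₂ ≤ N₃) (j₀ : Fin J) (w₀ : Fin J × Fin K)
    (w : Fin m → Fin J × Fin K) :
    noiseLaw n Q N₂ N₃ {ω | (c.toCode n m j₀ w₀).decode ((c.toCode n m j₀ w₀).destOutput
        (Fintype.equivFin (Fin m → Fin J × Fin K) w) ω) ≠
          Fintype.equivFin (Fin m → Fin J × Fin K) w} ≤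
      ∑ b : Fin m, (c.relayError N₂ (w b) + (c.binError Q N₃ (w b).1 +
        c.destError Q N₃ (w b) (sentIndex j₀ w₀ w b))) := by
  refine le_trans (measure_mono ?_) (c.measure_not_allCorrect_le hn hN₂ hN₂₃ j₀ w₀ w)
  intro ω hω h
  exact hω (allCorrect.decode_eq hn h)

theorem sum_measure_decode_ne_le {n m : ℕ} (hn : (m + 1) * k ≤ n) {Q N₂ N₃ ε : ℝ} (hN₂ : 0 ≤ N₂)
    (hN₂₃ : N₂ ≤ N₃) (hε : 0 ≤ ε)
    (hrel : ∑ w, c.relayError N₂ w ≤ (J * K : ℕ) * ENNReal.ofReal ε)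
    (hdest : ∑ w, ∑ j, c.destError Q N₃ w j ≤ (J * K * J : ℕ) * ENNReal.ofReal ε)
    (hbin : ∑ j, c.binError Q N₃ j ≤ J * ENNReal.ofReal ε)
    {j₀ : Fin J} (hj₀ : ∑ w, c.destError Q N₃ w j₀ ≤ (J * K : ℕ) * ENNReal.ofReal ε)
    (w₀ : Fin J × Fin K) :
    ∑ i, noiseLaw n Q N₂ N₃ {ω | (c.toCode n m j₀ w₀).decode
      ((c.toCode n m j₀ w₀).destOutput i ω) ≠ i} ≤
        Fintype.card (Fin m → Fin J × Fin K) * ENNReal.ofReal (3 * m * ε) := by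
  have hW : Fintype.card (Fin J × Fin K) = J * K := by simp
  have hbin' : ∑ w : Fin J × Fin K, c.binError Q N₃ w.1 ≤ (J * K : ℕ) * ENNReal.ofReal ε := by
    rw [Fintype.sum_prod_type]
    simp only [Finset.sum_const, Finset.card_univ, Fintype.card_fin, nsmul_eq_mul]
    rw [← Finset.mul_sum]
    refine (mul_le_mul_right hbin _).trans_eq ?_
    push_cast
    ring
  have h2 : ∀ b : Fin m, ∑ w : Fin m → Fin J × Fin K, (c.relayError N₂ (w b) +
      (c.binError Q N₃ (w b).1 + c.destError Q N₃ (w b) (sentIndex j₀ w₀ w b))) ≤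
      Fintype.card (Fin m → Fin J × Fin K) * ENNReal.ofReal (3 * ε) := fun b => by
    rw [Finset.sum_add_distrib, Finset.sum_add_distrib]
    have h₁ := sum_pi_eval_le (f := fun x => c.relayError N₂ x) b (by rwa [hW])
    have h₂ := sum_pi_eval_le (f := fun x : Fin J × Fin K => c.binError Q N₃ x.1) b
      (by rwa [hW])
    refine (add_le_add h₁ (add_le_add h₂
      (c.sum_destError_sentIndex_le hdest hj₀ w₀ b))).trans_eq ?_
    rw [← mul_add, ← mul_add, ← ENNReal.ofReal_add hε hε, ← ENNReal.ofReal_add hε (by positivity)]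
    congr 2
    ring
  rw [← (Fintype.equivFin (Fin m → Fin J × Fin K)).sum_comp]
  refine (Finset.sum_le_sum fun w _ =>
    c.measure_decode_ne_le hn hN₂ hN₂₃ j₀ w₀ w).trans ?_
  rw [Finset.sum_comm]
  refine (Finset.sum_le_card_nsmul _ _ _ fun b _ => h2 b).trans_eq ?_
  rw [Finset.card_univ, Fintype.card_fin, nsmul_eq_mul, mul_left_comm,
    ← ENNReal.ofReal_natCast m, ← ENNReal.ofReal_mul (Nat.cast_nonneg m)]
  congr 2
  ring

end BlockCode

/-! ### From block codes to achievable rates -/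

theorem Code.errorProb_le {n M : ℕ} (c : Code n M) {Q N₂ N₃ ε : ℝ} (hε : 0 ≤ ε)
    (h : ∑ i, noiseLaw n Q N₂ N₃ {ω | c.decode (c.destOutput i ω) ≠ i} ≤
      M * ENNReal.ofReal ε) : c.errorProb Q N₂ N₃ ≤ ε := by
  have : IsProbabilityMeasure (noiseLaw n Q N₂ N₃) := by unfold noiseLaw; infer_instance
  rw [Code.errorProb]
  refine div_le_of_le_mul₀ (Nat.cast_nonneg _) hε ?_
  have h' := ENNReal.toReal_mono (by finiteness) h
  rwa [ENNReal.toReal_sum (fun _ _ => measure_ne_top _ _), ENNReal.toReal_mul,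
    ENNReal.toReal_ofReal hε, ENNReal.toReal_natCast, mul_comm (M : ℝ)] at h'

theorem Achievable.mono {P₁ P₂ Q N₂ N₃ R R' : ℝ} (h : Achievable P₁ P₂ Q N₂ N₃ R) (hR : R' ≤ R) :
    Achievable P₁ P₂ Q N₂ N₃ R' := fun ε hε => by
  obtain ⟨n₀, h⟩ := h ε hε
  refine ⟨n₀, fun n hn => ?_⟩
  obtain ⟨M, c, hM, h⟩ := h n hn
  exact ⟨M, c, (Real.exp_le_exp.2 (mul_le_mul_of_nonneg_left hR (Nat.cast_nonneg n))).trans hM, h⟩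

theorem BlockCode.toCode_sourceUninformed {k J K : ℕ} {P₁ P₂ : ℝ} (c : BlockCode k J K P₁ P₂)
    (n m : ℕ) (j₀ : Fin J) (w₀ : Fin J × Fin K) : (c.toCode n m j₀ w₀).SourceUninformed :=
  fun _ _ _ => rfl

theorem BlockCode.toCode_powerConstraint {k J K : ℕ} {P₁ P₂ : ℝ} (c : BlockCode k J K P₁ P₂)
    (hP₁ : 0 ≤ P₁) (hP₂ : 0 ≤ P₂) {n m : ℕ} (hn : (m + 1) * k ≤ n) (j₀ : Fin J)
    (w₀ : Fin J × Fin K) : (c.toCode n m j₀ w₀).PowerConstraint P₁ P₂ := by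
  refine ⟨fun i s => ?_, fun s y => ?_⟩
  · simp only [BlockCode.toCode]
    exact concat_power hn hP₁ fun b => c.source_power _
  · simp only [BlockCode.toCode]
    exact concat_power hn hP₂ fun b => c.relay_power _ _

/-- Decode-and-forward with dirty paper coding at the relay. -/
theorem achievable_of_lt_add {P₁ P₂ Q N₂ N₃ P a R₁ R₂ R : ℝ} (hP₁ : 0 < P₁) (hP : 0 < P)
    (hQ : 0 ≤ Q) (hN₂ : 0 < N₂) (hN₂₃ : N₂ ≤ N₃) (hpow : P + a ^ 2 * Q < P₂)
    (hR₁0 : 0 ≤ R₁) (hR₂0 : 0 ≤ R₂)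
    (hR₁ : R₁ < 1 / 2 * Real.log (1 + P₁ / (P + (1 + a) ^ 2 * Q + N₃)))
    (hR₂ : R₂ < 1 / 2 * Real.log (1 + P / N₃))
    (hR₁₂ : R₁ + R₂ < 1 / 2 * Real.log (1 + P₁ / N₂)) (hR0 : 0 ≤ R) (hR : R < R₁ + R₂) :
    Achievable P₁ P₂ Q N₂ N₃ R := by
  intro ε hε
  have hP₂ : 0 < P₂ := lt_of_le_of_lt (by positivity) hpow
  -- Only `m` of the `m + 1` blocks carry messages; this `m` makes the loss smaller than `R₁ + R₂ -
  -- R`.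
  obtain ⟨m, hm⟩ := exists_nat_gt (R / (R₁ + R₂ - R))
  have hm' : (m + 1) * R < m * (R₁ + R₂) := by
    rw [div_lt_iff₀ (sub_pos.2 hR)] at hm
    linarith
  have hε' : 0 < ε / (3 * m + 1) := by positivity
  have hblock := exists_block_code hP₁ hP hQ hN₂ (hN₂.trans_le hN₂₃) hpow hR₁0 hR₂0 hR₁ hR₂ hR₁₂ hε'
  -- Long blocks absorb the rounding of `n` to a multiple of `m + 1`.
  have hlarge : ∀ᶠ k : ℕ in atTop, (m + 1) * R ≤ k * (m * (R₁ + R₂) - (m + 1) * R) :=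
    (tendsto_natCast_atTop_atTop.atTop_mul_const (sub_pos.2 hm')).eventually_ge_atTop _
  have hdiv : Tendsto (fun n : ℕ => n / (m + 1)) atTop atTop :=
    Nat.tendsto_div_const_atTop (Nat.succ_ne_zero m)
  obtain ⟨n₀, hn₀⟩ := eventually_atTop.1 (hdiv.eventually (hblock.and hlarge))
  refine ⟨n₀, fun n hn => ?_⟩
  have hn' := hn₀ n hn
  have hkn := Nat.mul_div_le n (m + 1)
  have hkn' : (n : ℝ) ≤ (m + 1) * ((n / (m + 1) : ℕ) + 1) := by
    have := Nat.lt_mul_div_succ n (Nat.succ_pos m)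
    exact_mod_cast this.le
  generalize n / (m + 1) = k at hn' hkn hkn'
  obtain ⟨⟨J, K, c, hJK, hrel, hdest, hbin⟩, hk⟩ := hn'
  have hJK0 : 0 < J * K := by
    have := (Real.exp_pos _).trans_le hJK
    exact_mod_cast this
  have hJ0 : 0 < J := Nat.pos_of_mul_pos_right hJK0
  have hK0 : 0 < K := Nat.pos_of_mul_pos_left hJK0
  have : Nonempty (Fin J) := ⟨⟨0, hJ0⟩⟩
  -- Averaging over `j` provides an initial index that does no more harm than a random one.
  obtain ⟨j₀, hj₀⟩ := exists_sum_le_of_sum_sum_le (fun w j => c.destError Q N₃ w j)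
    (η := (J * K : ℕ) * ENNReal.ofReal (ε / (3 * m + 1))) (by
      refine hdest.trans_eq ?_
      rw [Fintype.card_fin]
      push_cast
      ring)
  refine ⟨_, c.toCode n m j₀ (⟨0, hJ0⟩, ⟨0, hK0⟩), ?_, c.toCode_sourceUninformed _ _ _ _,
    c.toCode_powerConstraint hP₁.le hP₂.le hkn _ _, ?_⟩
  · have hcard : Fintype.card (Fin m → Fin J × Fin K) = (J * K) ^ m := by simp
    rw [hcard]
    push_cast
    refine le_trans ?_ (pow_le_pow_left₀ (Real.exp_pos _).le hJK m)
    rw [← Real.exp_nat_mul]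
    refine Real.exp_le_exp.2 ((mul_le_mul_of_nonneg_right hkn' hR0).trans ?_)
    linarith
  · refine (Code.errorProb_le _ (by positivity) (c.sum_measure_decode_ne_le hkn hN₂.le hN₂₃ hε'.le
      hrel hdest hbin hj₀ _)).trans ?_
    rw [mul_div_assoc', div_le_iff₀ (by positivity)]
    nlinarith

/-- Without relay power the source code for the Gaussian channel is used. -/
theorem achievable_of_relay_silent {P₁ P₂ Q N₂ N₃ R : ℝ} (hP₁ : 0 < P₁) (hP₂ : 0 ≤ P₂)
    (hQ : 0 ≤ Q) (hN₂ : 0 < N₂) (hN₂₃ : N₂ ≤ N₃) (hR0 : 0 ≤ R)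
    (hR : R < 1 / 2 * Real.log (1 + P₁ / (Q + N₃))) : Achievable P₁ P₂ Q N₂ N₃ R := by
  intro ε hε
  obtain ⟨n₀, hn₀⟩ := eventually_atTop.1
    (exists_awgn_code hP₁ (by linarith : 0 < Q + N₃) hR0 hR hε)
  refine ⟨n₀, fun n hn => ?_⟩
  obtain ⟨M, x, d, hM, hd, hx, hsum⟩ := hn₀ n hn
  have : IsProbabilityMeasure (noiseLaw n Q N₂ N₃) := by unfold noiseLaw; infer_instance
  let c : Code n M :=
    { source := fun m _ => x m
      relay := fun _ _ => 0
      decode := d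
      measurable_source := fun _ => measurable_const
      measurable_relay := measurable_const
      measurable_decode := hd
      relay_causal := fun _ _ _ _ _ => rfl }
  refine ⟨M, c, hM, fun _ _ _ => rfl, ⟨fun m _ => ?_, fun _ _ => ?_⟩, ?_⟩
  · exact (dotProduct_self_eq_sum_sq (x m)).symm.trans_le (hx m)
  · simp only [c, Pi.zero_apply, ne_eq, OfNat.ofNat_ne_zero, not_false_eq_true, zero_pow,
      Finset.sum_const_zero]
    positivity
  · have hdest : ∀ m ω, c.destOutput m ω = x m + (ω.1 + (ω.2.1 + ω.2.2)) := fun m ω => by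
      simp only [Code.destOutput, Code.relayOutput, c]
      abel
    refine c.errorProb_le hε.le ((Finset.sum_le_sum fun m _ => ?_).trans hsum)
    rw [← map_total_noiseLaw n hQ hN₂.le hN₂₃]
    simp only [hdest]
    exact Measure.le_map_apply (f := fun ω : (Fin n → ℝ) × (Fin n → ℝ) × (Fin n → ℝ) =>
      ω.1 + (ω.2.1 + ω.2.2)) (by fun_prop) {z | d (x m + z) ≠ m}

/-! ### Capacity -/

theorem half_log_pos {x : ℝ} (hx : 0 < x) : 0 < 1 / 2 * Real.log (1 + x) :=
  mul_pos (by norm_num) (Real.log_pos (by linarith))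

theorem half_log_le_half_log {x y : ℝ} (hx : 0 < x) (hxy : x ≤ y) :
    1 / 2 * Real.log x ≤ 1 / 2 * Real.log y :=
  mul_le_mul_of_nonneg_left (Real.log_le_log hx hxy) (by norm_num)

theorem achievable_of_power_lt {P₁ P₂ Q N₂ N₃ P a R : ℝ} (hP₁ : 0 < P₁) (hP : 0 < P)
    (hQ : 0 ≤ Q) (hN₂ : 0 < N₂) (hN₂₃ : N₂ ≤ N₃) (hpow : P + a ^ 2 * Q < P₂)
    (hR : R < 1 / 2 * Real.log (1 + P₁ / N₂))
    (hR' : R < 1 / 2 * Real.log (1 + P₁ / (P + (1 + a) ^ 2 * Q + N₃)) +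
      1 / 2 * Real.log (1 + P / N₃)) :
    Achievable P₁ P₂ Q N₂ N₃ R := by
  have hN₃ : 0 < N₃ := hN₂.trans_le hN₂₃
  have hC : 0 < 1 / 2 * Real.log (1 + P₁ / N₂) := half_log_pos (by positivity)
  have h1 : 0 < 1 / 2 * Real.log (1 + P₁ / (P + (1 + a) ^ 2 * Q + N₃)) :=
    half_log_pos (by positivity)
  have h2 : 0 < 1 / 2 * Real.log (1 + P / N₃) := half_log_pos (by positivity)
  have key : ∀ f₁ f₂ : ℝ, f₁ = 1 / 2 * Real.log (1 + P₁ / (P + (1 + a) ^ 2 * Q + N₃)) →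
      f₂ = 1 / 2 * Real.log (1 + P / N₃) → Achievable P₁ P₂ Q N₂ N₃ R := by
    intro f₁ f₂ e₁ e₂
    rw [← e₁] at h1
    rw [← e₂] at h2
    rw [← e₁, ← e₂] at hR'
    have hf : 0 < f₁ + f₂ := add_pos h1 h2
    -- A rate between the target and all limits is split in proportion to the two destination terms,
    -- so each part stays strictly below its term.
    obtain ⟨R', hRR', hR'lt⟩ := exists_between (max_lt (lt_min hR hR') (lt_min hC hf))
    rw [max_lt_iff] at hRR'
    rw [lt_min_iff] at hR'lt
    have hq : R' / (f₁ + f₂) < 1 := (div_lt_one hf).2 hR'lt.2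
    have hq0 : 0 ≤ R' / (f₁ + f₂) := div_nonneg hRR'.2.le hf.le
    have hsum : R' / (f₁ + f₂) * f₁ + R' / (f₁ + f₂) * f₂ = R' := by
      rw [← mul_add, div_mul_cancel₀ _ hf.ne']
    refine (achievable_of_lt_add (R := max R 0) hP₁ hP hQ hN₂ hN₂₃ hpow (mul_nonneg hq0 h1.le)
      (mul_nonneg hq0 h2.le) ?_ ?_ ?_ (le_max_right _ _) ?_).mono (le_max_left _ _)
    · rw [← e₁]
      exact mul_lt_of_lt_one_left h1 hq
    · rw [← e₂]
      exact mul_lt_of_lt_one_left h2 hq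
    · rw [hsum]
      exact hR'lt.1
    · rw [hsum]
      exact max_lt hRR'.1 hRR'.2
  exact key _ _ rfl rfl

/-- Reaches the boundary by continuity: scaling the input by `t < 1` and adding `(1 - t²) P₂ / 2` to
the power of `x` makes the power constraint strict and `x` nonzero, even if `P = 0`. -/
theorem achievable_of_power_le {P₁ P₂ Q N₂ N₃ P a R : ℝ} (hP₁ : 0 < P₁) (hP₂ : 0 < P₂) (hP : 0 ≤ P)
    (hQ : 0 ≤ Q) (hN₂ : 0 < N₂) (hN₂₃ : N₂ ≤ N₃) (hpow : P + a ^ 2 * Q ≤ P₂)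
    (hR : R < 1 / 2 * Real.log (1 + P₁ / N₂))
    (hR' : R < 1 / 2 * Real.log (1 + P₁ / (P + (1 + a) ^ 2 * Q + N₃)) +
      1 / 2 * Real.log (1 + P / N₃)) :
    Achievable P₁ P₂ Q N₂ N₃ R := by
  have hN₃ : 0 < N₃ := hN₂.trans_le hN₂₃
  set p : ℝ → ℝ := fun t => t ^ 2 * P + (1 - t ^ 2) * (P₂ / 2) with hp
  have hp1 : p 1 = P := by simp [hp]
  have hpc : ContinuousAt p 1 := by fun_prop
  have hcont : ContinuousAt (fun t : ℝ =>
      1 / 2 * Real.log (1 + P₁ / (p t + (1 + t * a) ^ 2 * Q + N₃)) +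
        1 / 2 * Real.log (1 + p t / N₃)) 1 := by
    have hden : p 1 + (1 + 1 * a) ^ 2 * Q + N₃ ≠ 0 := by
      rw [hp1]
      positivity
    refine ContinuousAt.add (continuousAt_const.mul (ContinuousAt.log ?_ ?_))
      (continuousAt_const.mul (ContinuousAt.log ?_ ?_))
    · exact continuousAt_const.add (continuousAt_const.div (by fun_prop) hden)
    · rw [hp1]
      positivity
    · exact continuousAt_const.add (hpc.div_const _)
    · rw [hp1]
      positivity
  have hev := hcont.eventually_const_lt (u := R) (by simpa only [hp1, one_mul] using hR')
  have h01 : ∀ᶠ t : ℝ in 𝓝[<] 1, t ∈ Set.Ioo (0 : ℝ) 1 := Ioo_mem_nhdsLT (by norm_num)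
  obtain ⟨t, ht, ht0, ht1⟩ := ((hev.filter_mono nhdsWithin_le_nhds).and h01).exists
  have ht2 : t ^ 2 < 1 := by nlinarith
  refine achievable_of_power_lt hP₁ (P := p t) (a := t * a) ?_ hQ hN₂ hN₂₃ ?_ hR ht
  · have h1 : 0 < (1 - t ^ 2) * (P₂ / 2) := mul_pos (by linarith) (by linarith)
    have h2 : 0 ≤ t ^ 2 * P := by positivity
    simp only [hp]
    linarith
  · have h1 : t ^ 2 * (P + a ^ 2 * Q) ≤ t ^ 2 * P₂ := mul_le_mul_of_nonneg_left hpow (sq_nonneg t)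
    have h2 : 0 < (1 - t ^ 2) * P₂ := mul_pos (by linarith) hP₂
    simp only [hp]
    nlinarith

theorem power_add_state_eq {P₂ Q : ℝ} (hP₂ : 0 ≤ P₂) (hQ : 0 ≤ Q) (N₃ ζ : ℝ) :
    P₂ + Q + N₃ + 2 * ζ * √(P₂ * Q) = P₂ * (1 - ζ ^ 2) + (ζ * √P₂ + √Q) ^ 2 + N₃ := by
  rw [Real.sqrt_mul hP₂]
  have h1 := Real.sq_sqrt hP₂
  have h2 := Real.sq_sqrt hQ
  linear_combination (-ζ ^ 2) * h1 - h2

/-- Rates below both Gaussian terms are achievable when the relay input has correlation `ζ` with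
the state. -/
theorem achievable_of_lt {P₁ P₂ Q N₂ N₃ ζ R : ℝ} (hP₁ : 0 < P₁) (hP₂ : 0 ≤ P₂)
    (hQ : 0 ≤ Q) (hN₂ : 0 < N₂) (hN₂₃ : N₂ ≤ N₃) (hζ : ζ ∈ Set.Icc (-1 : ℝ) 0)
    (hR : R < 1 / 2 * Real.log (1 + P₁ / N₂))
    (hR' : R < 1 / 2 * Real.log (1 + P₁ / (P₂ + Q + N₃ + 2 * ζ * √(P₂ * Q))) +
      1 / 2 * Real.log (1 + P₂ * (1 - ζ ^ 2) / N₃)) :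
    Achievable P₁ P₂ Q N₂ N₃ R := by
  have hN₃ : 0 < N₃ := hN₂.trans_le hN₂₃
  have hζ2 : ζ ^ 2 ≤ 1 := by nlinarith [hζ.1, hζ.2]
  rcases hP₂.eq_or_lt with rfl | hP₂'
  · have hpos : 0 < 1 / 2 * Real.log (1 + P₁ / (Q + N₃)) := half_log_pos (by positivity)
    refine (achievable_of_relay_silent (R := max R 0) hP₁ le_rfl hQ hN₂ hN₂₃ (le_max_right _ _)
      (max_lt ?_ hpos)).mono (le_max_left _ _)
    simpa using hR'
  have hP : 0 ≤ P₂ * (1 - ζ ^ 2) := mul_nonneg hP₂ (by linarith)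
  rw [power_add_state_eq hP₂ hQ] at hR'
  -- Without state the coefficient `ζ √P₂ / √Q` is meaningless; `a = 0` does at least as well, as it
  -- leaves no interference.
  rcases hQ.eq_or_lt with rfl | hQ'
  · refine achievable_of_power_le hP₁ hP₂' hP le_rfl hN₂ hN₂₃ (a := 0) ?_ hR
      (hR'.trans_le (add_le_add_left ?_ _))
    · nlinarith [sq_nonneg ζ]
    · refine half_log_le_half_log (by positivity) ?_
      gcongr
      simp only [mul_zero]
      positivity
  · have hs : √Q ≠ 0 := (Real.sqrt_pos.2 hQ').ne'
    have e1 : (ζ * √P₂ / √Q) ^ 2 * Q = ζ ^ 2 * P₂ := by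
      rw [div_pow, mul_pow, Real.sq_sqrt hP₂, Real.sq_sqrt hQ]
      field_simp
    have e2 : (1 + ζ * √P₂ / √Q) ^ 2 * Q = (ζ * √P₂ + √Q) ^ 2 := by
      have : (1 + ζ * √P₂ / √Q) * √Q = ζ * √P₂ + √Q := by
        field_simp
        ring
      rw [← this, mul_pow, Real.sq_sqrt hQ]
    refine achievable_of_power_le hP₁ hP₂' hP hQ hN₂ hN₂₃ (a := ζ * √P₂ / √Q) ?_ hR ?_
    · rw [e1]
      linarith
    · rwa [e2]

/-- The codes work without state at the source and the converse holds with it, so both capacities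
are settled together. -/
theorem isCapacity_of_forall_lt {P₁ P₂ Q N₂ N₃ : ℝ} (hP₁ : 0 < P₁) (hN₂ : 0 < N₂)
    (h : ∀ R < 1 / 2 * Real.log (1 + P₁ / N₂), Achievable P₁ P₂ Q N₂ N₃ R) :
    IsCapacity P₁ P₂ Q N₂ N₃ (1 / 2 * Real.log (1 + P₁ / N₂)) ∧
      IsCapacityInformedSource P₁ P₂ Q N₂ N₃ (1 / 2 * Real.log (1 + P₁ / N₂)) := by
  refine ⟨⟨fun R hR => ?_, fun B hB => ?_⟩, ⟨fun R hR => ?_, fun B hB => ?_⟩⟩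
  · exact AchievableInformedSource.le hP₁ hN₂ (Achievable.informedSource hR)
  · exact le_of_forall_lt fun R hR => by
      obtain ⟨R', h1, h2⟩ := exists_between hR
      exact h1.trans_le (hB (h R' h2))
  · exact AchievableInformedSource.le hP₁ hN₂ hR
  · exact le_of_forall_lt fun R hR => by
      obtain ⟨R', h1, h2⟩ := exists_between hR
      exact h1.trans_le (hB (Achievable.informedSource (h R' h2)))

theorem achievable_of_mul_le {P₁ P₂ Q N₂ N₃ ζ : ℝ} (hP₁ : 0 < P₁) (hP₂ : 0 ≤ P₂)
    (hQ : 0 ≤ Q) (hN₂ : 0 < N₂) (hN₂₃ : N₂ ≤ N₃) (hζ : ζ ∈ Set.Icc (-1 : ℝ) 0)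
    (h : 1 + P₁ / N₂ ≤ (1 + P₁ / (P₂ + Q + N₃ + 2 * ζ * √(P₂ * Q))) *
      (1 + P₂ * (1 - ζ ^ 2) / N₃)) {R : ℝ} (hR : R < 1 / 2 * Real.log (1 + P₁ / N₂)) :
    Achievable P₁ P₂ Q N₂ N₃ R := by
  have hN₃ : 0 < N₃ := hN₂.trans_le hN₂₃
  have hP : 0 ≤ P₂ * (1 - ζ ^ 2) := mul_nonneg hP₂ (by nlinarith [hζ.1, hζ.2])
  refine achievable_of_lt hP₁ hP₂ hQ hN₂ hN₂₃ hζ hR (hR.trans_le ?_)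
  rw [power_add_state_eq hP₂ hQ] at h ⊢
  rw [← mul_add, ← Real.log_mul (by positivity) (by positivity)]
  exact half_log_le_half_log (by positivity) h

/-- `T(ζ) ≤ N₂` is this inequality after clearing denominators, with `V` for the interference power
and `p` for `P₂ (1 - ζ²)`. -/
theorem mul_le_of_threshold_le {P₁ P₂ Q N₂ N₃ ζ : ℝ} (hP₁ : 0 < P₁) (hP₂ : 0 ≤ P₂)
    (hQ : 0 ≤ Q) (hN₂ : 0 < N₂) (hN₃ : 0 < N₃) (hζ : ζ ∈ Set.Icc (-1 : ℝ) 0)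
    (h : threshold P₁ P₂ Q N₃ ζ ≤ N₂) :
    1 + P₁ / N₂ ≤ (1 + P₁ / (P₂ + Q + N₃ + 2 * ζ * √(P₂ * Q))) *
      (1 + P₂ * (1 - ζ ^ 2) / N₃) := by
  have hP : 0 ≤ P₂ * (1 - ζ ^ 2) := mul_nonneg hP₂ (by nlinarith [hζ.1, hζ.2])
  have hV : 0 < P₂ + Q + N₃ + 2 * ζ * √(P₂ * Q) := by
    rw [power_add_state_eq hP₂ hQ]
    positivity
  rw [threshold, show P₁ + P₂ + Q + N₃ + 2 * ζ * √(P₂ * Q) =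
    P₁ + (P₂ + Q + N₃ + 2 * ζ * √(P₂ * Q)) by ring] at h
  generalize P₂ + Q + N₃ + 2 * ζ * √(P₂ * Q) = V at h hV ⊢
  generalize P₂ * (1 - ζ ^ 2) = p at h hP ⊢
  rw [div_le_iff₀ (by positivity)] at h
  have e : (1 + P₁ / V) * (1 + p / N₃) - (1 + P₁ / N₂) =
      (N₂ * (P₁ * N₃ + p * (P₁ + V)) - P₁ * N₃ * V) / (V * N₃ * N₂) := by
    field_simp
    ring
  rw [← sub_nonneg, e]
  exact div_nonneg (by linarith) (by positivity)

/-- Dropping `(ζ √P₂ + √Q)²` from the denominator only helps; the product then collapses to `1 + (P₁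
+ p) / N₃`, which increases with `p` up to `p = P₂`. -/
theorem mul_le_no_state {P₁ P₂ Q N₂ N₃ ζ : ℝ} (hP₁ : 0 < P₁) (hP₂ : 0 ≤ P₂)
    (hQ : 0 ≤ Q) (hN₃ : 0 < N₃) (hζ : ζ ∈ Set.Icc (-1 : ℝ) 0)
    (h : 1 + P₁ / N₂ ≤ (1 + P₁ / (P₂ + Q + N₃ + 2 * ζ * √(P₂ * Q))) *
      (1 + P₂ * (1 - ζ ^ 2) / N₃)) :
    1 + P₁ / N₂ ≤ (1 + P₁ / (P₂ + 0 + N₃ + 2 * 0 * √(P₂ * 0))) *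
      (1 + P₂ * (1 - (0 : ℝ) ^ 2) / N₃) := by
  have hP : 0 ≤ P₂ * (1 - ζ ^ 2) := mul_nonneg hP₂ (by nlinarith [hζ.1, hζ.2])
  have hP' : P₂ * (1 - ζ ^ 2) ≤ P₂ := by nlinarith [sq_nonneg ζ]
  have h1 : ∀ p : ℝ, 0 ≤ p → (1 + P₁ / (p + N₃)) * (1 + p / N₃) = 1 + (P₁ + p) / N₃ := by
    intro p hp
    field_simp
    ring
  rw [power_add_state_eq hP₂ hQ] at h
  calc 1 + P₁ / N₂ ≤ _ := h
    _ ≤ (1 + P₁ / (P₂ * (1 - ζ ^ 2) + N₃)) * (1 + P₂ * (1 - ζ ^ 2) / N₃) := by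
        gcongr
        exact le_add_of_nonneg_right (sq_nonneg _)
    _ = 1 + (P₁ + P₂ * (1 - ζ ^ 2)) / N₃ := h1 _ hP
    _ ≤ 1 + (P₁ + P₂) / N₃ := by gcongr
    _ = _ := by
        rw [← h1 P₂ hP₂]
        simp

/-- If the relay noise is above the threshold at some `ζ`, the source-to-relay link is the
bottleneck. -/
theorem isCapacity_of_threshold_le {P₁ P₂ Q N₂ N₃ ζ : ℝ} (hP₁ : 0 < P₁) (hP₂ : 0 ≤ P₂)
    (hQ : 0 ≤ Q) (hN₂ : 0 < N₂) (hN₂₃ : N₂ ≤ N₃) (hζ : ζ ∈ Set.Icc (-1 : ℝ) 0)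
    (h : threshold P₁ P₂ Q N₃ ζ ≤ N₂) :
    IsCapacity P₁ P₂ Q N₂ N₃ (1 / 2 * Real.log (1 + P₁ / N₂)) ∧
      IsCapacityInformedSource P₁ P₂ Q N₂ N₃ (1 / 2 * Real.log (1 + P₁ / N₂)) ∧
      IsCapacity P₁ P₂ 0 N₂ N₃ (1 / 2 * Real.log (1 + P₁ / N₂)) := by
  have hN₃ : 0 < N₃ := hN₂.trans_le hN₂₃
  have h1 := mul_le_of_threshold_le hP₁ hP₂ hQ hN₂ hN₃ hζ h
  have h2 := mul_le_no_state hP₁ hP₂ hQ hN₃ hζ h1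
  have h3 := isCapacity_of_forall_lt hP₁ hN₂ fun R hR =>
    achievable_of_mul_le hP₁ hP₂ hQ hN₂ hN₂₃ hζ h1 hR
  have h4 := isCapacity_of_forall_lt hP₁ hN₂ fun R hR =>
    achievable_of_mul_le hP₁ hP₂ le_rfl hN₂ hN₂₃ (ζ := 0) ⟨by norm_num, le_rfl⟩ h2 hR
  exact ⟨h3.1, h3.2, h4.1⟩

/-! ### Tightness of the lower bound -/

theorem isCapacity_relay_silent {P₁ Q N₂ N₃ : ℝ} (hP₁ : 0 < P₁) (hQ : 0 ≤ Q)
    (hN₂ : 0 < N₂) (hN₂₃ : N₂ ≤ N₃) :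
    IsCapacity P₁ 0 Q N₂ N₃ (1 / 2 * Real.log (1 + P₁ / (Q + N₃))) := by
  have hN₃ : 0 < N₃ := hN₂.trans_le hN₂₃
  refine ⟨fun R hR => Achievable.le_of_relay_silent hP₁ hQ hN₂ hN₂₃ hR, fun B hB => ?_⟩
  have hpos : 0 < 1 / 2 * Real.log (1 + P₁ / (Q + N₃)) := half_log_pos (by positivity)
  refine le_of_forall_lt fun R hR => ?_
  obtain ⟨R', h1, h2⟩ := exists_between (max_lt hR hpos)
  exact ((le_max_left _ _).trans_lt h1).trans_le (hB
    (achievable_of_relay_silent hP₁ le_rfl hQ hN₂ hN₂₃ ((le_max_right _ _).trans h1.le) h2))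

/-- With `P₂ = 0` the second term is constant in all parameters, and at `r = 0` the first is no
smaller since `N₂ ≤ Q + N₃`. -/
theorem lowerBound_relay_silent {P₁ Q N₂ N₃ : ℝ} (hP₁ : 0 < P₁) (hQ : 0 ≤ Q)
    (hN₂ : 0 < N₂) (hN₂₃ : N₂ ≤ N₃) :
    lowerBound P₁ 0 Q N₂ N₃ = 1 / 2 * Real.log (1 + P₁ / (Q + N₃)) := by
  have hN₃ : 0 < N₃ := hN₂.trans_le hN₂₃
  have hne : (Set.Icc (0 : ℝ) 1 ×ˢ Set.Icc (-1 : ℝ) 0).Nonempty := ⟨(0, 0), by simp⟩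
  have e : ∀ r : ℝ, sSup ((fun p : ℝ × ℝ => lowerSecond P₁ 0 Q N₃ r p.1 p.2) ''
      (Set.Icc 0 1 ×ˢ Set.Icc (-1) 0)) = 1 / 2 * Real.log (1 + P₁ / (Q + N₃)) := fun r => by
    have : (fun p : ℝ × ℝ => lowerSecond P₁ 0 Q N₃ r p.1 p.2) =
        fun _ => 1 / 2 * Real.log (1 + P₁ / (Q + N₃)) := by
      funext p
      simp [lowerSecond]
    rw [this, hne.image_const, csSup_singleton]
  rw [lowerBound]
  simp only [e]
  refine IsGreatest.csSup_eq ⟨⟨0, by simp, min_eq_right ?_⟩, ?_⟩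
  · rw [lowerFirst]
    refine half_log_le_half_log (by positivity) ?_
    simp only [ne_eq, OfNat.ofNat_ne_zero, not_false_eq_true, zero_pow, sub_zero, mul_one]
    gcongr
    linarith
  · rintro _ ⟨r, -, rfl⟩
    exact min_le_right _ _

theorem lowerBound_eq_of_noise_eq {P₁ Q N : ℝ} (hP₁ : 0 < P₁) (hQ : 0 ≤ Q) (hN : 0 < N) :
    lowerBound P₁ Q Q N N = 1 / 2 * Real.log (1 + P₁ / N) := by
  refine IsGreatest.csSup_eq ⟨⟨0, by simp, ?_⟩, ?_⟩
  · have e : lowerFirst P₁ N 0 = 1 / 2 * Real.log (1 + P₁ / N) := by simp [lowerFirst]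
    simp only [e]
    -- The choice `θ = 1`, `t = -1` cancels the state exactly. Boundedness has to be proved because
    -- the supremum of an unbounded real set is `0` by convention.
    refine min_eq_left (le_csSup ?_ ⟨(1, -1), by simp, ?_⟩)
    · refine ⟨1 / 2 * Real.log (1 + (P₁ + Q) / N) + 1 / 2 * Real.log (1 + Q / N), ?_⟩
      rintro _ ⟨⟨θ, t⟩, ⟨hθ, ht⟩, rfl⟩
      have hθQ : 0 ≤ θ * Q := mul_nonneg hθ.1 hQ
      have hθQ' : 0 ≤ (1 - θ) * Q := mul_nonneg (sub_nonneg.2 hθ.2) hQ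
      have ht1 : 0 ≤ 1 - t ^ 2 := by nlinarith [ht.1, ht.2]
      have hden : N ≤ θ * Q + Q + N + 2 * t * √(θ * Q * Q) := by
        rw [power_add_state_eq hθQ hQ]
        nlinarith [sq_nonneg (t * √(θ * Q) + √Q), mul_nonneg hθQ ht1]
      simp only [lowerSecond, mul_zero, zero_mul, add_zero]
      have hnum : 0 ≤ P₁ + (1 - θ) * Q := by linarith
      refine add_le_add (half_log_le_half_log ?_ ?_) (half_log_le_half_log ?_ ?_)
      · have := div_nonneg hnum (hN.le.trans hden)
        linarith
      · gcongr
        nlinarith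
      · positivity
      · have h2 : θ * Q * (1 - t ^ 2) ≤ Q := by
          have h3 : θ * Q ≤ Q := by linarith
          nlinarith [mul_nonneg hθQ (sq_nonneg t)]
        gcongr
    · have hs : √(Q * Q) = Q := Real.sqrt_mul_self hQ
      simp only [lowerSecond, one_mul, hs]
      norm_num
      congr 3
      ring
  · rintro _ ⟨r, hr, rfl⟩
    refine (min_le_left _ _).trans (half_log_le_half_log ?_ ?_)
    · have : 0 ≤ 1 - r ^ 2 := by nlinarith [hr.1, hr.2]
      positivity
    · gcongr
      nlinarith [sq_nonneg r]

theorem isCapacity_of_noise_eq {P₁ Q N : ℝ} (hP₁ : 0 < P₁) (hQ : 0 ≤ Q) (hN : 0 < N) :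
    IsCapacity P₁ Q Q N N (1 / 2 * Real.log (1 + P₁ / N)) := by
  refine (isCapacity_of_forall_lt hP₁ hN fun R hR => ?_).1
  refine achievable_of_mul_le hP₁ hQ hQ hN le_rfl (ζ := -1) ⟨le_rfl, by norm_num⟩ ?_ hR
  rw [Real.sqrt_mul_self hQ]
  refine le_of_eq ?_
  have : Q + Q + N + 2 * (-1) * Q = N := by ring
  rw [this]
  norm_num

/-! ### Maxima of the upper bound on the unit circle -/

/-- The common form of the functions maximized in the upper bounds. -/
def upperFunction (P₁ P₂ Q N₃ g : ℝ) (p : ℝ × ℝ) : ℝ :=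
  min (1 / 2 * Real.log (1 + P₁ * residualFraction p.1 p.2 * g))
    (upperSecond P₁ P₂ Q N₃ p.1 p.2)

theorem upperDegraded_eq (P₁ P₂ Q N₂ N₃ : ℝ) :
    upperDegraded P₁ P₂ Q N₂ N₃ = upperFunction P₁ P₂ Q N₃ (1 / N₂) := by
  funext p
  rw [upperDegraded, upperFunction, mul_one_div]

theorem upperGeneral_eq (P₁ P₂ Q N₂ N₃ : ℝ) :
    upperGeneral P₁ P₂ Q N₂ N₃ = upperFunction P₁ P₂ Q N₃ (1 / N₂ + 1 / N₃) := rfl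

/-- Elsewhere on the circle `X₁` is determined by `(X₂, S)`, the first term is zero, and the origin
does strictly better. -/
theorem eq_of_isMaxOn_upperFunction {P₁ P₂ Q N₃ g : ℝ} (hP₁ : 0 < P₁) (hP₂ : 0 ≤ P₂)
    (hN₃ : 0 < N₃) (hg : 0 < g) {p : ℝ × ℝ} (hp : p ∈ upperDomain)
    (hmax : IsMaxOn (upperFunction P₁ P₂ Q N₃ g) upperDomain p) (h1 : p.1 ^ 2 + p.2 ^ 2 = 1) :
    p = (0, -1) := by
  have hp2 : p.2 = -1 := by
    by_contra hne
    have h0 : ((0, 0) : ℝ × ℝ) ∈ upperDomain := by simp [upperDomain]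
    have hlt : p.2 ^ 2 < 1 := by
      have h2 : -1 < p.2 := lt_of_le_of_ne hp.2.1.1 (Ne.symm hne)
      nlinarith [hp.2.1.2]
    have hres : residualFraction p.1 p.2 = 0 := by
      rw [residualFraction, if_neg hne, show p.1 ^ 2 = 1 - p.2 ^ 2 by linarith,
        div_self (by linarith), sub_self]
    have hle : upperFunction P₁ P₂ Q N₃ g p ≤ 0 := by
      refine (min_le_left _ _).trans ?_
      simp [hres]
    have hpos : 0 < upperFunction P₁ P₂ Q N₃ g (0, 0) := by
      refine lt_min ?_ (add_pos_of_pos_of_nonneg ?_ ?_)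
      · refine half_log_pos ?_
        simp only [residualFraction]
        norm_num
        positivity
      · refine half_log_pos ?_
        have := Real.sqrt_pos.2 hP₁
        simp only [zero_mul, add_zero, ne_eq, OfNat.ofNat_ne_zero, not_false_eq_true, zero_pow,
          sub_zero, mul_one]
        positivity
      · refine mul_nonneg (by norm_num) (Real.log_nonneg ?_)
        simp only [ne_eq, OfNat.ofNat_ne_zero, not_false_eq_true, zero_pow, sub_zero, mul_one]
        have := div_nonneg hP₂ hN₃.le
        linarith
    exact absurd (hmax h0) (not_le.2 (hle.trans_lt hpos))
  refine Prod.ext ?_ hp2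
  rw [hp2] at h1
  exact pow_eq_zero_iff (two_ne_zero) |>.1 (by linarith)

/-- Moving away from `(0, -1)` at constant residual fraction raises the received power. -/
theorem exists_mem_upperDomain_lt {P₁ P₂ Q N₃ c : ℝ} (hP₁ : 0 < P₁) (hP₂ : 0 < P₂)
    (hN₃ : 0 < N₃) (hc0 : 0 < c) (hc1 : c < 1) :
    ∃ r ρ : ℝ, (r, ρ) ∈ upperDomain ∧ residualFraction r ρ = 1 - c ^ 2 ∧
      P₁ / ((√Q - √P₂) ^ 2 + N₃) < (√P₁ + r * √P₂) ^ 2 /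
        (P₂ * (1 - r ^ 2 - ρ ^ 2) + (√Q + ρ * √P₂) ^ 2 + N₃) := by
  have hs0 : 0 < √P₁ := Real.sqrt_pos.2 hP₁
  have hq0 : 0 < √P₂ := Real.sqrt_pos.2 hP₂
  have hs2 : √P₁ ^ 2 = P₁ := Real.sq_sqrt hP₁.le
  have hq2 : √P₂ ^ 2 = P₂ := Real.sq_sqrt hP₂.le
  have hu0 : 0 ≤ √Q := Real.sqrt_nonneg Q
  generalize √P₁ = s at *
  generalize √P₂ = q at *
  generalize √Q = u at *
  obtain ⟨D, hD⟩ : ∃ D, D = (u - q) ^ 2 + N₃ := ⟨_, rfl⟩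
  have hD0 : 0 < D := by rw [hD]; positivity
  rw [← hD]
  -- `2 q u δ²` is the actual growth bound of the denominator; the extra `q²` keeps `K` positive
  -- when `Q = 0`.
  obtain ⟨K, hK⟩ : ∃ K, K = 2 * q * u + q ^ 2 := ⟨_, rfl⟩
  have hK0 : 0 < K := by rw [hK]; positivity
  -- With `ρ = -1 + δ²` and `r = c √(1 - ρ²) ≥ c δ` the numerator gains at least `2 s c q δ`, the
  -- denominator at most `K δ²`; this condition on `δ` makes the gain prevail.
  obtain ⟨δ, hδ0, hδ1, hδ⟩ : ∃ δ : ℝ, 0 < δ ∧ δ < 1 ∧ s * K * δ < 2 * c * q * D := by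
    obtain ⟨δ, h0, h1⟩ := exists_between
      (lt_min one_pos (by positivity : 0 < 2 * c * q * D / (s * K)))
    rw [lt_min_iff, lt_div_iff₀ (by positivity)] at h1
    exact ⟨δ, h0, h1.1, by linarith⟩
  have hε0 : 0 < δ ^ 2 := by positivity
  have hε1 : δ ^ 2 < 1 := by nlinarith
  obtain ⟨ρ, hρ⟩ : ∃ ρ, ρ = -1 + δ ^ 2 := ⟨_, rfl⟩
  have hwδ : δ ^ 2 ≤ 1 - ρ ^ 2 := by
    rw [hρ]
    nlinarith
  have hw0 : 0 < 1 - ρ ^ 2 := hε0.trans_le hwδ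
  obtain ⟨r, hr⟩ : ∃ r, r = c * √(1 - ρ ^ 2) := ⟨_, rfl⟩
  have hr2 : r ^ 2 = c ^ 2 * (1 - ρ ^ 2) := by rw [hr, mul_pow, Real.sq_sqrt hw0.le]
  have hrδ : c * δ ≤ r := by
    rw [hr]
    refine mul_le_mul_of_nonneg_left ?_ hc0.le
    rwa [Real.le_sqrt hδ0.le hw0.le]
  have hr0 : 0 < r := (mul_pos hc0 hδ0).trans_le hrδ
  have hc2 : c ^ 2 ≤ 1 := by nlinarith
  have hdiff : r ^ 2 + ρ ^ 2 ≤ 1 := by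
    have := mul_le_mul_of_nonneg_right hc2 hw0.le
    linarith
  refine ⟨r, ρ, ⟨⟨hr0.le, ?_⟩, ⟨?_, ?_⟩, hdiff⟩, ?_, ?_⟩
  · exact (sq_le_one_iff₀ hr0.le).1 (by linarith [sq_nonneg ρ])
  · change -1 ≤ ρ
    linarith
  · change ρ ≤ 0
    linarith
  · rw [residualFraction, if_neg (fun h => by linarith), hr2, mul_div_cancel_right₀ _ hw0.ne']
  · obtain ⟨E, hE⟩ : ∃ E, E = P₂ * (1 - r ^ 2 - ρ ^ 2) + (u + ρ * q) ^ 2 + N₃ := ⟨_, rfl⟩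
    have hE0 : 0 < E := by
      have : 0 ≤ P₂ * (1 - r ^ 2 - ρ ^ 2) := mul_nonneg hP₂.le (by linarith)
      rw [hE]
      positivity
    have hED : E ≤ D + K * δ ^ 2 := by
      have h1 : P₂ * (1 - r ^ 2 - ρ ^ 2) ≤ q ^ 2 * (1 - ρ ^ 2) := by
        rw [hq2]
        exact mul_le_mul_of_nonneg_left (by linarith [sq_nonneg r]) hP₂.le
      have h2 : q ^ 2 * (1 - ρ ^ 2) + (u + ρ * q) ^ 2 + N₃ = D + 2 * q * u * δ ^ 2 := by
        rw [hD, hρ]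
        ring
      have h3 : 0 ≤ q ^ 2 * δ ^ 2 := by positivity
      rw [hE, hK]
      linarith
    rw [← hE, div_lt_div_iff₀ hD0 hE0]
    have h1 : s ^ 2 * (K * δ ^ 2) < 2 * s * (c * δ) * q * D := by
      have := mul_lt_mul_of_pos_right hδ (mul_pos hs0 hδ0)
      linarith
    have h2 : 2 * s * (c * δ) * q * D ≤ 2 * s * r * q * D := by gcongr
    have h3 : P₁ * E ≤ s ^ 2 * (D + K * δ ^ 2) := by
      rw [hs2]
      exact mul_le_mul_of_nonneg_left hED hP₁.le
    have h4 : 0 ≤ r ^ 2 * q ^ 2 * D := by positivity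
    linarith

theorem not_isMaxOn_upperFunction {P₁ P₂ Q N₃ g : ℝ} (hP₁ : 0 < P₁) (hP₂ : 0 < P₂)
    (hN₃ : 0 < N₃) (hg : 1 / ((√Q - √P₂) ^ 2 + N₃) < g) :
    ¬ IsMaxOn (upperFunction P₁ P₂ Q N₃ g) upperDomain (0, -1) := by
  intro hmax
  obtain ⟨D, hD⟩ : ∃ D, D = (√Q - √P₂) ^ 2 + N₃ := ⟨_, rfl⟩
  have hD0 : 0 < D := by rw [hD]; positivity
  rw [← hD] at hg
  have hg0 : 0 < g := (by positivity : 0 < 1 / D).trans hg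
  have hval : upperFunction P₁ P₂ Q N₃ g (0, -1) ≤ 1 / 2 * Real.log (1 + P₁ / D) := by
    refine (min_le_right _ _).trans_eq ?_
    simp only [upperSecond, zero_mul, add_zero, Real.sq_sqrt hP₁.le, neg_one_mul, ← sub_eq_add_neg]
    norm_num [hD]
  have hx : 1 / D / g < 1 := (div_lt_one hg0).2 hg
  -- The residual fraction drops from `1` to `1 - c²` off the point; `c²` is half of `1 - 1 / (D
  -- g)`, so the first term stays above the value at `(0, -1)`.
  obtain ⟨c, hc0, hc1, hcg⟩ : ∃ c : ℝ, 0 < c ∧ c < 1 ∧ 1 / D < (1 - c ^ 2) * g := by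
    have hx0 : 0 ≤ 1 / D / g := by positivity
    refine ⟨√((1 - 1 / D / g) / 2), Real.sqrt_pos.2 (by linarith), ?_, ?_⟩
    · rw [Real.sqrt_lt' one_pos]
      linarith
    · rw [Real.sq_sqrt (by linarith), ← div_lt_iff₀ hg0]
      linarith
  obtain ⟨r, ρ, hmem, hres, hfrac⟩ :=
    exists_mem_upperDomain_lt (Q := Q) hP₁ hP₂ hN₃ hc0 hc1
  rw [← hD] at hfrac
  have hlog : ∀ x : ℝ, P₁ / D < x →
      1 / 2 * Real.log (1 + P₁ / D) < 1 / 2 * Real.log (1 + x) := fun x hx =>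
    mul_lt_mul_of_pos_left (Real.log_lt_log (by positivity) (by linarith)) (by norm_num)
  have hgt : 1 / 2 * Real.log (1 + P₁ / D) < upperFunction P₁ P₂ Q N₃ g (r, ρ) := by
    refine lt_min (hlog _ ?_) ?_
    · simp only [hres]
      rw [mul_assoc, div_eq_mul_one_div]
      exact mul_lt_mul_of_pos_left hcg hP₁
    · rw [upperSecond]
      refine (hlog _ hfrac).trans_le (le_add_of_nonneg_right
        (mul_nonneg (by norm_num) (Real.log_nonneg ?_)))
      have h1 : r ^ 2 + ρ ^ 2 ≤ 1 := hmem.2.2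
      have h2 : 0 ≤ P₂ * (1 - r ^ 2 - ρ ^ 2) / N₃ :=
        div_nonneg (mul_nonneg hP₂.le (by linarith)) hN₃.le
      exact le_add_of_nonneg_right h2
  exact absurd (hmax hmem) (not_le.2 (hval.trans_lt hgt))

/-- For `P₂ > 0` maximality gives `(√Q - √P₂)² + N₃ ≤ 1 / g ≤ N₂ ≤ N₃`, which forces `P₂ = Q` and
`N₂ = N₃`; only this case and `P₂ = 0` need evaluation. -/
theorem isCapacity_lowerBound {P₁ P₂ Q N₂ N₃ g : ℝ} (hP₁ : 0 < P₁) (hP₂ : 0 ≤ P₂)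
    (hQ : 0 ≤ Q) (hN₂ : 0 < N₂) (hN₂₃ : N₂ ≤ N₃) (hg : 1 / N₂ ≤ g) {p : ℝ × ℝ}
    (hp : p ∈ upperDomain) (hmax : IsMaxOn (upperFunction P₁ P₂ Q N₃ g) upperDomain p)
    (h1 : p.1 ^ 2 + p.2 ^ 2 = 1) :
    IsCapacity P₁ P₂ Q N₂ N₃ (lowerBound P₁ P₂ Q N₂ N₃) := by
  have hN₃ : 0 < N₃ := hN₂.trans_le hN₂₃
  have hg0 : 0 < g := (one_div_pos.2 hN₂).trans_le hg
  rcases hP₂.eq_or_lt with rfl | hP₂'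
  · rw [lowerBound_relay_silent hP₁ hQ hN₂ hN₂₃]
    exact isCapacity_relay_silent hP₁ hQ hN₂ hN₂₃
  rw [eq_of_isMaxOn_upperFunction hP₁ hP₂ hN₃ hg0 hp hmax h1] at hmax
  have hD : g ≤ 1 / ((√Q - √P₂) ^ 2 + N₃) :=
    not_lt.1 fun h => not_isMaxOn_upperFunction hP₁ hP₂' hN₃ h hmax
  have hle : (√Q - √P₂) ^ 2 + N₃ ≤ N₂ :=
    (one_div_le_one_div hN₂ (by positivity)).1 (hg.trans hD)
  have hsq : (√Q - √P₂) ^ 2 = 0 := le_antisymm (by linarith) (sq_nonneg _)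
  have hN : N₃ = N₂ := le_antisymm (by linarith) hN₂₃
  have hPQ : P₂ = Q := by
    have : √Q = √P₂ := sub_eq_zero.1 (pow_eq_zero_iff two_ne_zero |>.1 hsq)
    exact ((Real.sqrt_inj hQ hP₂).1 this).symm
  subst hPQ hN
  rw [lowerBound_eq_of_noise_eq hP₁ hQ hN₂]
  exact isCapacity_of_noise_eq hP₁ hQ hN₂

end GaussianRelay

end

end

/-! ### The theorem -/

theorem proposition1 (P₁ P₂ Q N₂ N₃ : ℝ) (hP₁ : 0 < P₁) (hP₂ : 0 ≤ P₂) (hQ : 0 ≤ Q)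
    (hN₂ : 0 < N₂) (hN₂₃ : N₂ ≤ N₃) :
    ((∃ T, IsGreatest (GaussianRelay.threshold P₁ P₂ Q N₃ '' Set.Icc (-1) 0) T ∧ T ≤ N₂) →
      GaussianRelay.IsCapacity P₁ P₂ Q N₂ N₃ (1 / 2 * Real.log (1 + P₁ / N₂)) ∧
      GaussianRelay.IsCapacityInformedSource P₁ P₂ Q N₂ N₃ (1 / 2 * Real.log (1 + P₁ / N₂)) ∧
      GaussianRelay.IsCapacity P₁ P₂ 0 N₂ N₃ (1 / 2 * Real.log (1 + P₁ / N₂))) ∧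
    ((∃ ζ ∈ Set.Icc (-1 : ℝ) 0, GaussianRelay.threshold P₁ P₂ Q N₃ ζ ≤ N₂) →
      GaussianRelay.IsCapacity P₁ P₂ Q N₂ N₃ (1 / 2 * Real.log (1 + P₁ / N₂)) ∧
      GaussianRelay.IsCapacityInformedSource P₁ P₂ Q N₂ N₃ (1 / 2 * Real.log (1 + P₁ / N₂)) ∧
      GaussianRelay.IsCapacity P₁ P₂ 0 N₂ N₃ (1 / 2 * Real.log (1 + P₁ / N₂))) ∧
    (∀ p ∈ GaussianRelay.upperDomain,
      (IsMaxOn (GaussianRelay.upperDegraded P₁ P₂ Q N₂ N₃) GaussianRelay.upperDomain p ∨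
        IsMaxOn (GaussianRelay.upperGeneral P₁ P₂ Q N₂ N₃) GaussianRelay.upperDomain p) →
      p.1 ^ 2 + p.2 ^ 2 = 1 →
      GaussianRelay.IsCapacity P₁ P₂ Q N₂ N₃ (GaussianRelay.lowerBound P₁ P₂ Q N₂ N₃)) := by
  refine ⟨?_, ?_, ?_⟩
  · rintro ⟨T, hT, hTN⟩
    -- The maximum of the threshold dominates its value at any point; `ζ = 0` serves.
    have h0 : (0 : ℝ) ∈ Set.Icc (-1 : ℝ) 0 := ⟨by norm_num, le_rfl⟩
    exact GaussianRelay.isCapacity_of_threshold_le hP₁ hP₂ hQ hN₂ hN₂₃ h0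
      ((hT.2 ⟨0, h0, rfl⟩).trans hTN)
  · rintro ⟨ζ, hζ, h⟩
    exact GaussianRelay.isCapacity_of_threshold_le hP₁ hP₂ hQ hN₂ hN₂₃ hζ h
  · rintro p hp (hmax | hmax) h1
    · rw [GaussianRelay.upperDegraded_eq] at hmax
      exact GaussianRelay.isCapacity_lowerBound hP₁ hP₂ hQ hN₂ hN₂₃ le_rfl hp hmax h1
    · rw [GaussianRelay.upperGeneral_eq] at hmax
      exact GaussianRelay.isCapacity_lowerBound hP₁ hP₂ hQ hN₂ hN₂₃
        (le_add_of_nonneg_right (one_div_nonneg.2 (hN₂.le.trans hN₂₃))) hp hmax h1
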